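/- **Setting.** Let $\Omega\subset\mathbb R^N$ be open and bounded, $T>0$, $\Omega_T=\Omega\times(0,T]$. For $i=1,\dots,N$ let $1<p_i\le q_i$ and $m_i,n_i>0$ with $\lambda_i:=m_i(p_i-1)\le\Lambda_i:=n_i(q_i-1)$. Put $$m=\min_i\min(m_i,n_i),\quad q=\max_i q_i,\quad \Lambda=\max_i\Lambda_i,\quad \frac1p=\frac1N\sum_i\frac1{p_i},\quad \Big|\frac\lambda p\Big|=\frac1N\sum_i\frac{\lambda_i}{p_i},$$ $$\mathcal L=\max(1,\Lambda),\qquad \mathcal M=p\Big|\frac\lambda p\Big|+(m+1)\frac pN,\qquad \varkappa_s=p(s+1-\mathcal L)+N\Big(p\Big|\frac\lambda p\Big|-\mathcal L\Big),$$ and assume $p<N$. For $\vec r\in(0,\infty)^N$ and $\eta>0$ let $K_{\vec r}(y)=\{x:|x_i-y_i|<r_i\ \forall i\}$ and $Q_{\vec r,\eta}(y,\tau)=K_{\vec r}(y)\times(\tau-\eta,\tau)$. Let $g(a,b)=\frac1m\int_b^a z^{\frac1m-1}(z-b)_+\,dz$. **The class.** For $C>0$, a measurable function $u\ge0$ on $\Omega_T$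 belongs to $\mathcal{PDG}^+(\Omega_T)=\mathcal{PDG}^+(\Omega_T,C)$ if $u\in C_{loc}(0,T;L^{1+m}_{loc}(\Omega))$; if for every $i$ the functions $u^{(\lambda_i+m)/p_i}$, $u^{(\Lambda_i+m)/p_i}$ and the weak derivative $D_i\big(u^{(\lambda_i+m)/p_i}\big)$ belong to $L^{p_i}(0,T;L^{p_i}_{loc}(\Omega))$; and if for every $k>0$, every cylinder with $Q_{8\vec r,8\eta}(y,\tau)\subset\Omega_T$ and every piecewise smooth $\zeta$ with $0\le\zeta\le1$ that vanishes on $\partial K_{\vec r}(y)\times[\tau-\eta,\tau]$, $$\sup_{\tau-\eta\le t\le\tau}\int_{K_{\vec r}(y)\times\{t\}}g(u^m,k^m)\zeta^q\,dx+\frac1C\sum_i\iint_{Q_{\vec r,\eta}(y,\tau)}u^{(m_i-m)(p_i-1)}|D_i(u^m-k^m)_+|^{p_i}\zeta^q\,dx\,dt$$ $$\le\int_{K_{\vec r}(y)\times\{\tau-\eta\}}g(u^m,k^m)\zeta^q\,dx+C\iint_{Q_{\vec r,\eta}(y,\tau)}g(u^m,k^m)|\zeta_t|\,dx\,dt$$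 $$+C\sum_i\iint_{Q_{\vec r,\eta}(y,\tau)}\Big[u^{(m_i-m)(p_i-1)}(u^m-k^m)_+^{p_i}|D_i\zeta|^{p_i}+u^{(n_i-m)(q_i-1)}(u^m-k^m)_+^{q_i}|D_i\zeta|^{q_i}\Big]dx\,dt.$$ **The quantities $\mathcal H$ and $\mathcal R$.** For $\theta>0$ and $\vec\rho\in(0,\infty)^N$, $$\mathcal H(\theta,\vec\rho)=\begin{cases}\frac1\theta,&\Lambda<1,\\ \frac1\theta+\sum_{\lambda_i=1}\rho_i^{-p_i}+\sum_{\Lambda_i=1}\rho_i^{-q_i},&\Lambda=1,\\ \sum_{\lambda_i=\Lambda}\rho_i^{-p_i}+\sum_{\Lambda_i=\Lambda}\rho_i^{-q_i},&\Lambda>1;\end{cases}$$ if $\Lambda\le1$, then $$\mathcal R(\theta,\vec\rho)=\sum_{i:\lambda_i<1}\Big(\frac{\theta}{\rho_i^{p_i}}\Big)^{\frac1{1-\lambda_i}}+\sum_{i:\Lambda_i<1}\Big(\frac{\theta}{\rho_i^{q_i}}\Big)^{\frac1{1-\Lambda_i}},$$ and if $\Lambda>1$, then $$\mathcal R(\theta,\vec\rho)=\sum_{\lambda_i=\Lambda}\Big(\frac{\rho_i^{p_i}}\theta\Big)^{\frac1{\Lambda-1}}+\sum_{\Lambda_i=\Lambda}\Big(\frac{\rho_i^{q_i}}\theta\Big)^{\frac1{\Lambda-1}}+\sum_{\lambda_i<\Lambda}\Big(\frac{\sigma_\lambda}{\rho_i^{p_i}}\Big)^{\frac1{\Lambda-\lambda_i}}+\sum_{\Lambda_i<\Lambda}\Big(\frac{\sigma_\Lambda}{\rho_i^{q_i}}\Big)^{\frac1{\Lambda-\Lambda_i}},$$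 where $\sigma_\Lambda=\sum_{\Lambda_l=\Lambda}\rho_l^{q_l}$, and $\sigma_\lambda=\sum_{\lambda_l=\Lambda}\rho_l^{p_l}$ if some $\lambda_l$ equals $\Lambda$, $\sigma_\lambda=\sigma_\Lambda$ if none does. **Theorem 1.2.** Let $\mathcal L\ge\mathcal M$, let $s>m+1$ satisfy $\varkappa_s>0$, and let $u\in\mathcal{PDG}^+(\Omega_T,C)\cap L^s_{loc}(\Omega_T)$. Then $u$ is locally (essentially) bounded in $\Omega_T$. Moreover, there is a constant $\gamma>0$ depending only on $s$ and on the data $C,N,p_i,q_i,m_i,n_i$ such that for every cylinder with $Q_{8\vec\rho,8\theta}(x_0,t_0)\subset\Omega_T$ $$\operatorname*{ess\,sup}_{Q_{\vec\rho/2,\theta/2}(x_0,t_0)}u\le\gamma\Big(\mathcal H(\theta,\vec\rho)^{\frac{N+p}p}\iint_{Q_{\vec\rho,\theta}(x_0,t_0)}u^s\,dx\,dt\Big)^{\frac p{\varkappa_s}}+\mathcal R(\theta,\vec\rho).$$ -/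

import Mathlib

open MeasureTheory Filter Topology Set
open scoped ContDiff

/-- Space `ℝ^N`, carrying Lebesgue measure (the norm on it plays no role). -/
abbrev Space (N : ℕ) : Type := Fin N → ℝ

/-- The parameters `p_i, q_i, m_i, n_i`, `i = 1, …, N`. -/
structure Exponents (N : ℕ) where
  p : Fin N → ℝ
  q : Fin N → ℝ
  m : Fin N → ℝ
  n : Fin N → ℝ

namespace Exponents

variable {N : ℕ}

/-- `m = min (m_1, …, m_N, n_1, …, n_N)`. -/
noncomputable def mMin (D : Exponents N) : ℝ := ⨅ i, min (D.m i) (D.n i)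

/-- `q = max (q_1, …, q_N)`. -/
noncomputable def qMax (D : Exponents N) : ℝ := ⨆ i, D.q i

/-- `λ_i = m_i (p_i - 1)`. -/
noncomputable def lam (D : Exponents N) (i : Fin N) : ℝ := D.m i * (D.p i - 1)

/-- `Λ_i = n_i (q_i - 1)`. -/
noncomputable def Lam (D : Exponents N) (i : Fin N) : ℝ := D.n i * (D.q i - 1)

/-- `Λ = max (Λ_1, …, Λ_N)`. -/
noncomputable def LamMax (D : Exponents N) : ℝ := ⨆ i, D.Lam i

/-- The harmonic mean `p` of the `p_i`: `1 / p = (1 / N) ∑ 1 / p_i`. -/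
noncomputable def pBar (D : Exponents N) : ℝ := ((1 / (N : ℝ)) * ∑ i, 1 / D.p i)⁻¹

/-- `|λ/p| = (1 / N) ∑ λ_i / p_i`. -/
noncomputable def lamOverP (D : Exponents N) : ℝ := (1 / (N : ℝ)) * ∑ i, D.lam i / D.p i

/-- `𝓛 = max (1, Λ)`. -/
noncomputable def calL (D : Exponents N) : ℝ := max 1 D.LamMax

/-- `𝓜 = p |λ/p| + (m + 1) p / N`. -/
noncomputable def calM (D : Exponents N) : ℝ :=
  D.pBar * D.lamOverP + (D.mMin + 1) * (D.pBar / N)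

/-- `κ_s = p (s + 1 - 𝓛) + N (p |λ/p| - 𝓛)`. -/
noncomputable def kappa (D : Exponents N) (s : ℝ) : ℝ :=
  D.pBar * (s + 1 - D.calL) + N * (D.pBar * D.lamOverP - D.calL)

/-- The standing assumptions on the parameters: `1 < p_i ≤ q_i`, `m > 0`, `λ_i ≤ Λ_i`, `p < N`. -/
structure Admissible (D : Exponents N) : Prop where
  one_lt_p : ∀ i, 1 < D.p i
  p_le_q : ∀ i, D.p i ≤ D.q i
  m_pos : ∀ i, 0 < D.m i
  n_pos : ∀ i, 0 < D.n i
  lam_le_Lam : ∀ i, D.lam i ≤ D.Lam i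
  pBar_lt : D.pBar < N

/-- The quantity `𝓗(θ, ρ)`. -/
noncomputable def calH (D : Exponents N) (θ : ℝ) (ρ : Fin N → ℝ) : ℝ :=
  if D.LamMax < 1 then 1 / θ
  else if D.LamMax = 1 then
    1 / θ + (∑ i with D.lam i = 1, 1 / ρ i ^ D.p i) + ∑ i with D.Lam i = 1, 1 / ρ i ^ D.q i
  else
    (∑ i with D.lam i = D.LamMax, 1 / ρ i ^ D.p i)
      + ∑ i with D.Lam i = D.LamMax, 1 / ρ i ^ D.q i

/-- `σ_Λ = ∑_{l : Λ_l = Λ} ρ_l ^ q_l`; its index set is never empty. -/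
noncomputable def sigmaLam (D : Exponents N) (ρ : Fin N → ℝ) : ℝ :=
  ∑ l with D.Lam l = D.LamMax, ρ l ^ D.q l

/-- `σ_λ = ∑_{l : λ_l = Λ} ρ_l ^ p_l` if some `λ_l` equals `Λ`, and `σ_λ = σ_Λ` otherwise. -/
noncomputable def sigmalam (D : Exponents N) (ρ : Fin N → ℝ) : ℝ :=
  open Classical in
  if ∃ l, D.lam l = D.LamMax then ∑ l with D.lam l = D.LamMax, ρ l ^ D.p l
  else D.sigmaLam ρ

/-- The quantity `𝓡(θ, ρ)`. -/
noncomputable def calR (D : Exponents N) (θ : ℝ) (ρ : Fin N → ℝ) : ℝ :=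
  if D.LamMax < 1 then
    (∑ i, (θ / ρ i ^ D.p i) ^ (1 / (1 - D.lam i)))
      + ∑ i, (θ / ρ i ^ D.q i) ^ (1 / (1 - D.Lam i))
  else if D.LamMax = 1 then
    (∑ i with D.lam i < 1, (θ / ρ i ^ D.p i) ^ (1 / (1 - D.lam i)))
      + ∑ i with D.Lam i < 1, (θ / ρ i ^ D.q i) ^ (1 / (1 - D.Lam i))
  else
    (∑ i with D.lam i = D.LamMax, (ρ i ^ D.p i / θ) ^ (1 / (D.LamMax - 1)))
      + (∑ i with D.Lam i = D.LamMax, (ρ i ^ D.q i / θ) ^ (1 / (D.LamMax - 1)))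
      + (∑ i with D.lam i < D.LamMax,
          (1 / ρ i ^ D.p i * D.sigmalam ρ) ^ (1 / (D.LamMax - D.lam i)))
      + ∑ i with D.Lam i < D.LamMax,
          (1 / ρ i ^ D.q i * D.sigmaLam ρ) ^ (1 / (D.LamMax - D.Lam i))

end Exponents

/-- The open box `K_r(y) = {x : |x_i - y_i| < r_i for all i}`. -/
def box {N : ℕ} (r : Fin N → ℝ) (y : Space N) : Set (Space N) := {x | ∀ i, |x i - y i| < r i}

/-- The cylinder `Q_{r,η}(y,τ) = K_r(y) × (τ - η, τ)`. -/
def cyl {N : ℕ} (r : Fin N → ℝ) (η : ℝ) (y : Space N) (τ : ℝ) : Set (Space N × ℝ) :=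
  box r y ×ˢ Ioo (τ - η) τ

/-- `Ω_T = Ω × (0, T]`. -/
def spaceTime {N : ℕ} (Ω : Set (Space N)) (T : ℝ) : Set (Space N × ℝ) := Ω ×ˢ Ioc 0 T

/-- The spatial partial derivative `D_i f`. -/
noncomputable def spaceDeriv {N : ℕ} (i : Fin N) (f : Space N × ℝ → ℝ) (z : Space N × ℝ) : ℝ :=
  fderiv ℝ f z (Pi.single i 1, 0)

/-- The time derivative `f_t`. -/
noncomputable def timeDeriv {N : ℕ} (f : Space N × ℝ → ℝ) (z : Space N × ℝ) : ℝ :=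
  fderiv ℝ f z (0, 1)

/-- `g` is the weak spatial partial derivative `D_i f` in the open space-time set `U`. -/
def HasWeakSpaceDeriv {N : ℕ} (U : Set (Space N × ℝ)) (i : Fin N) (f g : Space N × ℝ → ℝ) :
    Prop :=
  LocallyIntegrableOn f U ∧ LocallyIntegrableOn g U ∧
    ∀ φ : Space N × ℝ → ℝ, ContDiff ℝ ∞ φ → HasCompactSupport φ → tsupport φ ⊆ U →
      ∫ z in U, f z * spaceDeriv i φ z = -∫ z in U, g z * φ z

/-- `f ∈ L^r(0, T; L^r_loc(Ω))`. -/
def MemLpTimeLoc {N : ℕ} (r : ℝ) (Ω : Set (Space N)) (T : ℝ) (f : Space N × ℝ → ℝ) : Prop :=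
  ∀ K : Set (Space N), IsCompact K → K ⊆ Ω →
    MemLp f (ENNReal.ofReal r) (volume.restrict (K ×ˢ Ioo 0 T))

/-- `u ∈ C_loc(0, T; L^r_loc(Ω))`. -/
def MemCLocLpLoc {N : ℕ} (r : ℝ) (Ω : Set (Space N)) (T : ℝ) (u : Space N × ℝ → ℝ) : Prop :=
  ∀ K : Set (Space N), IsCompact K → K ⊆ Ω → ∀ t₀ ∈ Ioo 0 T,
    MemLp (fun x => u (x, t₀)) (ENNReal.ofReal r) (volume.restrict K) ∧
    Tendsto (fun t => eLpNorm (fun x => u (x, t) - u (x, t₀)) (ENNReal.ofReal r)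
      (volume.restrict K)) (𝓝 t₀) (𝓝 0)

/-- `u ∈ L^s_loc(Ω_T)`. -/
def MemLpLoc {N : ℕ} (s : ℝ) (Ω : Set (Space N)) (T : ℝ) (u : Space N × ℝ → ℝ) : Prop :=
  ∀ K : Set (Space N × ℝ), IsCompact K → K ⊆ spaceTime Ω T →
    MemLp u (ENNReal.ofReal s) (volume.restrict K)

/-- `u` is (essentially) bounded on every compact subset of `Ω_T`. -/
def LocallyBounded {N : ℕ} (Ω : Set (Space N)) (T : ℝ) (u : Space N × ℝ → ℝ) : Prop :=
  ∀ K : Set (Space N × ℝ), IsCompact K → K ⊆ spaceTime Ω T →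
    ∃ B : ℝ, ∀ᵐ z ∂(volume.restrict K), |u z| ≤ B

/-- The anisotropic energy space `𝓥_loc(Ω_T)`, for a non-negative `u`. -/
def MemVLoc {N : ℕ} (D : Exponents N) (Ω : Set (Space N)) (T : ℝ) (u : Space N × ℝ → ℝ) :
    Prop :=
  AEStronglyMeasurable u (volume.restrict (spaceTime Ω T)) ∧
  ∀ i,
    MemLpTimeLoc (D.p i) Ω T (fun z => u z ^ ((D.m i * (D.p i - 1) + D.mMin) / D.p i)) ∧
    MemLpTimeLoc (D.p i) Ω T (fun z => u z ^ ((D.n i * (D.q i - 1) + D.mMin) / D.p i)) ∧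
    ∃ v : Space N × ℝ → ℝ,
      HasWeakSpaceDeriv (Ω ×ˢ Ioo 0 T) i
        (fun z => u z ^ ((D.m i * (D.p i - 1) + D.mMin) / D.p i)) v ∧
      MemLpTimeLoc (D.p i) Ω T v

/-- `g(a, b) = (1/m) ∫_b^a z^(1/m - 1) (z - b)_+ dz`. -/
noncomputable def gFun (m a b : ℝ) : ℝ :=
  (1 / m) * ∫ z in b..a, z ^ (1 / m - 1) * max (z - b) 0

/-- Piecewise smooth on `S`: a continuous selection of finitely many smooth functions. -/
def PiecewiseSmoothOn {N : ℕ} (S : Set (Space N × ℝ)) (ζ : Space N × ℝ → ℝ) : Prop :=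
  ContinuousOn ζ S ∧ ∃ (k : ℕ) (f : Fin k → Space N × ℝ → ℝ),
    (∀ j, ContDiff ℝ ∞ (f j)) ∧ ∀ z ∈ S, ∃ j, ζ z = f j z

/-- Piecewise smooth cut-off functions in `Q_{r,η}(y,τ)` that vanish on `∂K_r(y)`. -/
structure IsCutoff {N : ℕ} (r : Fin N → ℝ) (η : ℝ) (y : Space N) (τ : ℝ)
    (ζ : Space N × ℝ → ℝ) : Prop where
  smooth : PiecewiseSmoothOn (closure (box r y) ×ˢ Icc (τ - η) τ) ζ
  mem_Icc : ∀ z ∈ closure (box r y) ×ˢ Icc (τ - η) τ, ζ z ∈ Icc (0 : ℝ) 1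
  eq_zero : ∀ z ∈ frontier (box r y) ×ˢ Icc (τ - η) τ, ζ z = 0

/-- The energy inequality at level `k` in `Q_{r,η}(y,τ)` with cut-off function `ζ`, where `w i`
stands for `D_i (u^m - k^m)_+`. All integrands are non-negative. -/
def EnergyIneq {N : ℕ} (D : Exponents N) (C k : ℝ) (u : Space N × ℝ → ℝ)
    (w : Fin N → Space N × ℝ → ℝ) (r : Fin N → ℝ) (η : ℝ) (y : Space N) (τ : ℝ)
    (ζ : Space N × ℝ → ℝ) : Prop :=
  (⨆ t ∈ Icc (τ - η) τ, ∫⁻ x in box r y,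
      ENNReal.ofReal (gFun D.mMin (u (x, t) ^ D.mMin) (k ^ D.mMin) * ζ (x, t) ^ D.qMax))
    + ENNReal.ofReal (1 / C) * ∑ i, ∫⁻ z in cyl r η y τ,
        ENNReal.ofReal (u z ^ ((D.m i - D.mMin) * (D.p i - 1)) * |w i z| ^ D.p i
          * ζ z ^ D.qMax)
  ≤ (∫⁻ x in box r y, ENNReal.ofReal
        (gFun D.mMin (u (x, τ - η) ^ D.mMin) (k ^ D.mMin) * ζ (x, τ - η) ^ D.qMax))
    + ENNReal.ofReal C * (∫⁻ z in cyl r η y τ, ENNReal.ofReal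
        (gFun D.mMin (u z ^ D.mMin) (k ^ D.mMin) * |timeDeriv ζ z|))
    + ENNReal.ofReal C * (∑ i, ∫⁻ z in cyl r η y τ, ENNReal.ofReal
        (u z ^ ((D.m i - D.mMin) * (D.p i - 1)) * max (u z ^ D.mMin - k ^ D.mMin) 0 ^ D.p i
          * |spaceDeriv i ζ z| ^ D.p i))
    + ENNReal.ofReal C * (∑ i, ∫⁻ z in cyl r η y τ, ENNReal.ofReal
        (u z ^ ((D.n i - D.mMin) * (D.q i - 1)) * max (u z ^ D.mMin - k ^ D.mMin) 0 ^ D.q i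
          * |spaceDeriv i ζ z| ^ D.q i))

/-- The parabolic De Giorgi class `PDG⁺(Ω_T, C)`. -/
structure PDGPlus {N : ℕ} (D : Exponents N) (C : ℝ) (Ω : Set (Space N)) (T : ℝ)
    (u : Space N × ℝ → ℝ) : Prop where
  nonneg : ∀ z ∈ spaceTime Ω T, 0 ≤ u z
  cont : MemCLocLpLoc (1 + D.mMin) Ω T u
  mem_V : MemVLoc D Ω T u
  energy : ∀ k : ℝ, 0 < k → ∃ w : Fin N → Space N × ℝ → ℝ,
    (∀ i, HasWeakSpaceDeriv (Ω ×ˢ Ioo 0 T) i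
      (fun z => max (u z ^ D.mMin - k ^ D.mMin) 0) (w i)) ∧
    ∀ (r : Fin N → ℝ) (η : ℝ) (y : Space N) (τ : ℝ), (∀ i, 0 < r i) → 0 < η →
      cyl (fun i => 8 * r i) (8 * η) y τ ⊆ spaceTime Ω T →
      ∀ ζ, IsCutoff r η y τ ζ → EnergyIneq D C k u w r η y τ ζ

/-! The proof is a De Giorgi iteration on the integrals Y_j of u^(𝓛+m) over the sets {u > k_j} in
shrinking cylinders, with levels k_j rising from k/2 to k.

Above a level comparable to 𝓡 the lower-order terms collapse into one. For a cut-off with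
derivatives of size 1/(ε ρ_i) and 1/(ε θ), the right side of the energy inequality is controlled by
the integral of u^m times u/θ + ∑ u^λ_i/ρ_i^p_i + ∑ u^Λ_i/ρ_i^q_i. The summands of 𝓡 are the heights
beyond which each of these terms is at most a multiple of 𝓗 u^𝓛 (`Exponents.Admissible.growth_le`).
Hence the energy is bounded by a multiple of X = ε^(-q) 𝓗 ∫ u^(𝓛+m), taken over {u > k}
(`exists_cutoff_energy_le`).

The gain comes from an anisotropic parabolic Sobolev inequality (`parabolic_embedding`). From the
bound on sup_t ∫ g and on the weighted gradients it produces ∫ u^(𝓜+m) ≤ const · X^(1+p/N) over a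
higher superlevel set in a smaller cylinder (`exists_superlevel_step`). It is proved by Gagliardo's
method: a weak derivative bounds the function by an integral along almost every coordinate line, the
N bounds are multiplied and integrated, and the unknown integral is absorbed. A different power of
the function is used in each direction, tuned so that the same quantity remains after Hölder's
inequality. The chain rule is needed only along lines, where the function is absolutely continuous,
so u is never approximated by smooth functions.

Since 𝓜 ≤ 𝓛 < s - m, interpolating the exponent 𝓛+m between 𝓜+m and s with weight t gives Y_{j+1} ≤
A b^j 𝓗^(1+δ) S^(1-t) Y_j^(1+δ), with S = ∫ u^s and 1+δ = (1+p/N) t. Here δ = κ_s / (N (s - 𝓜 - m)),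
which is where κ_s > 0 enters. Such a recursion forces Y_j → 0 once Y_0 is small
(`le_geometric_of_superlinear`). As Y_0 ≤ (k/2)^(𝓛+m-s) S, smallness amounts to k ≥ γ (𝓗^((N+p)/p)
S)^(p/κ_s) (`exists_ae_le_level`). Together with k ≥ 𝓡 this is the estimate, and a covering argument
gives local boundedness. -/

/-! ### Weak derivatives and absolute continuity along lines. -/

section Lines

variable {E : Type*} [NormedAddCommGroup E] [NormedSpace ℝ E] [FiniteDimensional ℝ E]
  [MeasurableSpace E] [BorelSpace E] {μ : Measure E} [μ.IsAddHaarMeasure]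

instance isFiniteMeasure_restrict_uIoc (a b : ℝ) :
    IsFiniteMeasure (volume.restrict (uIoc a b)) := ⟨by simp [uIoc]⟩

theorem integrable_prod_line {g : E → ℝ} (hg : Integrable g μ) (e : E) (a b : ℝ) :
    Integrable (fun q : ℝ × E => g (q.2 + q.1 • e))
      ((volume.restrict (uIoc a b)).prod μ) := by
  have hmp : MeasurePreserving (fun q : ℝ × E => (q.1, q.2 + q.1 • e))
      ((volume.restrict (uIoc a b)).prod μ) ((volume.restrict (uIoc a b)).prod μ) := by
    refine (MeasurePreserving.id _).skew_product (g := fun s z => z + s • e) (by fun_prop) ?_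
    exact Eventually.of_forall fun s => (measurePreserving_add_right μ (s • e)).map_eq
  have h2 : Integrable (fun q : ℝ × E => g q.2) ((volume.restrict (uIoc a b)).prod μ) :=
    hg.comp_snd _
  exact hmp.integrable_comp_of_integrable h2

/-- Both sides are tested against φ. Translations are moved onto φ, the difference φ(z - a e) - φ(z)
is written as an integral of directional derivatives, and after Fubini the weak derivative is
applied to each translate of φ. -/
theorem translate_sub_ae_eq_integral {f g : E → ℝ} (hf : Integrable f μ) (hg : Integrable g μ)
    (e : E)
    (hfg : ∀ φ : E → ℝ, ContDiff ℝ ∞ φ → HasCompactSupport φ →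
      ∫ z, f z * fderiv ℝ φ z e ∂μ = -∫ z, g z * φ z ∂μ) (a : ℝ) :
    ∀ᵐ z ∂μ, f (z + a • e) - f z = ∫ s in 0..a, g (z + s • e) := by
  have hprod := integrable_prod_line (μ := μ) hg e 0 a
  have hF : Integrable (fun z => ∫ s in 0..a, g (z + s • e)) μ := by
    simp_rw [intervalIntegral.intervalIntegral_eq_integral_uIoc]
    exact (hprod.integral_prod_right).smul (if (0:ℝ) ≤ a then (1:ℝ) else -1)
  have hT : ∀ s : ℝ, Integrable (fun z => f (z + s • e)) μ := fun s =>
    (measurePreserving_add_right μ (s • e)).integrable_comp_of_integrable hf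
  refine ae_eq_of_integral_contDiff_smul_eq ((hT a).sub hf).locallyIntegrable
    hF.locallyIntegrable fun φ hφ hφc => ?_
  have hφcont : Continuous φ := hφ.continuous
  obtain ⟨B, hB⟩ := hφc.exists_bound_of_continuous hφcont
  have hbdd : ∀ {w : E → ℝ} (_ : Integrable w μ) (s : ℝ),
      Integrable (fun z => φ (z - s • e) * w z) μ := fun hw s =>
    hw.bdd_mul (c := B) (by fun_prop) (Eventually.of_forall fun z => hB _)
  have hderiv : ∀ z s, HasDerivAt (fun s : ℝ => φ (z - s • e)) (-(fderiv ℝ φ (z - s • e) e)) s := by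
    intro z s
    have h1 : HasFDerivAt φ (fderiv ℝ φ (z - s • e)) (z - s • e) :=
      (hφ.differentiable (by simp)).differentiableAt.hasFDerivAt
    have h2 : HasDerivAt (fun s : ℝ => z - s • e) (-e) s := by
      simpa using ((hasDerivAt_id s).smul_const e).const_sub z
    simpa [Function.comp_def] using! h1.comp_hasDerivAt s h2
  have hfd : Continuous (fun z => fderiv ℝ φ z e) :=
    (hφ.continuous_fderiv (by simp)).clm_apply continuous_const
  have hfdc : HasCompactSupport (fun z => fderiv ℝ φ z e) := hφc.fderiv_apply ℝ e
  obtain ⟨B', hB'⟩ := hfdc.exists_bound_of_continuous hfd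
  have htrans : ∀ s : ℝ, ∫ z, f z * fderiv ℝ φ (z - s • e) e ∂μ = -∫ z, g z * φ (z - s • e) ∂μ := by
    intro s
    have := hfg (fun z => φ (z - s • e)) (hφ.comp (contDiff_id.sub contDiff_const))
      (hφc.comp_homeomorph (Homeomorph.subRight (s • e)))
    simpa [fderiv_comp_sub] using this
  calc ∫ z, φ z • (f (z + a • e) - f z) ∂μ
      = ∫ z, (φ (z - a • e) - φ z) * f z ∂μ := by
        have e1 : ∫ z, φ z * f (z + a • e) ∂μ = ∫ z, φ (z - a • e) * f z ∂μ := by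
          rw [← integral_add_right_eq_self (fun z => φ (z - a • e) * f z) (a • e)]
          simp
        have i1 : Integrable (fun z => φ z * f (z + a • e)) μ := by
          simpa using hbdd (hT a) 0
        have i2 : Integrable (fun z => φ z * f z) μ := by simpa using hbdd hf 0
        simp only [smul_eq_mul, mul_sub, sub_mul]
        rw [integral_sub i1 i2, integral_sub (hbdd hf a) i2, e1]
    _ = ∫ z, (∫ s in 0..a, -(fderiv ℝ φ (z - s • e) e) * f z) ∂μ := by
        refine integral_congr_ae (Eventually.of_forall fun z => ?_)
        simp only
        rw [intervalIntegral.integral_mul_const]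
        congr 1
        rw [intervalIntegral.integral_eq_sub_of_hasDerivAt (fun s _ => hderiv z s)]
        · simp
        · exact (Continuous.intervalIntegrable (by fun_prop) _ _)
    _ = ∫ s in 0..a, ∫ z, -(fderiv ℝ φ (z - s • e) e) * f z ∂μ := by
        simp_rw [intervalIntegral.intervalIntegral_eq_integral_uIoc]
        rw [integral_smul, integral_integral_swap]
        have hf2 : Integrable (fun q : E × ℝ => f q.1) (μ.prod (volume.restrict (uIoc 0 a))) :=
          hf.comp_fst _
        refine hf2.bdd_mul (c := B') ?_ ?_
        · exact (by fun_prop : Continuous (fun q : E × ℝ => -(fderiv ℝ φ (q.1 - q.2 • e) e))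
            ).aestronglyMeasurable
        · exact Eventually.of_forall fun q => by simpa using hB' _
    _ = ∫ s in 0..a, ∫ z, φ z * g (z + s • e) ∂μ := by
        refine intervalIntegral.integral_congr fun s _ => ?_
        have e1 : ∫ z, φ z * g (z + s • e) ∂μ = ∫ z, φ (z - s • e) * g z ∂μ := by
          rw [← integral_add_right_eq_self (fun z => φ (z - s • e) * g z) (s • e)]
          simp
        rw [e1]
        have h3 := htrans s
        have e2 : ∫ z, -(fderiv ℝ φ (z - s • e) e) * f z ∂μ
            = -∫ z, f z * fderiv ℝ φ (z - s • e) e ∂μ := by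
          rw [← integral_neg]; congr 1; ext z; ring
        rw [e2, h3, neg_neg]
        congr 1; ext z; ring
    _ = ∫ z, φ z • (∫ s in 0..a, g (z + s • e)) ∂μ := by
        simp_rw [intervalIntegral.intervalIntegral_eq_integral_uIoc, smul_eq_mul]
        rw [integral_integral_swap, ← integral_const_mul]
        · refine integral_congr_ae (Eventually.of_forall fun z => ?_)
          simp only
          rw [integral_const_mul]; ring
        · refine hprod.bdd_mul (c := B) ?_ ?_
          · exact (by fun_prop : Continuous (fun q : ℝ × E => φ q.2)).aestronglyMeasurable
          · exact Eventually.of_forall fun q => hB _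

/-- The translation formula holds for each fixed s and almost every z. Exchanging the two "almost
every" by Fubini gives, for almost every z, an absolutely continuous representative of f on the line
through z. -/
theorem ae_line_integral_rep {f g : E → ℝ} (hf : Integrable f μ) (hg : Integrable g μ)
    (hfm : Measurable f) (hgm : Measurable g) (e : E)
    (hfg : ∀ φ : E → ℝ, ContDiff ℝ ∞ φ → HasCompactSupport φ →
      ∫ z, f z * fderiv ℝ φ z e ∂μ = -∫ z, g z * φ z ∂μ) :
    ∀ᵐ z ∂μ, (∀ a b : ℝ, IntervalIntegrable (fun s : ℝ => g (z + s • e)) volume a b) ∧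
      ∀ᵐ s : ℝ, f (z + s • e) = f z + ∫ r in 0..s, g (z + r • e) := by
  have hint : ∀ᵐ z ∂μ, ∀ n : ℕ, IntegrableOn (fun s : ℝ => g (z + s • e)) (uIoc (-(n : ℝ)) n) := by
    rw [ae_all_iff]
    intro n
    have := (integrable_prod_line hg e (-(n : ℝ)) n).swap
    exact this.prod_right_ae
  have hloc : ∀ᵐ z ∂μ, ∀ a b : ℝ,
      IntervalIntegrable (fun s : ℝ => g (z + s • e)) volume a b := by
    filter_upwards [hint] with z hz a b
    obtain ⟨n, hn⟩ := exists_nat_ge (max |a| |b|)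
    rw [intervalIntegrable_iff]
    refine (hz n).mono_set ?_
    have ha := abs_le.1 ((le_max_left _ _).trans hn)
    have hb := abs_le.1 ((le_max_right _ _).trans hn)
    rw [uIoc, uIoc]
    refine Ioc_subset_Ioc ?_ ?_
    · exact (min_le_left _ _).trans (le_min ha.1 hb.1)
    · exact (max_le ha.2 hb.2).trans (le_max_right _ _)
  refine hloc.and ?_
  -- The oriented integral from 0 to s, written over all of ℝ with indicators so that its joint
  -- measurability in (z, s) follows from Fubini's theorem.
  let I : E × ℝ → ℝ := fun q => ∫ r : ℝ,
    ((Ioc 0 q.2).indicator (fun r => g (q.1 + r • e)) r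
      - (Ioc q.2 0).indicator (fun r => g (q.1 + r • e)) r)
  have hIm : Measurable I := by
    refine StronglyMeasurable.measurable ?_
    refine StronglyMeasurable.integral_prod_right
      (f := fun (q : E × ℝ) (r : ℝ) => (Ioc 0 q.2).indicator (fun r => g (q.1 + r • e)) r
      - (Ioc q.2 0).indicator (fun r => g (q.1 + r • e)) r) ?_
    refine Measurable.stronglyMeasurable ?_
    have hgq : Measurable (fun x : (E × ℝ) × ℝ => g (x.1.1 + x.2 • e)) :=
      hgm.comp (by fun_prop)
    have m1 : MeasurableSet {x : (E × ℝ) × ℝ | 0 < x.2 ∧ x.2 ≤ x.1.2} :=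
      (measurableSet_lt measurable_const measurable_snd).inter
        (measurableSet_le measurable_snd (by fun_prop))
    have m2 : MeasurableSet {x : (E × ℝ) × ℝ | x.1.2 < x.2 ∧ x.2 ≤ 0} :=
      (measurableSet_lt (by fun_prop) measurable_snd).inter
        (measurableSet_le measurable_snd measurable_const)
    exact (hgq.indicator m1).sub (hgq.indicator m2)
  have key : ∀ᵐ z ∂μ, ∀ᵐ s : ℝ, f (z + s • e) = f z + I (z, s) := by
    have hmeas : MeasurableSet {q : E × ℝ | f (q.1 + q.2 • e) = f q.1 + I q} :=
      measurableSet_eq_fun (hfm.comp (by fun_prop)) ((hfm.comp measurable_fst).add hIm)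
    rw [Measure.ae_ae_comm hmeas]
    refine Eventually.of_forall fun s => ?_
    filter_upwards [translate_sub_ae_eq_integral hf hg e hfg s, hloc] with z hz hzi
    have h1 : I (z, s) = ∫ r in 0..s, g (z + r • e) := by
      rw [intervalIntegral, ← integral_indicator measurableSet_Ioc,
        ← integral_indicator measurableSet_Ioc, ← integral_sub]
      · exact ((hzi 0 s).1.integrable_indicator measurableSet_Ioc)
      · exact ((hzi 0 s).2.integrable_indicator measurableSet_Ioc)
    rw [h1, ← hz]; ring
  filter_upwards [key, hloc] with z hz hzi
  filter_upwards [hz] with s hs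
  rw [hs]
  congr 1
  rw [intervalIntegral, ← integral_indicator measurableSet_Ioc,
    ← integral_indicator measurableSet_Ioc, ← integral_sub]
  · exact ((hzi 0 s).1.integrable_indicator measurableSet_Ioc)
  · exact ((hzi 0 s).2.integrable_indicator measurableSet_Ioc)

end Lines

theorem AbsolutelyContinuousOnInterval.comp_contDiff {F H : ℝ → ℝ} {a b : ℝ}
    (hH : AbsolutelyContinuousOnInterval H a b) (hF : ContDiff ℝ 1 F) :
    AbsolutelyContinuousOnInterval (fun s => F (H s)) a b := by
  obtain ⟨B, hB⟩ := hH.exists_bound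
  obtain ⟨K, hK⟩ := hF.contDiffOn.exists_lipschitzOnWith (s := Icc (-B) B) (by decide)
    (convex_Icc _ _) isCompact_Icc
  unfold AbsolutelyContinuousOnInterval at hH ⊢
  refine squeeze_zero' ?_ ?_ (by simpa using hH.const_mul (K : ℝ))
  · exact Eventually.of_forall fun _ => Finset.sum_nonneg fun i hi => dist_nonneg
  rw [eventually_inf_principal]
  filter_upwards with q hq
  rw [Finset.mul_sum]
  refine Finset.sum_le_sum fun i hi => ?_
  have h1 := hB _ (hq.1 i hi).1
  have h2 := hB _ (hq.1 i hi).2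
  rw [Real.norm_eq_abs, abs_le] at h1 h2
  exact hK.dist_le_mul _ h1 _ h2

/-- The product of ζ with F composed with the primitive of g is absolutely continuous, so its value
at 0 is the integral of its derivative from -L, where ζ vanishes. -/
theorem enorm_comp_integral_mul_le {F F' g ζ : ℝ → ℝ} {c L : ℝ} (hL : 0 ≤ L)
    (hF : ∀ y, HasDerivAt F (F' y) y) (hF' : Continuous F')
    (hg : ∀ a b : ℝ, IntervalIntegrable g volume a b)
    (hζ : ContDiff ℝ 1 ζ) (hζL : ζ (-L) = 0) :
    ‖F c * ζ 0‖ₑ ≤ ∫⁻ s, ‖F' (c + ∫ r in 0..s, g r) * g s * ζ s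
      + F (c + ∫ r in 0..s, g r) * deriv ζ s‖ₑ := by
  set H : ℝ → ℝ := fun s => c + ∫ r in 0..s, g r with hH
  have hFc : ContDiff ℝ 1 F := by
    rw [contDiff_one_iff_deriv]
    refine ⟨fun y => (hF y).differentiableAt, ?_⟩
    rwa [show deriv F = F' from funext fun y => (hF y).deriv]
  have hHac : AbsolutelyContinuousOnInterval H (-L) 0 := by
    have h0 : AbsolutelyContinuousOnInterval (fun _ : ℝ => c) (-L) 0 :=
      (contDiff_const.contDiffOn (n := 1)).absolutelyContinuousOnInterval
    exact h0.add ((hg (-L) 0).absolutelyContinuousOnInterval_intervalIntegral (by simp))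
  have hP := (hHac.comp_contDiff hFc).mul hζ.contDiffOn.absolutelyContinuousOnInterval
  have hftc := hP.integral_deriv_eq_sub
  have hH0 : H 0 = c := by simp [hH]
  have e1 : ∫ s in (-L)..0, deriv ((fun s => F (H s)) * ζ) s
      = ∫ s in (-L)..0, (F' (H s) * g s * ζ s + F (H s) * deriv ζ s) := by
    refine intervalIntegral.integral_congr_ae ?_
    filter_upwards [(hg (-L) 0).ae_hasDerivAt_integral] with s hs hsm
    have h1 : HasDerivAt H (g s) s := (hs (uIoc_subset_uIcc hsm) 0 (by simp)).const_add c
    have h2 : HasDerivAt (fun s => F (H s)) (F' (H s) * g s) s := (hF (H s)).comp s h1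
    exact (h2.mul ((hζ.differentiable (by simp)) s).hasDerivAt).deriv
  have e2 : F c * ζ 0 = ∫ s in (-L)..0, (F' (H s) * g s * ζ s + F (H s) * deriv ζ s) := by
    rw [← e1, hftc]; simp [hζL, hH0]
  rw [e2, intervalIntegral.integral_of_le (by linarith)]
  exact (enorm_integral_le_lintegral_enorm _).trans (lintegral_mono' Measure.restrict_le_self le_rfl)

theorem integrable_mul_of_locallyIntegrableOn {E : Type*} [NormedAddCommGroup E]
    [MeasurableSpace E] [BorelSpace E] {μ : Measure E} {U : Set E} {h χ : E → ℝ}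
    (hh : LocallyIntegrableOn h U μ) (hχ : Continuous χ) (hχc : HasCompactSupport χ)
    (hχU : tsupport χ ⊆ U) : Integrable (fun z => χ z * h z) μ := by
  have h1 : IntegrableOn h (tsupport χ) μ := hh.integrableOn_compact_subset hχU hχc
  obtain ⟨B, hB⟩ := hχc.exists_bound_of_continuous hχ
  have h2 : IntegrableOn (fun z => χ z * h z) (tsupport χ) μ :=
    h1.bdd_mul (c := B) hχ.aestronglyMeasurable (Eventually.of_forall hB)
  refine (integrableOn_iff_integrable_of_support_subset ?_).1 h2
  intro z hz
  exact subset_tsupport _ fun h0 => hz (by simp [h0])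

open scoped Manifold in
theorem exists_contDiff_cutoff {E : Type*} [NormedAddCommGroup E] [NormedSpace ℝ E]
    [FiniteDimensional ℝ E] {K U : Set E} (hK : IsCompact K) (hU : IsOpen U) (hKU : K ⊆ U) :
    ∃ χ : E → ℝ, ContDiff ℝ ∞ χ ∧ HasCompactSupport χ ∧ tsupport χ ⊆ U ∧ ∀ z ∈ K, χ z = 1 := by
  obtain ⟨L, hL, hKL, hLU⟩ := exists_compact_between hK hU hKU
  obtain ⟨χ, h1, -, h3, h4⟩ := exists_contMDiff_support_eq_eq_one_iff (n := ⊤) 𝓘(ℝ, E)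
    isOpen_interior hK.isClosed hKL
  have hsub : tsupport χ ⊆ L := by
    rw [tsupport, h3]
    exact closure_minimal interior_subset hL.isClosed
  exact ⟨χ, h1.contDiff, hL.of_isClosed_subset (isClosed_tsupport _) hsub, hsub.trans hLU,
    fun z hz => (h4 z).1 hz⟩

/-- The product rule for a cut-off: χ φ is an admissible test function in U, while the products with
χ live on the whole space. This globalises a local weak derivative. -/
theorem weak_deriv_cutoff_mul {E : Type*} [NormedAddCommGroup E] [NormedSpace ℝ E]
    [MeasurableSpace E] [BorelSpace E] {μ : Measure E} {U : Set E} {h w χ : E → ℝ} {e : E}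
    (hh : LocallyIntegrableOn h U μ) (hw : LocallyIntegrableOn w U μ)
    (hhw : ∀ φ : E → ℝ, ContDiff ℝ ∞ φ → HasCompactSupport φ → tsupport φ ⊆ U →
      ∫ z in U, h z * fderiv ℝ φ z e ∂μ = -∫ z in U, w z * φ z ∂μ)
    (hχ : ContDiff ℝ ∞ χ) (hχc : HasCompactSupport χ) (hχU : tsupport χ ⊆ U)
    (φ : E → ℝ) (hφ : ContDiff ℝ ∞ φ) (_ : HasCompactSupport φ) :
    ∫ z, (χ z * h z) * fderiv ℝ φ z e ∂μ
      = -∫ z, (χ z * w z + fderiv ℝ χ z e * h z) * φ z ∂μ := by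
  have hsup : ∀ z, z ∉ tsupport χ → χ z = 0 ∧ fderiv ℝ χ z e = 0 := fun z hz =>
    ⟨image_eq_zero_of_notMem_tsupport hz, by rw [fderiv_of_notMem_tsupport ℝ hz]; simp⟩
  have hd : Continuous fun z => fderiv ℝ χ z e :=
    (hχ.continuous_fderiv (by simp)).clm_apply continuous_const
  have hdφ : Continuous fun z => fderiv ℝ φ z e :=
    (hφ.continuous_fderiv (by simp)).clm_apply continuous_const
  have key := hhw (fun z => χ z * φ z) (hχ.mul hφ) (hχc.mul_right)
    ((tsupport_mul_subset_left).trans hχU)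
  have hprod : ∀ z, fderiv ℝ (fun z => χ z * φ z) z e
      = χ z * fderiv ℝ φ z e + φ z * fderiv ℝ χ z e := by
    intro z
    rw [fderiv_fun_mul (hχ.differentiable (by simp) z) (hφ.differentiable (by simp) z)]
    simp
  have iA : Integrable (fun z => (χ z * fderiv ℝ φ z e) * h z) μ :=
    integrable_mul_of_locallyIntegrableOn hh (hχ.continuous.mul hdφ) hχc.mul_right
      ((tsupport_mul_subset_left).trans hχU)
  have iB : Integrable (fun z => (fderiv ℝ χ z e * φ z) * h z) μ :=
    integrable_mul_of_locallyIntegrableOn hh (hd.mul hφ.continuous)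
      (hχc.fderiv_apply ℝ e).mul_right
      ((tsupport_mul_subset_left).trans ((tsupport_fderiv_apply_subset ℝ e).trans hχU))
  have iC : Integrable (fun z => (χ z * φ z) * w z) μ :=
    integrable_mul_of_locallyIntegrableOn hw (hχ.continuous.mul hφ.continuous) hχc.mul_right
      ((tsupport_mul_subset_left).trans hχU)
  have e1 : ∫ z in U, h z * fderiv ℝ (fun z => χ z * φ z) z e ∂μ
      = ∫ z, h z * fderiv ℝ (fun z => χ z * φ z) z e ∂μ := by
    refine setIntegral_eq_integral_of_forall_compl_eq_zero fun z hz => ?_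
    obtain ⟨h1, h2⟩ := hsup z fun h => hz (hχU h)
    simp [hprod, h1, h2]
  have e2 : ∫ z in U, w z * (χ z * φ z) ∂μ = ∫ z, w z * (χ z * φ z) ∂μ := by
    refine setIntegral_eq_integral_of_forall_compl_eq_zero fun z hz => ?_
    simp [(hsup z fun h => hz (hχU h)).1]
  rw [e1, e2] at key
  have e3 : ∫ z, h z * fderiv ℝ (fun z => χ z * φ z) z e ∂μ
      = ∫ z, (χ z * fderiv ℝ φ z e) * h z ∂μ + ∫ z, (fderiv ℝ χ z e * φ z) * h z ∂μ := by
    rw [← integral_add iA iB]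
    congr 1; ext z; rw [hprod]; ring
  have e4 : ∫ z, (χ z * w z + fderiv ℝ χ z e * h z) * φ z ∂μ
      = ∫ z, (χ z * φ z) * w z ∂μ + ∫ z, (fderiv ℝ χ z e * φ z) * h z ∂μ := by
    rw [← integral_add iC iB]
    congr 1; ext z; ring
  have e5 : ∫ z, w z * (χ z * φ z) ∂μ = ∫ z, (χ z * φ z) * w z ∂μ := by
    congr 1; ext z; ring
  have e6 : ∫ z, (χ z * h z) * fderiv ℝ φ z e ∂μ = ∫ z, (χ z * fderiv ℝ φ z e) * h z ∂μ := by
    congr 1; ext z; ring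
  rw [e6, e4]
  rw [e3, e5] at key
  linarith

section WeakDerivative

variable {E : Type*} [NormedAddCommGroup E] [NormedSpace ℝ E] [FiniteDimensional ℝ E]
  [MeasurableSpace E] [BorelSpace E] {μ : Measure E} [μ.IsAddHaarMeasure]

/-- This is Gagliardo's starting point, with the chain rule for F built in. The function is first
multiplied by χ, equal to 1 on the support of ζ, to make it globally integrable; the fundamental
theorem of calculus is then used on almost every line. -/
theorem ae_enorm_comp_mul_le_lintegral_line {U : Set E} (hU : IsOpen U) {h w : E → ℝ} {e : E}
    (he : e ≠ 0) (hhm : Measurable h) (hwm : Measurable w)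
    (hh : LocallyIntegrableOn h U μ) (hw : LocallyIntegrableOn w U μ)
    (hhw : ∀ φ : E → ℝ, ContDiff ℝ ∞ φ → HasCompactSupport φ → tsupport φ ⊆ U →
      ∫ z in U, h z * fderiv ℝ φ z e ∂μ = -∫ z in U, w z * φ z ∂μ)
    {F F' : ℝ → ℝ} (hF : ∀ y, HasDerivAt F (F' y) y) (hF' : Continuous F')
    {ζ : E → ℝ} (hζ : ContDiff ℝ 1 ζ) (hζc : HasCompactSupport ζ) (hζU : tsupport ζ ⊆ U) :
    ∀ᵐ z ∂μ, ‖F (h z) * ζ z‖ₑ ≤ ∫⁻ s : ℝ, ‖F' (h (z + s • e)) * w (z + s • e) * ζ (z + s • e)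
      + F (h (z + s • e)) * fderiv ℝ ζ (z + s • e) e‖ₑ := by
  obtain ⟨χ, hχ, hχc, hχU, hχ1⟩ := exists_contDiff_cutoff hζc hU hζU
  have hd : Continuous fun z => fderiv ℝ χ z e :=
    (hχ.continuous_fderiv (by simp)).clm_apply continuous_const
  have hf : Integrable (fun z => χ z * h z) μ :=
    integrable_mul_of_locallyIntegrableOn hh hχ.continuous hχc hχU
  have hg : Integrable (fun z => χ z * w z + fderiv ℝ χ z e * h z) μ :=
    (integrable_mul_of_locallyIntegrableOn hw hχ.continuous hχc hχU).add
      (integrable_mul_of_locallyIntegrableOn hh hd (hχc.fderiv_apply ℝ e)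
        ((tsupport_fderiv_apply_subset ℝ e).trans hχU))
  have hline := ae_line_integral_rep hf hg ((hχ.continuous.measurable).mul hhm)
    ((hχ.continuous.measurable.mul hwm).add (hd.measurable.mul hhm)) e
    (weak_deriv_cutoff_mul hh hw hhw hχ hχc hχU)
  obtain ⟨R, hR⟩ := hζc.isBounded.exists_norm_le
  filter_upwards [hline] with z ⟨hzi, hz⟩
  have he' : 0 < ‖e‖ := norm_pos_iff.2 he
  -- This length moves z past the ball of radius R containing the support of ζ.
  set L : ℝ := (|R| + ‖z‖ + 1) / ‖e‖ with hL
  have hL0 : 0 ≤ L := by positivity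
  have hζL : ζ (z + (-L) • e) = 0 := by
    by_contra hne
    have h1 := hR _ (subset_tsupport _ hne)
    have h2 : ‖(-L) • e‖ = |R| + ‖z‖ + 1 := by
      rw [norm_smul, norm_neg, Real.norm_of_nonneg hL0, hL]; field_simp
    have h3 : ‖(-L) • e‖ ≤ ‖z + (-L) • e‖ + ‖z‖ := by
      have := norm_sub_le (z + (-L) • e) z
      simpa using this
    have := le_abs_self R
    linarith
  have hlin : ∀ s : ℝ, HasDerivAt (fun s : ℝ => z + s • e) e s := fun s => by
    simpa using ((hasDerivAt_id s).smul_const e).const_add z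
  have hζd : ∀ s : ℝ, deriv (fun s : ℝ => ζ (z + s • e)) s = fderiv ℝ ζ (z + s • e) e := fun s =>
    ((hζ.differentiable (by simp) _).hasFDerivAt.comp_hasDerivAt s (hlin s)).deriv
  have key := enorm_comp_integral_mul_le (c := χ z * h z) (ζ := fun s : ℝ => ζ (z + s • e)) hL0
    hF hF' hzi (hζ.comp (by fun_prop)) hζL
  have h0 : F (h z) * ζ z = F (χ z * h z) * ζ (z + (0 : ℝ) • e) := by
    by_cases hzs : z ∈ tsupport ζ
    · simp [hχ1 z hzs]
    · simp [image_eq_zero_of_notMem_tsupport hzs]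
  rw [h0]
  refine key.trans (lintegral_mono_ae ?_)
  filter_upwards [hz] with s hs
  rw [← hs, hζd]
  by_cases hzs : z + s • e ∈ tsupport ζ
  · rw [hχ1 _ hzs, one_mul]
    -- The cut-off χ is known to be 1 only on the support of ζ. Where ζ ≠ 0 it is therefore locally
    -- constant and its derivative drops out; where ζ = 0 the term carrying that derivative has the
    -- factor ζ.
    by_cases hζ0 : ζ (z + s • e) = 0
    · simp [hζ0]
    · have hev : χ =ᶠ[𝓝 (z + s • e)] fun _ => (1 : ℝ) := by
        have : {y | ζ y ≠ 0} ∈ 𝓝 (z + s • e) :=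
          (isOpen_ne.preimage hζ.continuous).mem_nhds hζ0
        filter_upwards [this] with y hy using hχ1 y (subset_tsupport _ hy)
      rw [hev.fderiv_eq]
      simp
  · rw [image_eq_zero_of_notMem_tsupport hzs, fderiv_of_notMem_tsupport ℝ hzs]
    simp

end WeakDerivative

/-! ### Anisotropic Sobolev inequality on a time slice. -/

theorem ENNReal.prod_rpow_eq_rpow_sum {ι : Type*} {s : Finset ι} {e : ι → ℝ} (x : ENNReal)
    (he : ∀ i ∈ s, 0 ≤ e i) : ∏ i ∈ s, x ^ e i = x ^ ∑ i ∈ s, e i := by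
  classical
  induction s using Finset.induction_on with
  | empty => simp
  | insert a t ha ih =>
    rw [Finset.prod_insert ha, Finset.sum_insert ha, ih fun i hi => he i (Finset.mem_insert_of_mem hi),
      ENNReal.rpow_add_of_nonneg _ _ (he a (Finset.mem_insert_self a t))
        (Finset.sum_nonneg fun i hi => he i (Finset.mem_insert_of_mem hi))]

/-- The grid-lines inequality concerns a single function integrated in every direction. Different
g_i are reduced to it by the normalised sum of the g_i / ∫ g_i, which has integral at most N and,
after rescaling, dominates each g_i. Adding ε to the integrals avoids division by zero and is
removed in the limit. -/
theorem lintegral_prod_rpow_le_of_le_line {N : ℕ} (hN : 2 ≤ N) {f g : Fin N → Space N → ENNReal}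
    (hg : ∀ i, Measurable (g i)) (hfin : ∀ i, ∫⁻ x, g i x ≠ ⊤)
    (hfg : ∀ i, ∀ᵐ x, f i x ≤ ∫⁻ s : ℝ, g i (Function.update x i s)) :
    ∫⁻ x, ∏ i, f i x ^ (1 / ((N : ℝ) - 1))
      ≤ (N : ENNReal) ^ ((N : ℝ) / (N - 1)) * ∏ i, (∫⁻ x, g i x) ^ (1 / ((N : ℝ) - 1)) := by
  have hN1 : (1 : ℝ) < N := by exact_mod_cast (by omega : 1 < N)
  have hN2 : 0 < (N : ℝ) - 1 := by linarith
  have ha : 0 ≤ 1 / ((N : ℝ) - 1) := by positivity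
  have key : ∀ ε : ENNReal, ε ≠ 0 → ε ≠ ⊤ → ∫⁻ x, ∏ i, f i x ^ (1 / ((N : ℝ) - 1))
      ≤ (N : ENNReal) ^ ((N : ℝ) / (N - 1)) * ∏ i, ((∫⁻ x, g i x) + ε) ^ (1 / ((N : ℝ) - 1)) := by
    intro ε hε hε'
    set G : Fin N → ENNReal := fun i => (∫⁻ x, g i x) + ε with hG
    have hG0 : ∀ i, G i ≠ 0 := fun i => by simp [hG, hε]
    have hGt : ∀ i, G i ≠ ⊤ := fun i => by simp [hG, hε', hfin i]
    set F : Space N → ENNReal := fun x => ∑ i, (G i)⁻¹ * g i x with hF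
    have hFm : Measurable F := Finset.measurable_fun_sum _ fun i _ => (hg i).const_mul _
    have hFi : ∫⁻ x, F x ≤ N := by
      rw [hF, lintegral_finsetSum _ fun i _ => (hg i).const_mul _]
      calc ∑ i, ∫⁻ x, (G i)⁻¹ * g i x ≤ ∑ _i : Fin N, 1 := by
            refine Finset.sum_le_sum fun i _ => ?_
            rw [lintegral_const_mul _ (hg i), mul_comm, ← div_eq_mul_inv]
            exact ENNReal.div_le_of_le_mul (by rw [one_mul]; exact le_self_add)
        _ = N := by simp
    have hfF : ∀ᵐ x, ∀ i, f i x ≤ G i * ∫⁻ s : ℝ, F (Function.update x i s) := by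
      rw [ae_all_iff]
      intro i
      filter_upwards [hfg i] with x hx
      refine hx.trans ?_
      rw [← lintegral_const_mul' _ _ (hGt i)]
      refine lintegral_mono fun s => ?_
      calc g i (Function.update x i s)
          = G i * ((G i)⁻¹ * g i (Function.update x i s)) := by
            rw [← mul_assoc, ENNReal.mul_inv_cancel (hG0 i) (hGt i), one_mul]
        _ ≤ G i * F (Function.update x i s) := by
            gcongr
            exact Finset.single_le_sum (f := fun j => (G j)⁻¹ * g j (Function.update x i s))
              (fun _ _ => zero_le) (Finset.mem_univ i)
    have hconj : Real.HolderConjugate (Fintype.card (Fin N)) ((N : ℝ) / (N - 1)) := by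
      rw [Fintype.card_fin, Real.holderConjugate_iff]
      refine ⟨hN1, ?_⟩
      field_simp
      ring
    have hgl := lintegral_prod_lintegral_pow_le (fun _ : Fin N => (volume : Measure ℝ)) hconj hFm
    rw [Fintype.card_fin] at hgl
    calc ∫⁻ x, ∏ i, f i x ^ (1 / ((N : ℝ) - 1))
        ≤ ∫⁻ x, (∏ i, G i ^ (1 / ((N : ℝ) - 1))) *
            ∏ i, (∫⁻ s : ℝ, F (Function.update x i s)) ^ (1 / ((N : ℝ) - 1)) := by
          refine lintegral_mono_ae ?_
          filter_upwards [hfF] with x hx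
          rw [← Finset.prod_mul_distrib]
          refine Finset.prod_le_prod' fun i _ => ?_
          rw [← ENNReal.mul_rpow_of_nonneg _ _ ha]
          exact ENNReal.rpow_le_rpow (hx i) ha
      _ = (∏ i, G i ^ (1 / ((N : ℝ) - 1))) * ∫⁻ x,
            ∏ i, (∫⁻ s : ℝ, F (Function.update x i s)) ^ (1 / ((N : ℝ) - 1)) := by
          refine lintegral_const_mul' _ _ ?_
          exact ENNReal.prod_ne_top fun i _ => ENNReal.rpow_ne_top_of_nonneg ha (hGt i)
      _ ≤ (∏ i, G i ^ (1 / ((N : ℝ) - 1))) * (N : ENNReal) ^ ((N : ℝ) / (N - 1)) := by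
          gcongr
          exact hgl.trans (ENNReal.rpow_le_rpow hFi (by positivity))
      _ = _ := mul_comm _ _
  have hlim : Tendsto (fun ε : ENNReal => (N : ENNReal) ^ ((N : ℝ) / (N - 1)) *
      ∏ i, ((∫⁻ x, g i x) + ε) ^ (1 / ((N : ℝ) - 1))) (𝓝[>] 0)
      (𝓝 ((N : ENNReal) ^ ((N : ℝ) / (N - 1)) *
      ∏ i, ((∫⁻ x, g i x) + 0) ^ (1 / ((N : ℝ) - 1)))) := by
    refine ENNReal.Tendsto.const_mul ?_ (Or.inr ?_)
    · refine ENNReal.tendsto_finsetProd_of_ne_top _ (fun i _ => ?_) (fun i _ => ?_)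
      · refine Tendsto.mono_left ?_ nhdsWithin_le_nhds
        exact ((ENNReal.continuous_rpow_const.comp (continuous_const.add continuous_id)).tendsto 0)
      · exact ENNReal.rpow_ne_top_of_nonneg ha (by simpa using hfin i)
    · exact ENNReal.rpow_ne_top_of_nonneg (by positivity) (by simp)
  simp only [add_zero] at hlim
  refine ge_of_tendsto hlim ?_
  filter_upwards [self_mem_nhdsWithin, mem_nhdsWithin_of_mem_nhds
    (Iio_mem_nhds (show (0 : ENNReal) < 1 by simp))] with ε h1 h2
  exact key ε h1.ne' (h2.trans ENNReal.one_lt_top).ne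

/-- Write X = ∫ Q and A_i = ∫ P_i^p_i. Hölder in each direction gives X ≤ const · ∏ (A_i^(1/p_i)
X^(1-1/p_i))^(1/(N-1)). The total power of X on the right is below 1 because p < N, and finiteness
of X allows it to be absorbed. -/
theorem rpow_lintegral_le_of_le_line {N : ℕ} (hN : 2 ≤ N) {p : Fin N → ℝ} {pb : ℝ}
    (hp : ∀ i, 1 < p i) (hpb0 : 0 < pb) (hpbN : pb < N) (hpb : ∑ i, 1 / p i = N / pb)
    {f P : Fin N → Space N → ENNReal} {Q : Space N → ENNReal} (hP : ∀ i, Measurable (P i))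
    (hQ : Measurable Q) (hA : ∀ i, ∫⁻ x, P i x ^ p i ≠ ⊤) (hX : ∫⁻ x, Q x ≠ ⊤)
    (hf : ∀ i, ∀ᵐ x, f i x ≤ ∫⁻ s : ℝ, P i (Function.update x i s)
      * Q (Function.update x i s) ^ (1 - 1 / p i))
    (hQf : ∀ x, Q x ≤ ∏ i, f i x ^ (1 / ((N : ℝ) - 1))) :
    (∫⁻ x, Q x) ^ ((N - pb) / N)
      ≤ (N : ENNReal) ^ pb * ∏ i, (∫⁻ x, P i x ^ p i) ^ (pb / (N * p i)) := by
  have hN1 : (1 : ℝ) < N := by exact_mod_cast (by omega : 1 < N)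
  have hN2 : 0 < (N : ℝ) - 1 := by linarith
  have hN0 : 0 < (N : ℝ) := by linarith
  set X := ∫⁻ x, Q x with hXdef
  set A := fun i => ∫⁻ x, P i x ^ p i with hAdef
  have hp0 : ∀ i, 0 < p i := fun i => by linarith [hp i]
  have hp1 : ∀ i, 0 ≤ 1 - 1 / p i := fun i => by
    rw [sub_nonneg, div_le_one (hp0 i)]; exact (hp i).le
  have hholder : ∀ i, ∫⁻ x, P i x * Q x ^ (1 - 1 / p i)
      ≤ A i ^ (1 / p i) * X ^ (1 - 1 / p i) := by
    intro i
    have := hp0 i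
    have := ENNReal.lintegral_mul_norm_pow_le (μ := volume) (f := fun x => P i x ^ p i) (g := Q)
      ((hP i).pow_const _).aemeasurable hQ.aemeasurable (p := 1 / p i) (q := 1 - 1 / p i)
      (by positivity) (hp1 i) (by ring)
    refine le_trans (le_of_eq ?_) this
    congr 1; ext x
    rw [← ENNReal.rpow_mul, mul_one_div_cancel (hp0 i).ne', ENNReal.rpow_one]
  have hmain : X ≤ (N : ENNReal) ^ ((N : ℝ) / (N - 1)) *
      ∏ i, (A i ^ (1 / p i) * X ^ (1 - 1 / p i)) ^ (1 / ((N : ℝ) - 1)) := by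
    have h := lintegral_prod_rpow_le_of_le_line hN (f := f)
      (g := fun i x => P i x * Q x ^ (1 - 1 / p i))
      (fun i => (hP i).mul (hQ.pow_const _)) (fun i => ?_) hf
    · refine (lintegral_mono hQf).trans (h.trans ?_)
      gcongr with i
      exact hholder i
    · refine ((hholder i).trans_lt (ENNReal.mul_lt_top ?_ ?_)).ne
      · exact ENNReal.rpow_lt_top_of_nonneg (by have := hp0 i; positivity) (hA i)
      · exact ENNReal.rpow_lt_top_of_nonneg (hp1 i) hX
  rcases eq_or_ne X 0 with h0 | h0
  · rw [h0, ENNReal.zero_rpow_of_pos (div_pos (by linarith) hN0)]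
    exact zero_le
  have hsum : ∑ i, (1 - 1 / p i) * (1 / ((N : ℝ) - 1)) = (N - N / pb) * (1 / ((N : ℝ) - 1)) := by
    rw [← Finset.sum_mul, Finset.sum_sub_distrib, hpb]
    simp
  have hprodX : ∏ i, X ^ ((1 - 1 / p i) * (1 / ((N : ℝ) - 1)))
      = X ^ ((N - N / pb) * (1 / ((N : ℝ) - 1))) := by
    rw [← hsum]
    exact ENNReal.prod_rpow_eq_rpow_sum X fun i _ => mul_nonneg (hp1 i) (by positivity)
  set β := (N - N / pb) * (1 / ((N : ℝ) - 1)) with hβ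
  -- After absorption X carries the power 1 - β = (N/p - 1)/(N - 1); raising to the power e turns it
  -- into (N - p)/N.
  set e := ((N : ℝ) - 1) * (pb / N) with he
  have he0 : 0 ≤ e := by positivity
  have hmain2 : X ^ (1 - β) ≤ (N : ENNReal) ^ ((N : ℝ) / (N - 1)) *
      ∏ i, A i ^ (1 / p i * (1 / ((N : ℝ) - 1))) := by
    have h2 : X ≤ ((N : ENNReal) ^ ((N : ℝ) / (N - 1)) *
      ∏ i, A i ^ (1 / p i * (1 / ((N : ℝ) - 1)))) * X ^ β := by
      refine hmain.trans (le_of_eq ?_)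
      rw [← hprodX, mul_assoc, ← Finset.prod_mul_distrib]
      congr 1
      refine Finset.prod_congr rfl fun i _ => ?_
      rw [ENNReal.mul_rpow_of_nonneg _ _ (by positivity), ← ENNReal.rpow_mul, ← ENNReal.rpow_mul]
    rw [ENNReal.rpow_sub _ _ h0 hX, ENNReal.rpow_one]
    exact ENNReal.div_le_of_le_mul h2
  have h3 := ENNReal.rpow_le_rpow hmain2 he0
  rw [← ENNReal.rpow_mul, ENNReal.mul_rpow_of_nonneg _ _ he0, ← ENNReal.rpow_mul,
    ← ENNReal.prod_rpow_of_nonneg he0] at h3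
  have e1 : (1 - β) * e = (N - pb) / N := by
    rw [hβ, he]; field_simp; ring
  have e2 : (N : ℝ) / (N - 1) * e = pb := by rw [he]; field_simp
  rw [e1, e2] at h3
  refine h3.trans (le_of_eq ?_)
  congr 1
  refine Finset.prod_congr rfl fun i _ => ?_
  rw [← ENNReal.rpow_mul]
  congr 1
  have := hp0 i
  rw [he]; field_simp

/-! ### Nonlinear profiles used in the embedding. -/

/-- The line estimate requires F to be differentiable on all of ℝ. A profile on [0, ∞) extends by a
constant to the left because its derivative vanishes at 0. -/
theorem hasDerivAt_comp_max_zero {Φ φ : ℝ → ℝ} (hΦ : ∀ x, 0 ≤ x → HasDerivAt Φ (φ x) x)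
    (h0 : φ 0 = 0) (y : ℝ) : HasDerivAt (fun y => Φ (max y 0)) (φ (max y 0)) y := by
  rcases lt_trichotomy y 0 with hy | rfl | hy
  · rw [max_eq_right hy.le, h0]
    refine (hasDerivAt_const y (Φ 0)).congr_of_eventuallyEq ?_
    filter_upwards [Iio_mem_nhds hy] with x hx
    rw [max_eq_right (le_of_lt hx)]
  · rw [max_self, ← hasDerivWithinAt_univ, ← Iic_union_Ici (a := (0 : ℝ))]
    refine HasDerivWithinAt.union ?_ ?_
    · rw [h0]
      refine (hasDerivWithinAt_const 0 _ (Φ 0)).congr (fun x hx => ?_) (by simp)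
      rw [max_eq_right hx]
    · refine (hΦ 0 le_rfl).hasDerivWithinAt.congr (fun x hx => ?_) (by simp)
      rw [max_eq_left hx]
  · rw [max_eq_left hy.le]
    refine (hΦ y hy.le).congr_of_eventuallyEq ?_
    filter_upwards [Ioi_mem_nhds hy] with x hx
    rw [max_eq_left (le_of_lt hx)]

/-- Relative height of `x + K` above the level `K`. -/
noncomputable def relHeight (K x : ℝ) : ℝ := x / (x + K)

/-- A smooth bounded truncation of `x + K`, increasing to it as `M → ∞`. -/
noncomputable def truncHeight (K M x : ℝ) : ℝ := (x + K) * M / (x + K + M)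

/-- Product of powers of the relative height and of the truncated height. -/
noncomputable def profile (K M c a x : ℝ) : ℝ := relHeight K x ^ c * truncHeight K M x ^ a

/-- The derivative of `profile`. -/
noncomputable def profileDeriv (K M c a x : ℝ) : ℝ :=
  K / (x + K) ^ 2 * c * relHeight K x ^ (c - 1) * truncHeight K M x ^ a
    + relHeight K x ^ c * (M ^ 2 / (x + K + M) ^ 2 * a * truncHeight K M x ^ (a - 1))

section Profile

variable {K M c a x : ℝ}

theorem relHeight_nonneg (hK : 0 < K) (hx : 0 ≤ x) : 0 ≤ relHeight K x := by
  unfold relHeight; positivity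

theorem relHeight_le_one (hK : 0 < K) (hx : 0 ≤ x) : relHeight K x ≤ 1 := by
  unfold relHeight
  rw [div_le_one (by positivity)]
  linarith

theorem truncHeight_pos (hK : 0 < K) (hM : 0 < M) (hx : 0 ≤ x) : 0 < truncHeight K M x := by
  unfold truncHeight; positivity

theorem truncHeight_le (hK : 0 < K) (hM : 0 < M) (hx : 0 ≤ x) : truncHeight K M x ≤ x + K := by
  unfold truncHeight
  rw [div_le_iff₀ (by positivity)]
  nlinarith [sq_nonneg (x + K)]

theorem truncHeight_le_trunc (hK : 0 < K) (hM : 0 < M) (hx : 0 ≤ x) : truncHeight K M x ≤ M := by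
  unfold truncHeight
  rw [div_le_iff₀ (by positivity)]
  nlinarith [sq_nonneg M]

theorem tendsto_truncHeight (hK : 0 < K) (hx : 0 ≤ x) :
    Tendsto (fun n : ℕ => truncHeight K ((n : ℝ) + 1) x) atTop (𝓝 (x + K)) := by
  have h1 : Tendsto (fun n : ℕ => (x + K) / ((n : ℝ) + 1)) atTop (𝓝 0) :=
    tendsto_const_nhds.div_atTop (tendsto_natCast_atTop_atTop.atTop_add tendsto_const_nhds)
  have h2 : Tendsto (fun n : ℕ => (x + K) / ((x + K) / ((n : ℝ) + 1) + 1)) atTop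
      (𝓝 ((x + K) / (0 + 1))) :=
    tendsto_const_nhds.div (h1.add tendsto_const_nhds) (by norm_num)
  rw [zero_add, div_one] at h2
  refine h2.congr fun n => ?_
  unfold truncHeight
  have : (0 : ℝ) < (n : ℝ) + 1 := by positivity
  field_simp

theorem hasDerivAt_profile (hK : 0 < K) (hM : 0 < M) (hc : 1 ≤ c) (hx : 0 ≤ x) :
    HasDerivAt (profile K M c a) (profileDeriv K M c a x) x := by
  have hv : x + K ≠ 0 := by positivity
  have hvM : x + K + M ≠ 0 := by positivity
  have h1 : HasDerivAt (relHeight K) (K / (x + K) ^ 2) x := by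
    have := (hasDerivAt_id x).div ((hasDerivAt_id x).add_const K) hv
    refine HasDerivAt.congr_deriv (f := relHeight K) this ?_
    simp
  have h2 : HasDerivAt (truncHeight K M) (M ^ 2 / (x + K + M) ^ 2) x := by
    have := (((hasDerivAt_id x).add_const K).mul_const M).div
      (((hasDerivAt_id x).add_const K).add_const M) hvM
    refine HasDerivAt.congr_deriv (f := truncHeight K M) this ?_
    simp only [id_eq, one_mul, mul_one]
    ring
  exact (h1.rpow_const (Or.inr hc)).mul (h2.rpow_const (Or.inl (truncHeight_pos hK hM hx).ne'))

theorem profileDeriv_zero (hc : 1 < c) : profileDeriv K M c a 0 = 0 := by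
  simp [profileDeriv, relHeight, Real.zero_rpow (sub_pos.2 hc).ne', Real.zero_rpow (by linarith : c ≠ 0)]

theorem continuousOn_profileDeriv (hK : 0 < K) (hM : 0 < M) (hc : 1 < c) :
    ContinuousOn (profileDeriv K M c a) (Ici 0) := by
  have hv : ∀ x ∈ Ici (0 : ℝ), x + K ≠ 0 := fun x hx => by have : 0 ≤ x := hx; positivity
  have hvM : ∀ x ∈ Ici (0 : ℝ), x + K + M ≠ 0 := fun x hx => by have : 0 ≤ x := hx; positivity
  have h1 : ContinuousOn (relHeight K) (Ici 0) :=
    continuousOn_id.div (continuousOn_id.add continuousOn_const) hv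
  have h2 : ContinuousOn (truncHeight K M) (Ici 0) := by
    refine ContinuousOn.div (by fun_prop) (by fun_prop) hvM
  have h3 : ∀ x ∈ Ici (0 : ℝ), truncHeight K M x ≠ 0 := fun x hx => (truncHeight_pos hK hM hx).ne'
  have h4 : ContinuousOn (fun x => K / (x + K) ^ 2) (Ici 0) :=
    ContinuousOn.div (by fun_prop) (by fun_prop) fun x hx => pow_ne_zero 2 (hv x hx)
  have h5 : ContinuousOn (fun x => M ^ 2 / (x + K + M) ^ 2) (Ici 0) :=
    ContinuousOn.div (by fun_prop) (by fun_prop) fun x hx => pow_ne_zero 2 (hvM x hx)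
  refine ContinuousOn.add ?_ ?_
  · exact ((h4.mul continuousOn_const).mul (h1.rpow_const fun x hx => Or.inr (by linarith))).mul
      (h2.rpow_const fun x hx => Or.inl (h3 x hx))
  · exact (h1.rpow_const fun x hx => Or.inr (by linarith)).mul
      ((h5.mul continuousOn_const).mul (h2.rpow_const fun x hx => Or.inl (h3 x hx)))

theorem profileDeriv_nonneg (hK : 0 < K) (hM : 0 < M) (hc : 1 < c) (ha : 0 ≤ a) (hx : 0 ≤ x) :
    0 ≤ profileDeriv K M c a x := by
  have h1 := relHeight_nonneg hK hx
  have h2 := (truncHeight_pos hK hM hx).le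
  unfold profileDeriv
  positivity

/-- The logarithmic derivative of the truncated height is at most 1/(x + K), and differentiating the
relative height costs one of its powers and a factor at most 1/(x + K). The bound does not depend on
M. -/
theorem profileDeriv_le (hK : 0 < K) (hM : 0 < M) (hc : 1 < c) (ha : 0 ≤ a) (hx : 0 ≤ x) :
    profileDeriv K M c a x
      ≤ (c + a) * (relHeight K x ^ (c - 1) * truncHeight K M x ^ a / (x + K)) := by
  have h1 := relHeight_nonneg hK hx
  have h1' := relHeight_le_one hK hx
  have h2 := truncHeight_pos hK hM hx
  have hr : relHeight K x ^ c ≤ relHeight K x ^ (c - 1) :=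
    Real.rpow_le_rpow_of_exponent_ge_of_imp h1 h1' (by linarith) (fun _ h => by linarith)
  have hK' : K / (x + K) ^ 2 ≤ 1 / (x + K) := by
    rw [div_le_div_iff₀ (by positivity) (by positivity)]
    nlinarith
  have hT : M ^ 2 / (x + K + M) ^ 2 * truncHeight K M x ^ (a - 1)
      ≤ truncHeight K M x ^ a / (x + K) := by
    rw [Real.rpow_sub_one h2.ne']
    have : M ^ 2 / (x + K + M) ^ 2 / truncHeight K M x ≤ 1 / (x + K) := by
      rw [truncHeight, div_div_eq_mul_div, div_mul_eq_mul_div, div_div,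
        div_le_div_iff₀ (by positivity) (by positivity)]
      have : 0 ≤ M * M * (x + K) * (x + K) * (x + K + M) := by positivity
      nlinarith
    calc _ = truncHeight K M x ^ a * (M ^ 2 / (x + K + M) ^ 2 / truncHeight K M x) := by ring
      _ ≤ truncHeight K M x ^ a * (1 / (x + K)) := by gcongr
      _ = _ := by ring
  set R := relHeight K x ^ (c - 1) with hR
  set A := truncHeight K M x ^ a with hA
  have hR0 : 0 ≤ R := by positivity
  have hA0 : 0 ≤ A := by positivity
  unfold profileDeriv
  calc _ ≤ 1 / (x + K) * c * R * A + R * (a * (A / (x + K))) := by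
        have e1 : relHeight K x ^ c * (M ^ 2 / (x + K + M) ^ 2 * a * truncHeight K M x ^ (a - 1))
          = relHeight K x ^ c * (a * (M ^ 2 / (x + K + M) ^ 2 * truncHeight K M x ^ (a - 1))) := by
          ring
        rw [e1]
        gcongr
    _ = _ := by ring

end Profile

/-! ### Parabolic embedding. -/

instance isAddHaarMeasure_volume_spaceTime (N : ℕ) :
    (volume : Measure (Space N × ℝ)).IsAddHaarMeasure :=
  inferInstanceAs ((volume : Measure (Space N)).prod (volume : Measure ℝ)).IsAddHaarMeasure

theorem ae_ae_snd_fst {N : ℕ} {P : Space N × ℝ → Prop} (h : ∀ᵐ z, P z) :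
    ∀ᵐ t : ℝ, ∀ᵐ x : Space N, P (x, t) := by
  have h1 : ∀ᵐ z : ℝ × Space N, P z.swap :=
    (Measure.measurePreserving_swap (μ := (volume : Measure ℝ))
      (ν := (volume : Measure (Space N)))).quasiMeasurePreserving.ae h
  exact Measure.ae_ae_of_ae_prod h1

theorem lintegral_line_eq_update {N : ℕ} (i : Fin N) (x : Space N) (t : ℝ)
    (G : Space N × ℝ → ENNReal) :
    ∫⁻ s : ℝ, G ((x, t) + s • ((Pi.single i 1, 0) : Space N × ℝ))
      = ∫⁻ s : ℝ, G (Function.update x i s, t) := by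
  rw [← lintegral_add_left_eq_self (fun s => G (Function.update x i s, t)) (x i)]
  refine lintegral_congr fun s => ?_
  congr 1
  refine Prod.ext ?_ (by simp)
  ext j
  by_cases hj : j = i
  · subst hj; simp
  · simp [hj]

theorem spaceDeriv_mul_time {N : ℕ} (i : Fin N) {ζ : Space N × ℝ → ℝ} {τ : ℝ → ℝ}
    (hζ : Differentiable ℝ ζ) (hτ : Differentiable ℝ τ) (z : Space N × ℝ) :
    spaceDeriv i (fun z => ζ z * τ z.2) z = spaceDeriv i ζ z * τ z.2 := by
  unfold spaceDeriv
  have h2 : HasFDerivAt (fun z : Space N × ℝ => τ z.2)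
      ((fderiv ℝ τ z.2).comp (ContinuousLinearMap.snd ℝ (Space N) ℝ)) z :=
    (hτ z.2).hasFDerivAt.comp z hasFDerivAt_snd
  rw [((hζ z).hasFDerivAt.fun_mul h2).fderiv]
  simp [mul_comm]

/-- The direction is spatial, so a factor depending on time alone is constant along the line. Such a
factor can be inserted to make ζ compactly supported in time, and removed slice by slice. -/
theorem ae_ae_slice_line_bound {N : ℕ} {Ω : Set (Space N)} (hΩ : IsOpen Ω) {T a b : ℝ}
    (ha : 0 < a) (hb : b ≤ T) {i : Fin N} {h w : Space N × ℝ → ℝ} (hhm : Measurable h)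
    (hwm : Measurable w) (hhw : HasWeakSpaceDeriv (Ω ×ˢ Ioo 0 T) i h w)
    {F F' : ℝ → ℝ} (hF : ∀ y, HasDerivAt F (F' y) y) (hF' : Continuous F')
    {ζ : Space N × ℝ → ℝ} (hζ : ContDiff ℝ 1 ζ) {κ : Set (Space N)} (hκ : IsCompact κ)
    (hκΩ : κ ⊆ Ω) (hζκ : ∀ x t, x ∉ κ → ζ (x, t) = 0) (hζa : ∀ x t, t ≤ a → ζ (x, t) = 0) :
    ∀ᵐ t ∂(volume.restrict (Ioo a b)), ∀ᵐ x : Space N,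
      ‖F (h (x, t)) * ζ (x, t)‖ₑ ≤ ∫⁻ s : ℝ, ‖F' (h (Function.update x i s, t))
        * w (Function.update x i s, t) * ζ (Function.update x i s, t)
        + F (h (Function.update x i s, t)) * spaceDeriv i ζ (Function.update x i s, t)‖ₑ := by
  have main : ∀ n : ℕ, ∀ᵐ t : ℝ, ∀ᵐ x : Space N, t ≤ b - 2 / ((n : ℝ) + 1) →
      ‖F (h (x, t)) * ζ (x, t)‖ₑ ≤ ∫⁻ s : ℝ, ‖F' (h (Function.update x i s, t))
        * w (Function.update x i s, t) * ζ (Function.update x i s, t)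
        + F (h (Function.update x i s, t)) * spaceDeriv i ζ (Function.update x i s, t)‖ₑ := by
    intro n
    set δ : ℝ := 1 / ((n : ℝ) + 1) with hδ
    have hδ0 : 0 < δ := by positivity
    -- The function ζ need not vanish near the top time b. This factor does, and it equals 1 up to b
    -- - 2/(n+1); letting n vary reaches every t < b.
    set τ : ℝ → ℝ := fun t => Real.smoothTransition ((b - t) / δ - 1) with hτ
    have hτs : ContDiff ℝ 1 τ := Real.smoothTransition.contDiff.comp (by fun_prop)
    have hτ1 : ∀ t, t ≤ b - 2 / ((n : ℝ) + 1) → τ t = 1 := by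
      intro t ht
      apply Real.smoothTransition.one_of_one_le
      rw [le_sub_iff_add_le, le_div_iff₀ hδ0, hδ]
      ring_nf at ht ⊢; linarith
    have hτ0 : ∀ t, b - δ ≤ t → τ t = 0 := by
      intro t ht
      apply Real.smoothTransition.zero_of_nonpos
      rw [sub_nonpos, div_le_one hδ0]; linarith
    have hζτ : ContDiff ℝ 1 (fun z : Space N × ℝ => ζ z * τ z.2) :=
      hζ.mul (hτs.comp contDiff_snd)
    have hsub : tsupport (fun z : Space N × ℝ => ζ z * τ z.2) ⊆ κ ×ˢ Icc a (b - δ) := by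
      refine closure_minimal ?_ (hκ.isClosed.prod isClosed_Icc)
      rintro ⟨x, t⟩ hz
      rw [Function.mem_support] at hz
      refine ⟨?_, ?_, ?_⟩
      · by_contra hx; exact hz (by simp [hζκ x t hx])
      · by_contra hx; exact hz (by simp [hζa x t (not_le.1 hx).le])
      · by_contra hx; exact hz (by simp [hτ0 t (not_le.1 hx).le])
    have hc : HasCompactSupport (fun z : Space N × ℝ => ζ z * τ z.2) :=
      (hκ.prod isCompact_Icc).of_isClosed_subset (isClosed_tsupport _) hsub
    have hU : tsupport (fun z : Space N × ℝ => ζ z * τ z.2) ⊆ Ω ×ˢ Ioo 0 T :=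
      hsub.trans (prod_mono hκΩ fun t ht => ⟨ha.trans_le ht.1, by linarith [ht.2]⟩)
    have hne : ((Pi.single i 1, 0) : Space N × ℝ) ≠ 0 := by
      intro h0
      have := congrFun (congrArg Prod.fst h0) i
      simp at this
    have key := ae_enorm_comp_mul_le_lintegral_line (μ := (volume : Measure (Space N × ℝ)))
      (hΩ.prod isOpen_Ioo) hne hhm hwm hhw.1 hhw.2.1 hhw.2.2 hF hF' hζτ hc hU
    filter_upwards [ae_ae_snd_fst key] with t ht
    filter_upwards [ht] with x hx htn
    rw [lintegral_line_eq_update i x t (fun z => ‖F' (h z) * w z * (ζ z * τ z.2)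
      + F (h z) * fderiv ℝ (fun z : Space N × ℝ => ζ z * τ z.2) z (Pi.single i 1, 0)‖ₑ)] at hx
    simp only [hτ1 t htn, mul_one] at hx
    refine hx.trans (le_of_eq ?_)
    refine lintegral_congr fun s => ?_
    have := spaceDeriv_mul_time i (hζ.differentiable (by simp)) (hτs.differentiable (by simp))
      (Function.update x i s, t)
    rw [hτ1 t htn, mul_one] at this
    rw [← this]
    rfl
  rw [ae_restrict_iff' measurableSet_Ioo]
  filter_upwards [ae_all_iff.2 main] with t ht htab
  obtain ⟨n, hn⟩ := exists_nat_gt (2 / (b - t))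
  have hbt : 0 < b - t := by linarith [htab.2]
  filter_upwards [ht n] with x hx
  apply hx
  have : 2 / ((n : ℝ) + 1) ≤ b - t := by
    rw [div_le_iff₀ (by positivity)]
    rw [div_lt_iff₀ hbt] at hn
    nlinarith
  linarith

theorem lintegral_slab {N : ℕ} {a b : ℝ} {f : Space N × ℝ → ENNReal} (hf : Measurable f) :
    ∫⁻ z in univ ×ˢ Ioo a b, f z = ∫⁻ t in Ioo a b, ∫⁻ x : Space N, f (x, t) := by
  rw [Measure.volume_eq_prod, ← Measure.prod_restrict, Measure.restrict_univ,
    lintegral_prod_symm _ hf.aemeasurable]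

/-- The exponents c = 1 + p*(1 - 1/P) and a = β + σ(1 - 1/P) are made for this factorisation (p* is
`ps`): differentiating F(h) ζ^(qc) leaves the integrand with exponent β, controlled by the energy,
times the power 1 - 1/P of a quantity that is the same in every direction. Restricting to x > 0 is
harmless, since the profile and its derivative vanish at 0. -/
theorem abs_profile_terms_le {K M P β σ ps q x W Z D : ℝ} (hK : 0 < K) (hM : 0 < M) (hP : 1 < P)
    (hβ : 0 < β) (hσ : 0 ≤ σ) (hps : 0 < ps) (hq : 1 ≤ q) (hx : 0 ≤ x) (hZ : 0 ≤ Z) (hZ1 : Z ≤ 1) :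
    |profileDeriv K M (1 + ps * (1 - 1 / P)) (β + σ * (1 - 1 / P)) x * W
        * Z ^ (q * (1 + ps * (1 - 1 / P)))
      + profile K M (1 + ps * (1 - 1 / P)) (β + σ * (1 - 1 / P)) x
        * (q * (1 + ps * (1 - 1 / P)) * Z ^ (q * (1 + ps * (1 - 1 / P)) - 1) * D)|
      ≤ ((1 + ps * (1 - 1 / P)) + (β + σ * (1 - 1 / P)) + q * (1 + ps * (1 - 1 / P)))
        * (if 0 < x then (x + K) ^ (β - 1) * |W| * Z ^ q + (x + K) ^ β * |D| else 0)
        * ((relHeight K x * Z ^ q) ^ ps * truncHeight K M x ^ σ) ^ (1 - 1 / P) := by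
  set θ := 1 - 1 / P with hθ
  have hθ0 : 0 < θ := by
    rw [hθ, sub_pos, div_lt_one (by linarith)]; exact hP
  set c := 1 + ps * θ with hc
  set a := β + σ * θ with ha
  have hc1 : 1 < c := by rw [hc]; nlinarith [mul_pos hps hθ0]
  have ha0 : 0 ≤ a := by positivity
  rcases hx.eq_or_lt with rfl | hx0
  · have h1 : profile K M c a 0 = 0 := by
      simp [profile, relHeight, Real.zero_rpow (by linarith : c ≠ 0)]
    simp [profileDeriv_zero hc1, h1]
  rw [if_pos hx0]
  have hr0 := relHeight_nonneg hK hx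
  have hr1 := relHeight_le_one hK hx
  have hT0 := truncHeight_pos hK hM hx
  have hT1 := truncHeight_le hK hM hx
  have hv : 0 < x + K := by positivity
  set r := relHeight K x with hr
  set T := truncHeight K M x with hT
  set J := ((r * Z ^ q) ^ ps * T ^ σ) ^ θ with hJ
  have hJ0 : 0 ≤ J := by positivity
  have hZc : Z ^ (q * (c - 1)) * (r ^ (c - 1) * T ^ (σ * θ)) = J := by
    rw [hJ, Real.mul_rpow (by positivity) (by positivity), ← Real.rpow_mul (by positivity),
      ← Real.rpow_mul hT0.le, Real.mul_rpow hr0 (by positivity), ← Real.rpow_mul hZ, hc]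
    ring_nf
  have hTa : T ^ a ≤ (x + K) ^ β * T ^ (σ * θ) := by
    rw [ha, Real.rpow_add hT0]
    gcongr
  have hFd : profileDeriv K M c a x * Z ^ (q * c) ≤ (c + a) * ((x + K) ^ (β - 1) * Z ^ q * J) := by
    have hZe : Z ^ (q * c) = Z ^ q * Z ^ (q * (c - 1)) := by
      rw [← Real.rpow_add_of_nonneg hZ (by linarith) (by nlinarith)]; congr 1; ring
    calc profileDeriv K M c a x * Z ^ (q * c)
        ≤ ((c + a) * (r ^ (c - 1) * T ^ a / (x + K))) * Z ^ (q * c) := by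
          gcongr
          exact profileDeriv_le hK hM hc1 ha0 hx
      _ ≤ ((c + a) * (r ^ (c - 1) * ((x + K) ^ β * T ^ (σ * θ)) / (x + K))) * Z ^ (q * c) := by
          gcongr
      _ = (c + a) * ((x + K) ^ (β - 1) * Z ^ q * J) := by
          rw [← hZc, hZe, Real.rpow_sub_one hv.ne']; ring
  have hF : profile K M c a x * Z ^ (q * c - 1) ≤ (x + K) ^ β * J := by
    have hZe : Z ^ (q * c - 1) ≤ Z ^ (q * (c - 1)) :=
      Real.rpow_le_rpow_of_exponent_ge_of_imp hZ hZ1 (by linarith) (fun _ h => by nlinarith)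
    have hre : r ^ c ≤ r ^ (c - 1) :=
      Real.rpow_le_rpow_of_exponent_ge_of_imp hr0 hr1 (by linarith) (fun _ h => by linarith)
    calc profile K M c a x * Z ^ (q * c - 1)
        = r ^ c * T ^ a * Z ^ (q * c - 1) := rfl
      _ ≤ r ^ (c - 1) * ((x + K) ^ β * T ^ (σ * θ)) * Z ^ (q * (c - 1)) := by gcongr
      _ = (x + K) ^ β * J := by rw [← hZc]; ring
  have hFd0 := profileDeriv_nonneg hK hM hc1 ha0 hx
  have hF0 : 0 ≤ profile K M c a x := by
    have : 0 ≤ r ^ c * T ^ a := by positivity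
    exact this
  have hqc : 0 ≤ q * c := by nlinarith
  calc |profileDeriv K M c a x * W * Z ^ (q * c)
          + profile K M c a x * (q * c * Z ^ (q * c - 1) * D)|
      ≤ profileDeriv K M c a x * Z ^ (q * c) * |W|
          + q * c * (profile K M c a x * Z ^ (q * c - 1)) * |D| := by
        refine (abs_add_le _ _).trans (le_of_eq ?_)
        rw [abs_mul, abs_mul, abs_mul, abs_mul, abs_mul, abs_of_nonneg hFd0, abs_of_nonneg hF0,
          abs_of_nonneg hqc, abs_of_nonneg (Real.rpow_nonneg hZ _),
          abs_of_nonneg (Real.rpow_nonneg hZ _)]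
        ring
    _ ≤ (c + a) * ((x + K) ^ (β - 1) * Z ^ q * J) * |W| + q * c * ((x + K) ^ β * J) * |D| := by
        gcongr
    _ ≤ (c + a + q * c) * ((x + K) ^ (β - 1) * |W| * Z ^ q + (x + K) ^ β * |D|) * J := by
        have h1 : 0 ≤ q * c * ((x + K) ^ (β - 1) * |W| * Z ^ q * J) := by positivity
        have h2 : 0 ≤ (c + a) * ((x + K) ^ β * |D| * J) := by positivity
        nlinarith

/-- This closes the loop in Gagliardo's argument: with p* = Np/(N - p), the profiles of all
directions multiply to exactly the quantity whose powers 1 - 1/p_i appear in the line bounds. It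
rests on ∑ (1 - 1/p_i) = N - N/p. -/
theorem prod_profile_rpow_eq {N : ℕ} (hN : 2 ≤ N) {p β : Fin N → ℝ} {pb q K M x Z : ℝ}
    (hp : ∀ i, 1 < p i) (hpb0 : 0 < pb) (hpbN : pb < N) (hpb : ∑ i, 1 / p i = N / pb)
    (hβ : ∀ i, 0 < β i) (hK : 0 < K) (hM : 0 < M) (hx : 0 ≤ x) (hZ : 0 ≤ Z) :
    ∏ i, (profile K M (1 + N * pb / (N - pb) * (1 - 1 / p i))
        (β i + N * pb / (N - pb) * ((∑ j, β j) / N) * (1 - 1 / p i)) x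
        * Z ^ (q * (1 + N * pb / (N - pb) * (1 - 1 / p i)))) ^ (1 / ((N : ℝ) - 1))
      = (relHeight K x * Z ^ q) ^ (N * pb / (N - pb))
        * truncHeight K M x ^ (N * pb / (N - pb) * ((∑ j, β j) / N)) := by
  have hN1 : (1 : ℝ) < N := by exact_mod_cast (by omega : 1 < N)
  have hN0 : 0 < (N : ℝ) - 1 := by linarith
  have hNp : 0 < (N : ℝ) - pb := by linarith
  have hr0 := relHeight_nonneg hK hx
  have hT0 := truncHeight_pos hK hM hx
  have hθ : ∀ i, 0 ≤ 1 - 1 / p i := fun i => by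
    rw [sub_nonneg, div_le_one (by linarith [hp i])]; exact (hp i).le
  set ps := N * pb / (N - pb) with hps
  have hps0 : 0 < ps := by rw [hps]; positivity
  set B := (∑ j, β j) / N with hB
  have hB0 : 0 ≤ B := div_nonneg (Finset.sum_nonneg fun i _ => (hβ i).le) (by linarith)
  have hc : ∀ i, 0 ≤ 1 + ps * (1 - 1 / p i) := fun i => by have := hθ i; positivity
  have ha : ∀ i, 0 ≤ β i + ps * B * (1 - 1 / p i) := fun i => by
    have := hθ i; have := (hβ i).le; positivity
  have hterm : ∀ i, (profile K M (1 + ps * (1 - 1 / p i)) (β i + ps * B * (1 - 1 / p i)) x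
        * Z ^ (q * (1 + ps * (1 - 1 / p i)))) ^ (1 / ((N : ℝ) - 1))
      = (relHeight K x * Z ^ q) ^ ((1 + ps * (1 - 1 / p i)) * (1 / ((N : ℝ) - 1)))
        * truncHeight K M x ^ ((β i + ps * B * (1 - 1 / p i)) * (1 / ((N : ℝ) - 1))) := by
    intro i
    rw [profile, Real.rpow_mul hZ, mul_right_comm, ← Real.mul_rpow hr0 (by positivity),
      Real.mul_rpow (by positivity) (by positivity), ← Real.rpow_mul (by positivity),
      ← Real.rpow_mul hT0.le]
  simp_rw [hterm]
  rw [Finset.prod_mul_distrib,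
    ← Real.rpow_sum_of_nonneg (by positivity) fun i _ => mul_nonneg (hc i) (by positivity),
    ← Real.rpow_sum_of_nonneg hT0.le fun i _ => mul_nonneg (ha i) (by positivity)]
  have hsθ : ∑ i, (1 - 1 / p i) = N - N / pb := by
    rw [Finset.sum_sub_distrib, hpb]; simp
  have hβs : ∑ i, β i = N * B := by rw [hB]; field_simp
  congr 2
  · rw [← Finset.sum_mul, Finset.sum_add_distrib, ← Finset.mul_sum, hsθ]
    simp only [Finset.sum_const, Finset.card_univ, Fintype.card_fin, nsmul_eq_mul, mul_one]
    rw [hps]; field_simp; ring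
  · rw [← Finset.sum_mul, Finset.sum_add_distrib, ← Finset.mul_sum, hsθ, hβs, hps]
    field_simp; ring

/-- The integrand controlling the weak derivatives in the parabolic embedding. -/
noncomputable def gradTerm (K β q x W Z D : ℝ) : ℝ :=
  if 0 < x then (x + K) ^ (β - 1) * |W| * Z ^ q + (x + K) ^ β * |D| else 0

theorem gradTerm_nonneg {K β q x W Z D : ℝ} (hK : 0 < K) (hZ : 0 ≤ Z) :
    0 ≤ gradTerm K β q x W Z D := by
  unfold gradTerm
  split_ifs with h
  · positivity
  · exact le_rfl

theorem measurable_gradTerm {X : Type*} [MeasurableSpace X] {K β q : ℝ} {h w ζ D : X → ℝ}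
    (hh : Measurable h) (hw : Measurable w) (hζ : Measurable ζ) (hD : Measurable D) :
    Measurable fun z => gradTerm K β q (h z) (w z) (ζ z) (D z) := by
  unfold gradTerm
  refine Measurable.ite (measurableSet_lt measurable_const hh) ?_ measurable_const
  have h1 : Measurable fun z => |w z| := measurable_norm.comp hw
  have h2 : Measurable fun z => |D z| := measurable_norm.comp hD
  fun_prop

theorem measurable_spaceDeriv {N : ℕ} {i : Fin N} {ζ : Space N × ℝ → ℝ} (hζ : ContDiff ℝ 1 ζ) :
    Measurable (spaceDeriv i ζ) :=
  ((hζ.continuous_fderiv (by simp)).clm_apply continuous_const).measurable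

theorem spaceDeriv_rpow {N : ℕ} (i : Fin N) {ζ : Space N × ℝ → ℝ} (hζ : ContDiff ℝ 1 ζ) {e : ℝ}
    (he : 1 ≤ e) (z : Space N × ℝ) :
    spaceDeriv i (fun z => ζ z ^ e) z = e * ζ z ^ (e - 1) * spaceDeriv i ζ z := by
  unfold spaceDeriv
  have h := ((hζ.differentiable (by simp) z).hasFDerivAt).rpow_const (p := e) (Or.inr he)
  rw [h.fderiv]
  simp

theorem measurable_relHeight {K : ℝ} : Measurable (relHeight K) := by
  unfold relHeight; fun_prop

theorem measurable_truncHeight {K M : ℝ} : Measurable (truncHeight K M) := by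
  unfold truncHeight; fun_prop

/-- On each slice the Sobolev inequality bounds (∫ Q)^((N-p)/N) by the slice gradients. Hölder in x
with exponents (N-p)/N and p/N brings in the bound S on ∫ G, and Hölder in t joins the N gradient
factors. The constant is independent of the truncation M. -/
theorem parabolic_embedding_trunc {N : ℕ} (hN : 2 ≤ N) {p β : Fin N → ℝ} {pb q : ℝ}
    (hp : ∀ i, 1 < p i) (hpb0 : 0 < pb) (hpbN : pb < N) (hpb : ∑ i, 1 / p i = N / pb)
    (hβ : ∀ i, 0 < β i) (hq : 1 ≤ q) :
    ∃ A : ENNReal, A ≠ ⊤ ∧ ∀ {K M : ℝ} (_ : 0 < K) (_ : 0 < M) {Ω : Set (Space N)} (_ : IsOpen Ω)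
      {T a b : ℝ} (_ : 0 < a) (_ : b ≤ T) {h : Space N × ℝ → ℝ} {w : Fin N → Space N × ℝ → ℝ}
      (_ : Measurable h) (_ : ∀ z, 0 ≤ h z) (_ : ∀ i, Measurable (w i))
      (_ : ∀ i, HasWeakSpaceDeriv (Ω ×ˢ Ioo 0 T) i h (w i))
      {ζ : Space N × ℝ → ℝ} (_ : ContDiff ℝ 1 ζ) (_ : ∀ z, ζ z ∈ Icc (0 : ℝ) 1)
      {κ : Set (Space N)} (_ : IsCompact κ) (_ : κ ⊆ Ω) (_ : ∀ x t, x ∉ κ → ζ (x, t) = 0)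
      (_ : ∀ x t, t ≤ a → ζ (x, t) = 0) {G : Space N × ℝ → ENNReal} (_ : Measurable G)
      {S E : ENNReal} (_ : S ≠ ⊤) (_ : E ≠ ⊤)
      (_ : ∀ᵐ t ∂(volume.restrict (Ioo a b)), ∫⁻ x : Space N, G (x, t) ≤ S)
      (_ : ∀ i, ∫⁻ z in univ ×ˢ Ioo a b,
        ENNReal.ofReal (gradTerm K (β i) q (h z) (w i z) (ζ z) (spaceDeriv i ζ z)) ^ p i ≤ E),
      ∫⁻ z in univ ×ˢ Ioo a b, ENNReal.ofReal ((relHeight K (h z) * ζ z ^ q) ^ pb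
          * truncHeight K M (h z) ^ (pb * ((∑ j, β j) / N))) * G z ^ (pb / N)
        ≤ A * S ^ (pb / N) * E := by
  have hN1 : (1 : ℝ) < N := by exact_mod_cast (by omega : 1 < N)
  have hN0 : 0 < (N : ℝ) - 1 := by linarith
  have hNpos : 0 < (N : ℝ) := by linarith
  have hNp : 0 < (N : ℝ) - pb := by linarith
  have hp0 : ∀ i, 0 < p i := fun i => by linarith [hp i]
  have hθ : ∀ i, 0 < 1 - 1 / p i := fun i => by
    rw [sub_pos, div_lt_one (hp0 i)]; exact hp i
  set ps := N * pb / (N - pb) with hps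
  have hps0 : 0 < ps := by rw [hps]; positivity
  set B := (∑ j, β j) / N with hB
  have hB0 : 0 ≤ B := div_nonneg (Finset.sum_nonneg fun i _ => (hβ i).le) hNpos.le
  set c : Fin N → ℝ := fun i => 1 + ps * (1 - 1 / p i) with hc
  set a' : Fin N → ℝ := fun i => β i + ps * B * (1 - 1 / p i) with ha'
  have hc1 : ∀ i, 1 < c i := fun i => by
    have := mul_pos hps0 (hθ i); simp only [hc]; linarith
  have ha0 : ∀ i, 0 ≤ a' i := fun i => by
    have := (hθ i).le; have := (hβ i).le; simp only [ha']; positivity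
  set C0 : ℝ := ∑ i, (c i + a' i + q * c i) with hC0
  have hCi : ∀ i, 0 ≤ c i + a' i + q * c i := fun i => by
    have := hc1 i; have := ha0 i; positivity
  have hCle : ∀ i, c i + a' i + q * c i ≤ C0 := fun i =>
    Finset.single_le_sum (f := fun i => c i + a' i + q * c i) (fun j _ => hCi j)
      (Finset.mem_univ i)
  have hC00 : 0 ≤ C0 := Finset.sum_nonneg fun i _ => hCi i
  refine ⟨(N : ENNReal) ^ pb * ENNReal.ofReal C0 ^ pb, ENNReal.mul_ne_top
    (ENNReal.rpow_ne_top_of_nonneg hpb0.le (by simp))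
    (ENNReal.rpow_ne_top_of_nonneg hpb0.le (by simp)), ?_⟩
  intro K M hK hM Ω hΩ T a b hab hbT h w hhm hh0 hwm hhw ζ hζ hζ01 κ hκ hκΩ hζκ hζa G hG S E hS hE
    hGS hEi
  have hζm : Measurable ζ := hζ.continuous.measurable
  set g : Fin N → Space N × ℝ → ENNReal := fun i z =>
    ENNReal.ofReal (gradTerm K (β i) q (h z) (w i z) (ζ z) (spaceDeriv i ζ z)) with hg
  have hgm : ∀ i, Measurable (g i) := fun i =>
    (measurable_gradTerm hhm (hwm i) hζm (measurable_spaceDeriv hζ)).ennreal_ofReal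
  set P : Fin N → Space N × ℝ → ENNReal := fun i z => ENNReal.ofReal C0 * g i z with hP
  have hPm : ∀ i, Measurable (P i) := fun i => (hgm i).const_mul _
  set Q : Space N × ℝ → ENNReal := fun z => ENNReal.ofReal
    ((relHeight K (h z) * ζ z ^ q) ^ ps * truncHeight K M (h z) ^ (ps * B)) with hQ
  have hQm : Measurable Q := by
    have h1 := (measurable_relHeight (K := K)).comp hhm
    have h2 := (measurable_truncHeight (K := K) (M := M)).comp hhm
    exact (((h1.mul (hζm.pow_const q)).pow_const ps).mul (h2.pow_const _)).ennreal_ofReal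
  have hgtop : ∀ i, ∫⁻ t in Ioo a b, ∫⁻ x : Space N, g i (x, t) ^ p i ≤ E := fun i => by
    rw [← lintegral_slab ((hgm i).pow_const _)]; exact hEi i
  have hgfin : ∀ i, ∀ᵐ t ∂(volume.restrict (Ioo a b)), ∫⁻ x : Space N, g i (x, t) ^ p i < ⊤ :=
    fun i => ae_lt_top (((hgm i).pow_const _).lintegral_prod_left')
      ((hgtop i).trans_lt hE.lt_top).ne
  -- the line estimate in each direction
  have hline : ∀ i, ∀ᵐ t ∂(volume.restrict (Ioo a b)), ∀ᵐ x : Space N,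
      ENNReal.ofReal (profile K M (c i) (a' i) (h (x, t)) * ζ (x, t) ^ (q * c i))
        ≤ ∫⁻ s : ℝ, P i (Function.update x i s, t)
          * Q (Function.update x i s, t) ^ (1 - 1 / p i) := by
    intro i
    have hqc : 1 ≤ q * c i := by nlinarith [hc1 i]
    have hFd : ∀ y, HasDerivAt (fun y => profile K M (c i) (a' i) (max y 0))
        (profileDeriv K M (c i) (a' i) (max y 0)) y :=
      hasDerivAt_comp_max_zero (fun x hx => hasDerivAt_profile hK hM (hc1 i).le hx)
        (profileDeriv_zero (hc1 i))
    have hFc : Continuous fun y => profileDeriv K M (c i) (a' i) (max y 0) :=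
      (continuousOn_profileDeriv hK hM (hc1 i)).comp_continuous (by fun_prop)
        fun y => mem_Ici.2 (le_max_right _ _)
    have hζe : ContDiff ℝ 1 fun z => ζ z ^ (q * c i) := hζ.rpow_const_of_le (by simpa using hqc)
    have hz0 : ∀ {z}, ζ z = 0 → ζ z ^ (q * c i) = 0 := fun hz => by
      rw [hz, Real.zero_rpow (by linarith)]
    filter_upwards [ae_ae_slice_line_bound hΩ hab hbT hhm (hwm i) (hhw i) hFd hFc hζe hκ hκΩ
      (fun x t hx => hz0 (hζκ x t hx)) (fun x t ht => hz0 (hζa x t ht))] with t ht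
    filter_upwards [ht] with x hx
    rw [max_eq_left (hh0 _), ← ofReal_norm] at hx
    refine (ENNReal.ofReal_le_ofReal (le_abs_self _)).trans (hx.trans (lintegral_mono fun s => ?_))
    set z : Space N × ℝ := (Function.update x i s, t)
    rw [spaceDeriv_rpow i hζ hqc, max_eq_left (hh0 _), ← ofReal_norm, Real.norm_eq_abs]
    have hb := abs_profile_terms_le (W := w i z) (D := spaceDeriv i ζ z) hK hM (hp i) (hβ i)
      (mul_nonneg hps0.le hB0) hps0 hq (hh0 z) (hζ01 z).1 (hζ01 z).2
    refine (ENNReal.ofReal_le_ofReal hb).trans ?_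
    have hgt := gradTerm_nonneg (β := β i) (q := q) (x := h z) (W := w i z)
      (D := spaceDeriv i ζ z) hK (hζ01 z).1
    have hr0 := relHeight_nonneg hK (hh0 z)
    have hT0 := (truncHeight_pos hK hM (hh0 z)).le
    have hz := (hζ01 z).1
    have hQ0 : 0 ≤ (relHeight K (h z) * ζ z ^ q) ^ ps * truncHeight K M (h z) ^ (ps * B) := by
      positivity
    simp only [hP, hQ, hg]
    rw [ENNReal.ofReal_rpow_of_nonneg hQ0 (hθ i).le, ← ENNReal.ofReal_mul hC00,
      ← ENNReal.ofReal_mul (mul_nonneg hC00 hgt)]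
    refine ENNReal.ofReal_le_ofReal ?_
    refine mul_le_mul_of_nonneg_right ?_ (Real.rpow_nonneg hQ0 _)
    exact mul_le_mul_of_nonneg_right (hCle i) hgt
  -- This is the purpose of truncation: Q is bounded by a power of M and vanishes outside the
  -- compact set κ, so the slice integral to be absorbed is finite.
  have hQlt : ∀ t, ∫⁻ x : Space N, Q (x, t) < ⊤ := by
    intro t
    calc ∫⁻ x : Space N, Q (x, t)
        ≤ ∫⁻ x : Space N, κ.indicator (fun _ => ENNReal.ofReal (M ^ (ps * B))) x := by
          refine lintegral_mono fun x => ?_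
          by_cases hx : x ∈ κ
          · rw [indicator_of_mem hx]
            refine ENNReal.ofReal_le_ofReal ?_
            have hr0 := relHeight_nonneg hK (hh0 (x, t))
            have hr1 := relHeight_le_one hK (hh0 (x, t))
            have hT0 := (truncHeight_pos hK hM (hh0 (x, t))).le
            have hz := hζ01 (x, t)
            have h1 : (relHeight K (h (x, t)) * ζ (x, t) ^ q) ^ ps ≤ 1 := by
              refine Real.rpow_le_one (mul_nonneg hr0 (Real.rpow_nonneg hz.1 _)) ?_ hps0.le
              exact mul_le_one₀ hr1 (Real.rpow_nonneg hz.1 _)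
                (Real.rpow_le_one hz.1 hz.2 (by linarith))
            have h2 : truncHeight K M (h (x, t)) ^ (ps * B) ≤ M ^ (ps * B) :=
              Real.rpow_le_rpow hT0 (truncHeight_le_trunc hK hM (hh0 _)) (by positivity)
            calc _ ≤ 1 * M ^ (ps * B) := mul_le_mul h1 h2 (by positivity) zero_le_one
              _ = _ := one_mul _
          · simp [hQ, hζκ x t hx, Real.zero_rpow (by linarith : q ≠ 0), Real.zero_rpow hps0.ne']
      _ < ⊤ := by
          rw [lintegral_indicator hκ.measurableSet, lintegral_const]
          refine ENNReal.mul_lt_top (by simp) ?_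
          simpa using hκ.measure_lt_top
  have hslice : ∀ᵐ t ∂(volume.restrict (Ioo a b)),
      (∫⁻ x : Space N, Q (x, t)) ^ ((N - pb) / N)
        ≤ (N : ENNReal) ^ pb * ENNReal.ofReal C0 ^ pb *
          ∏ i, (∫⁻ x : Space N, g i (x, t) ^ p i) ^ (pb / (N * p i)) := by
    filter_upwards [ae_all_iff.2 hline, ae_all_iff.2 hgfin] with t ht htf
    have hPint : ∀ i, ∫⁻ x : Space N, P i (x, t) ^ p i
        = ENNReal.ofReal C0 ^ p i * ∫⁻ x : Space N, g i (x, t) ^ p i := by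
      intro i
      simp only [hP]
      rw [← lintegral_const_mul' _ _ (ENNReal.rpow_ne_top_of_nonneg (hp0 i).le (by simp))]
      simp_rw [ENNReal.mul_rpow_of_nonneg _ _ (hp0 i).le]
    have := rpow_lintegral_le_of_le_line hN hp hpb0 hpbN hpb
      (P := fun i x => P i (x, t)) (Q := fun x => Q (x, t))
      (f := fun i x => ENNReal.ofReal
        (profile K M (c i) (a' i) (h (x, t)) * ζ (x, t) ^ (q * c i)))
      (fun i => (hPm i).comp (by fun_prop)) (hQm.comp (by fun_prop)) (fun i => ?_) (hQlt t).ne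
      ht (fun x => ?_)
    · refine this.trans (le_of_eq ?_)
      rw [mul_assoc]
      congr 1
      simp_rw [hPint]
      have hexp : ∀ i, 0 ≤ pb / (N * p i) := fun i => by have := hp0 i; positivity
      simp_rw [ENNReal.mul_rpow_of_nonneg _ _ (hexp _), ← ENNReal.rpow_mul]
      rw [Finset.prod_mul_distrib]
      congr 1
      rw [ENNReal.prod_rpow_eq_rpow_sum _ fun i _ => mul_nonneg (hp0 i).le (hexp i)]
      congr 1
      have : ∀ i, p i * (pb / (N * p i)) = pb / N := fun i => by
        have := hp0 i; field_simp
      simp_rw [this]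
      simp; field_simp
    · rw [hPint]
      exact ENNReal.mul_ne_top (ENNReal.rpow_ne_top_of_nonneg (hp0 i).le (by simp)) (htf i).ne
    · have hr0 := relHeight_nonneg hK (hh0 (x, t))
      have hT0 := (truncHeight_pos hK hM (hh0 (x, t))).le
      have hz := (hζ01 (x, t)).1
      have hnn : ∀ i, 0 ≤ profile K M (c i) (a' i) (h (x, t)) * ζ (x, t) ^ (q * c i) := fun i => by
        unfold profile; positivity
      have hprod := prod_profile_rpow_eq (q := q) hN hp hpb0 hpbN hpb hβ hK hM (hh0 (x, t)) hz
      simp only [hQ]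
      rw [← hprod, ENNReal.ofReal_prod_of_nonneg fun i _ => Real.rpow_nonneg (hnn i) _]
      refine Finset.prod_le_prod' fun i _ => ?_
      rw [ENNReal.ofReal_rpow_of_nonneg (hnn i) (by positivity)]
  have hQr : ∀ z, ENNReal.ofReal ((relHeight K (h z) * ζ z ^ q) ^ pb
      * truncHeight K M (h z) ^ (pb * B)) = Q z ^ ((N - pb) / N) := by
    intro z
    have hr0 := relHeight_nonneg hK (hh0 z)
    have hT0 := (truncHeight_pos hK hM (hh0 z)).le
    have hz := (hζ01 z).1
    simp only [hQ]
    have hrz : 0 ≤ relHeight K (h z) * ζ z ^ q := by positivity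
    generalize relHeight K (h z) * ζ z ^ q = R at hrz ⊢
    rw [ENNReal.ofReal_rpow_of_nonneg (by positivity) (by positivity),
      Real.mul_rpow (by positivity) (by positivity), ← Real.rpow_mul (by positivity),
      ← Real.rpow_mul hT0]
    congr 3
    · rw [hps]; field_simp
    · rw [hps]; field_simp
  simp_rw [hQr]
  rw [lintegral_slab (f := fun z => Q z ^ ((N - pb) / N) * G z ^ (pb / N))
    ((hQm.pow_const _).mul (hG.pow_const _))]
  calc ∫⁻ t in Ioo a b, ∫⁻ x : Space N, Q (x, t) ^ ((N - pb) / N) * G (x, t) ^ (pb / N)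
      ≤ ∫⁻ t in Ioo a b, ((N : ENNReal) ^ pb * ENNReal.ofReal C0 ^ pb * S ^ (pb / N)) *
          ∏ i, (∫⁻ x : Space N, g i (x, t) ^ p i) ^ (pb / (N * p i)) := by
        refine lintegral_mono_ae ?_
        filter_upwards [hslice, hGS] with t ht hSt
        have hH := ENNReal.lintegral_mul_norm_pow_le (μ := (volume : Measure (Space N)))
          (f := fun x => Q (x, t)) (g := fun x => G (x, t))
          (hQm.comp (by fun_prop)).aemeasurable (hG.comp (by fun_prop)).aemeasurable
          (p := (N - pb) / N) (q := pb / N) (by positivity) (by positivity) (by field_simp; ring)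
        refine hH.trans ?_
        calc _ ≤ ((N : ENNReal) ^ pb * ENNReal.ofReal C0 ^ pb *
              ∏ i, (∫⁻ x : Space N, g i (x, t) ^ p i) ^ (pb / (N * p i))) * S ^ (pb / N) :=
              mul_le_mul' ht (ENNReal.rpow_le_rpow hSt (by positivity))
          _ = _ := by ring
    _ = ((N : ENNReal) ^ pb * ENNReal.ofReal C0 ^ pb * S ^ (pb / N)) * ∫⁻ t in Ioo a b,
          ∏ i, (∫⁻ x : Space N, g i (x, t) ^ p i) ^ (pb / (N * p i)) := by
        refine lintegral_const_mul' _ _ (ENNReal.mul_ne_top (ENNReal.mul_ne_top ?_ ?_) ?_)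
        · exact ENNReal.rpow_ne_top_of_nonneg hpb0.le (by simp)
        · exact ENNReal.rpow_ne_top_of_nonneg hpb0.le (by simp)
        · exact ENNReal.rpow_ne_top_of_nonneg (by positivity) hS
    _ ≤ ((N : ENNReal) ^ pb * ENNReal.ofReal C0 ^ pb * S ^ (pb / N)) * E := by
        gcongr
        -- The definition of the harmonic mean p is exactly what makes these exponents admissible
        -- for Hölder in time.
        have hsum : ∑ i, pb / (N * p i) = 1 := by
          have : ∀ i, pb / (N * p i) = pb / N * (1 / p i) := fun i => by
            have := hp0 i; field_simp
          simp_rw [this]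
          rw [← Finset.mul_sum, hpb]; field_simp
        have hnn : ∀ i ∈ (Finset.univ : Finset (Fin N)), 0 ≤ pb / (N * p i) := fun i _ => by
          have := hp0 i; positivity
        refine (ENNReal.lintegral_prod_norm_pow_le Finset.univ (fun i _ =>
          (((hgm i).pow_const _).lintegral_prod_left').aemeasurable) hsum hnn).trans ?_
        calc _ ≤ ∏ i, E ^ (pb / (N * p i)) :=
              Finset.prod_le_prod' fun i hi => ENNReal.rpow_le_rpow (hgtop i) (hnn i hi)
          _ = E := by rw [ENNReal.prod_rpow_eq_rpow_sum _ hnn, hsum, ENNReal.rpow_one]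

/-- Fatou's lemma as the truncation M = n + 1 tends to infinity. -/
theorem parabolic_embedding {N : ℕ} (hN : 2 ≤ N) {p β : Fin N → ℝ} {pb q : ℝ}
    (hp : ∀ i, 1 < p i) (hpb0 : 0 < pb) (hpbN : pb < N) (hpb : ∑ i, 1 / p i = N / pb)
    (hβ : ∀ i, 0 < β i) (hq : 1 ≤ q) :
    ∃ A : ENNReal, A ≠ ⊤ ∧ ∀ {K : ℝ} (_ : 0 < K) {Ω : Set (Space N)} (_ : IsOpen Ω)
      {T a b : ℝ} (_ : 0 < a) (_ : b ≤ T) {h : Space N × ℝ → ℝ} {w : Fin N → Space N × ℝ → ℝ}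
      (_ : Measurable h) (_ : ∀ z, 0 ≤ h z) (_ : ∀ i, Measurable (w i))
      (_ : ∀ i, HasWeakSpaceDeriv (Ω ×ˢ Ioo 0 T) i h (w i))
      {ζ : Space N × ℝ → ℝ} (_ : ContDiff ℝ 1 ζ) (_ : ∀ z, ζ z ∈ Icc (0 : ℝ) 1)
      {κ : Set (Space N)} (_ : IsCompact κ) (_ : κ ⊆ Ω) (_ : ∀ x t, x ∉ κ → ζ (x, t) = 0)
      (_ : ∀ x t, t ≤ a → ζ (x, t) = 0) {G : Space N × ℝ → ENNReal} (_ : Measurable G)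
      {S E : ENNReal} (_ : S ≠ ⊤) (_ : E ≠ ⊤)
      (_ : ∀ᵐ t ∂(volume.restrict (Ioo a b)), ∫⁻ x : Space N, G (x, t) ≤ S)
      (_ : ∀ i, ∫⁻ z in univ ×ˢ Ioo a b,
        ENNReal.ofReal (gradTerm K (β i) q (h z) (w i z) (ζ z) (spaceDeriv i ζ z)) ^ p i ≤ E),
      ∫⁻ z in univ ×ˢ Ioo a b, ENNReal.ofReal ((relHeight K (h z) * ζ z ^ q) ^ pb
          * (h z + K) ^ (pb * ((∑ j, β j) / N))) * G z ^ (pb / N)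
        ≤ A * S ^ (pb / N) * E := by
  obtain ⟨A, hA, hemb⟩ := parabolic_embedding_trunc hN hp hpb0 hpbN hpb hβ hq
  refine ⟨A, hA, ?_⟩
  intro K hK Ω hΩ T a b hab hbT h w hhm hh0 hwm hhw ζ hζ hζ01 κ hκ hκΩ hζκ hζa G hG S E hS hE
    hGS hEi
  set B := (∑ j, β j) / N with hB
  have hB0 : 0 ≤ B := div_nonneg (Finset.sum_nonneg fun i _ => (hβ i).le) (by positivity)
  have hlim : ∀ z, Tendsto (fun n : ℕ => ENNReal.ofReal ((relHeight K (h z) * ζ z ^ q) ^ pb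
      * truncHeight K ((n : ℝ) + 1) (h z) ^ (pb * B))) atTop
      (𝓝 (ENNReal.ofReal ((relHeight K (h z) * ζ z ^ q) ^ pb * (h z + K) ^ (pb * B)))) := by
    intro z
    refine ENNReal.tendsto_ofReal (Tendsto.const_mul _ ?_)
    exact (tendsto_truncHeight hK (hh0 z)).rpow_const (Or.inr (by positivity))
  have hmeas : ∀ n : ℕ, Measurable fun z => ENNReal.ofReal ((relHeight K (h z) * ζ z ^ q) ^ pb
      * truncHeight K ((n : ℝ) + 1) (h z) ^ (pb * B)) := by
    intro n
    have h1 := (measurable_relHeight (K := K)).comp hhm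
    have h2 := (measurable_truncHeight (K := K) (M := (n : ℝ) + 1)).comp hhm
    exact (((h1.mul (hζ.continuous.measurable.pow_const q)).pow_const pb).mul
      (h2.pow_const _)).ennreal_ofReal
  calc _ = ∫⁻ z in univ ×ˢ Ioo a b, (liminf (fun n : ℕ =>
          ENNReal.ofReal ((relHeight K (h z) * ζ z ^ q) ^ pb
            * truncHeight K ((n : ℝ) + 1) (h z) ^ (pb * B))) atTop) * G z ^ (pb / N) := by
        refine lintegral_congr fun z => ?_
        rw [(hlim z).liminf_eq]
    _ ≤ ∫⁻ z in univ ×ˢ Ioo a b, liminf (fun n : ℕ =>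
          ENNReal.ofReal ((relHeight K (h z) * ζ z ^ q) ^ pb
            * truncHeight K ((n : ℝ) + 1) (h z) ^ (pb * B)) * G z ^ (pb / N)) atTop := by
        refine lintegral_mono fun z => ?_
        have := ENNReal.le_liminf_mul (f := atTop) (u := fun n : ℕ =>
          ENNReal.ofReal ((relHeight K (h z) * ζ z ^ q) ^ pb
            * truncHeight K ((n : ℝ) + 1) (h z) ^ (pb * B))) (v := fun _ => G z ^ (pb / N))
        rw [liminf_const] at this
        exact this
    _ ≤ liminf (fun n : ℕ => ∫⁻ z in univ ×ˢ Ioo a b,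
          ENNReal.ofReal ((relHeight K (h z) * ζ z ^ q) ^ pb
            * truncHeight K ((n : ℝ) + 1) (h z) ^ (pb * B)) * G z ^ (pb / N)) atTop :=
        lintegral_liminf_le fun n => (hmeas n).mul (hG.pow_const _)
    _ ≤ A * S ^ (pb / N) * E := by
        refine liminf_le_of_le (by isBoundedDefault) fun c hc => ?_
        obtain ⟨n, hn⟩ := hc.exists
        exact hn.trans (hemb hK (by positivity) hΩ hab hbT hhm hh0 hwm hhw hζ hζ01 hκ hκΩ hζκ hζa
          hG hS hE hGS hEi)

/-! ### Smooth cut-off functions. -/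

theorem exists_abs_deriv_smoothTransition_le :
    ∃ B : ℝ, 0 < B ∧ ∀ x, |deriv Real.smoothTransition x| ≤ B := by
  have hc : Continuous (deriv Real.smoothTransition) :=
    (Real.smoothTransition.contDiff (n := 1)).continuous_deriv le_rfl
  obtain ⟨B, hB⟩ := isCompact_Icc.exists_bound_of_continuousOn (s := Icc (0 : ℝ) 1) hc.continuousOn
  refine ⟨max B 1, by positivity, fun x => ?_⟩
  by_cases hx : x ∈ Icc (0 : ℝ) 1
  · exact (hB x hx).trans (le_max_left _ _)
  · have h0 : deriv Real.smoothTransition x = 0 := by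
      rw [mem_Icc, not_and_or, not_le, not_le] at hx
      rcases hx with hx | hx
      · have : Real.smoothTransition =ᶠ[𝓝 x] fun _ => 0 := by
          filter_upwards [Iio_mem_nhds hx] with y hy
          exact Real.smoothTransition.zero_of_nonpos (le_of_lt hy)
        rw [this.deriv_eq]; simp
      · have : Real.smoothTransition =ᶠ[𝓝 x] fun _ => 1 := by
          filter_upwards [Ioi_mem_nhds hx] with y hy
          exact Real.smoothTransition.one_of_one_le (le_of_lt hy)
        rw [this.deriv_eq]; simp
    rw [h0, abs_zero]
    positivity

/-- A smooth bump equal to `1` on `|s - c| ≤ R - d` and to `0` on `|s - c| ≥ R`. -/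
noncomputable def intervalBump (c R d s : ℝ) : ℝ :=
  Real.smoothTransition ((s - c + R) / d) * Real.smoothTransition ((c + R - s) / d)

theorem contDiff_intervalBump (c R d : ℝ) : ContDiff ℝ ∞ (intervalBump c R d) :=
  (Real.smoothTransition.contDiff.comp (by fun_prop)).mul
    (Real.smoothTransition.contDiff.comp (by fun_prop))

theorem intervalBump_mem (c R d s : ℝ) : intervalBump c R d s ∈ Icc (0 : ℝ) 1 :=
  ⟨mul_nonneg (Real.smoothTransition.nonneg _) (Real.smoothTransition.nonneg _),
    mul_le_one₀ (Real.smoothTransition.le_one _) (Real.smoothTransition.nonneg _)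
      (Real.smoothTransition.le_one _)⟩

theorem intervalBump_eq_one {c R d s : ℝ} (hd : 0 < d) (h : |s - c| ≤ R - d) :
    intervalBump c R d s = 1 := by
  rw [abs_le] at h
  rw [intervalBump, Real.smoothTransition.one_of_one_le, Real.smoothTransition.one_of_one_le, one_mul]
  · rw [le_div_iff₀ hd]; linarith
  · rw [le_div_iff₀ hd]; linarith

theorem intervalBump_eq_zero {c R d s : ℝ} (hd : 0 < d) (h : R ≤ |s - c|) :
    intervalBump c R d s = 0 := by
  rw [intervalBump]
  rcases le_abs.1 h with h | h
  · rw [Real.smoothTransition.zero_of_nonpos (x := (c + R - s) / d), mul_zero]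
    exact div_nonpos_of_nonpos_of_nonneg (by linarith) hd.le
  · rw [Real.smoothTransition.zero_of_nonpos (x := (s - c + R) / d), zero_mul]
    exact div_nonpos_of_nonpos_of_nonneg (by linarith) hd.le

theorem hasDerivAt_smoothTransition (x : ℝ) :
    HasDerivAt Real.smoothTransition (deriv Real.smoothTransition x) x :=
  ((Real.smoothTransition.contDiff (n := 1)).differentiable (by simp) x).hasDerivAt

theorem exists_intervalBump_deriv {B : ℝ} (hB : ∀ x, |deriv Real.smoothTransition x| ≤ B)
    {c R d : ℝ} (hd : 0 < d) (s : ℝ) :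
    ∃ D, HasDerivAt (intervalBump c R d) D s ∧ |D| ≤ 2 * B / d := by
  have h1 : HasDerivAt (fun s => Real.smoothTransition ((s - c + R) / d)) _ s :=
    (hasDerivAt_smoothTransition _).comp s ((((hasDerivAt_id s).sub_const c).add_const R).div_const d)
  have h2 : HasDerivAt (fun s => Real.smoothTransition ((c + R - s) / d)) _ s :=
    (hasDerivAt_smoothTransition _).comp s (((hasDerivAt_id s).const_sub (c + R)).div_const d)
  refine ⟨_, h1.mul h2, ?_⟩
  have hB1 := hB ((s - c + R) / d)
  have hB2 := hB ((c + R - s) / d)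
  have n1 := Real.smoothTransition.nonneg ((s - c + R) / d)
  have n2 := Real.smoothTransition.nonneg ((c + R - s) / d)
  have l1 := Real.smoothTransition.le_one ((s - c + R) / d)
  have l2 := Real.smoothTransition.le_one ((c + R - s) / d)
  have hB0 : 0 ≤ B := (abs_nonneg _).trans hB1
  refine (abs_add_le _ _).trans ?_
  simp only [abs_mul, abs_div, abs_neg, abs_one, abs_of_pos hd, abs_of_nonneg n1,
    abs_of_nonneg n2]
  calc _ ≤ B * (1 / d) * 1 + 1 * (B * (1 / d)) := by gcongr
    _ = 2 * B / d := by ring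

theorem isOpen_box {N : ℕ} (r : Fin N → ℝ) (y : Space N) : IsOpen (box r y) := by
  have : box r y = ⋂ i, {x | |x i - y i| < r i} := by ext; simp [box]
  rw [this]
  exact isOpen_iInter_of_finite fun i => isOpen_lt (by fun_prop) continuous_const

/-- Smooth space-time cut-off between two concentric cylinders. -/
noncomputable def cylBump {N : ℕ} (x₀ : Space N) (t₀ : ℝ) (R d : Fin N → ℝ) (η δ : ℝ)
    (z : Space N × ℝ) : ℝ :=
  (∏ i, intervalBump (x₀ i) (R i) (d i) (z.1 i)) * Real.smoothTransition ((z.2 - (t₀ - η)) / δ)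

section CylBump

variable {N : ℕ} {x₀ : Space N} {t₀ : ℝ} {R d : Fin N → ℝ} {η δ : ℝ}

theorem contDiff_cylBump : ContDiff ℝ ∞ (cylBump x₀ t₀ R d η δ) := by
  refine ContDiff.mul ?_ (Real.smoothTransition.contDiff.comp (by fun_prop))
  exact contDiff_prod fun i _ => (contDiff_intervalBump _ _ _).comp (by fun_prop)

theorem prod_intervalBump_mem (s : Finset (Fin N)) (x : Space N) :
    ∏ i ∈ s, intervalBump (x₀ i) (R i) (d i) (x i) ∈ Icc (0 : ℝ) 1 :=
  ⟨Finset.prod_nonneg fun _ _ => (intervalBump_mem _ _ _ _).1,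
    Finset.prod_le_one (fun _ _ => (intervalBump_mem _ _ _ _).1)
      fun _ _ => (intervalBump_mem _ _ _ _).2⟩

theorem cylBump_mem (z : Space N × ℝ) : cylBump x₀ t₀ R d η δ z ∈ Icc (0 : ℝ) 1 := by
  have h := prod_intervalBump_mem (x₀ := x₀) (R := R) (d := d) Finset.univ z.1
  exact ⟨mul_nonneg h.1 (Real.smoothTransition.nonneg _),
    mul_le_one₀ h.2 (Real.smoothTransition.nonneg _) (Real.smoothTransition.le_one _)⟩

theorem cylBump_eq_one (hd : ∀ i, 0 < d i) (hδ : 0 < δ) {x : Space N} {t : ℝ}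
    (hx : ∀ i, |x i - x₀ i| ≤ R i - d i) (ht : t₀ - η + δ ≤ t) :
    cylBump x₀ t₀ R d η δ (x, t) = 1 := by
  rw [cylBump, Real.smoothTransition.one_of_one_le, mul_one]
  · exact Finset.prod_eq_one fun i _ => intervalBump_eq_one (hd i) (hx i)
  · rw [le_div_iff₀ hδ]; simp only; linarith

theorem cylBump_eq_zero_of_space (hd : ∀ i, 0 < d i) {x : Space N} {i : Fin N}
    (hx : R i ≤ |x i - x₀ i|) (t : ℝ) : cylBump x₀ t₀ R d η δ (x, t) = 0 := by
  rw [cylBump, Finset.prod_eq_zero (Finset.mem_univ i) (intervalBump_eq_zero (hd i) hx), zero_mul]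

theorem cylBump_eq_zero_of_time (hδ : 0 < δ) (x : Space N) {t : ℝ} (ht : t ≤ t₀ - η) :
    cylBump x₀ t₀ R d η δ (x, t) = 0 := by
  rw [cylBump, Real.smoothTransition.zero_of_nonpos, mul_zero]
  exact div_nonpos_of_nonpos_of_nonneg (by simp only; linarith) hδ.le

/-- A zero of a non-negative function is a minimum. This localises the derivatives of the cut-off
without any discussion of supports. -/
theorem fderiv_cylBump_eq_zero {z : Space N × ℝ} (hz : cylBump x₀ t₀ R d η δ z = 0) :
    fderiv ℝ (cylBump x₀ t₀ R d η δ) z = 0 := by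
  refine IsLocalMin.fderiv_eq_zero (Eventually.of_forall fun y => ?_)
  rw [hz]
  exact (cylBump_mem y).1

theorem abs_spaceDeriv_cylBump_le {B : ℝ} (hB : ∀ x, |deriv Real.smoothTransition x| ≤ B)
    (hd : ∀ i, 0 < d i) (i : Fin N) (z : Space N × ℝ) :
    |spaceDeriv i (cylBump x₀ t₀ R d η δ) z| ≤ 2 * B / d i := by
  have hlin : HasDerivAt (fun s : ℝ => z + s • ((Pi.single i 1, 0) : Space N × ℝ))
      (Pi.single i 1, 0) 0 := by
    simpa using ((hasDerivAt_id (0 : ℝ)).smul_const ((Pi.single i 1, 0) : Space N × ℝ)).const_add z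
  have hc : HasFDerivAt (cylBump x₀ t₀ R d η δ) (fderiv ℝ (cylBump x₀ t₀ R d η δ) z)
      (z + (0 : ℝ) • ((Pi.single i 1, 0) : Space N × ℝ)) := by
    simpa using (contDiff_cylBump.differentiable (by simp) z).hasFDerivAt
  have h1 := hc.comp_hasDerivAt (0 : ℝ) hlin
  obtain ⟨D, hD, hDB⟩ := exists_intervalBump_deriv hB (c := x₀ i) (R := R i) (hd i) (z.1 i)
  set A : ℝ := (∏ k ∈ Finset.univ.erase i, intervalBump (x₀ k) (R k) (d k) (z.1 k))
    * Real.smoothTransition ((z.2 - (t₀ - η)) / δ) with hA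
  have hA01 : 0 ≤ A ∧ A ≤ 1 := by
    have h := prod_intervalBump_mem (x₀ := x₀) (R := R) (d := d) (Finset.univ.erase i) z.1
    exact ⟨mul_nonneg h.1 (Real.smoothTransition.nonneg _),
      mul_le_one₀ h.2 (Real.smoothTransition.nonneg _) (Real.smoothTransition.le_one _)⟩
  have hfun : (cylBump x₀ t₀ R d η δ) ∘ (fun s : ℝ => z + s • ((Pi.single i 1, 0) : Space N × ℝ))
      = fun s => A * intervalBump (x₀ i) (R i) (d i) (z.1 i + s) := by
    ext s
    simp only [Function.comp, cylBump, hA]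
    rw [← Finset.mul_prod_erase Finset.univ _ (Finset.mem_univ i)]
    have : ∀ k ∈ Finset.univ.erase i, intervalBump (x₀ k) (R k) (d k)
        ((z + s • ((Pi.single i 1, 0) : Space N × ℝ)).1 k)
        = intervalBump (x₀ k) (R k) (d k) (z.1 k) := by
      intro k hk
      have := Finset.ne_of_mem_erase hk
      simp [this]
    rw [Finset.prod_congr rfl this]
    simp
    ring
  have h2 : HasDerivAt (fun s => A * intervalBump (x₀ i) (R i) (d i) (z.1 i + s)) (A * D) 0 := by
    refine HasDerivAt.const_mul A ?_
    have : HasDerivAt (intervalBump (x₀ i) (R i) (d i)) D (z.1 i + 0) := by simpa using hD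
    simpa using this.comp_const_add (z.1 i) 0
  rw [hfun] at h1
  have : spaceDeriv i (cylBump x₀ t₀ R d η δ) z = A * D := h1.unique h2
  rw [this, abs_mul, abs_of_nonneg hA01.1]
  calc A * |D| ≤ 1 * |D| := by gcongr; exact hA01.2
    _ ≤ 2 * B / d i := by rw [one_mul]; exact hDB

theorem abs_timeDeriv_cylBump_le {B : ℝ} (hB : ∀ x, |deriv Real.smoothTransition x| ≤ B)
    (hδ : 0 < δ) (z : Space N × ℝ) :
    |timeDeriv (cylBump x₀ t₀ R d η δ) z| ≤ B / δ := by
  have hlin : HasDerivAt (fun s : ℝ => z + s • ((0, 1) : Space N × ℝ)) (0, 1) 0 := by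
    simpa using ((hasDerivAt_id (0 : ℝ)).smul_const ((0, 1) : Space N × ℝ)).const_add z
  have hc : HasFDerivAt (cylBump x₀ t₀ R d η δ) (fderiv ℝ (cylBump x₀ t₀ R d η δ) z)
      (z + (0 : ℝ) • ((0, 1) : Space N × ℝ)) := by
    simpa using (contDiff_cylBump.differentiable (by simp) z).hasFDerivAt
  have h1 := hc.comp_hasDerivAt (0 : ℝ) hlin
  set A : ℝ := ∏ i, intervalBump (x₀ i) (R i) (d i) (z.1 i) with hA
  have hA01 : A ∈ Icc (0 : ℝ) 1 := prod_intervalBump_mem _ _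
  have hfun : (cylBump x₀ t₀ R d η δ) ∘ (fun s : ℝ => z + s • ((0, 1) : Space N × ℝ))
      = fun s => A * Real.smoothTransition ((z.2 + s - (t₀ - η)) / δ) := by
    ext s
    simp [cylBump, hA]
  have h2 : HasDerivAt (fun s => A * Real.smoothTransition ((z.2 + s - (t₀ - η)) / δ))
      (A * (deriv Real.smoothTransition ((z.2 + 0 - (t₀ - η)) / δ) * (1 / δ))) 0 := by
    refine HasDerivAt.const_mul A ?_
    exact (hasDerivAt_smoothTransition _).comp (0 : ℝ)
      ((((hasDerivAt_id (0 : ℝ)).const_add z.2).sub_const (t₀ - η)).div_const δ)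
  rw [hfun] at h1
  have : timeDeriv (cylBump x₀ t₀ R d η δ) z = _ := h1.unique h2
  rw [this, abs_mul, abs_mul, abs_of_nonneg hA01.1, abs_of_pos (one_div_pos.2 hδ)]
  have hb := hB ((z.2 + 0 - (t₀ - η)) / δ)
  calc _ ≤ 1 * (B * (1 / δ)) := by
        gcongr
        exact hA01.2
    _ = B / δ := by ring

theorem isCutoff_cylBump {r : Fin N → ℝ} {η₀ : ℝ} (hd : ∀ i, 0 < d i) (hr : ∀ i, R i ≤ r i) :
    IsCutoff r η₀ x₀ t₀ (cylBump x₀ t₀ R d η δ) where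
  smooth := ⟨contDiff_cylBump.continuous.continuousOn, 1, fun _ => cylBump x₀ t₀ R d η δ,
    fun _ => contDiff_cylBump, fun z _ => ⟨0, rfl⟩⟩
  mem_Icc := fun z _ => cylBump_mem z
  eq_zero := by
    rintro ⟨x, t⟩ ⟨hx, -⟩
    have hx' : x ∉ box r x₀ := by
      rw [(isOpen_box r x₀).frontier_eq] at hx
      exact hx.2
    simp only [box, mem_ofPred_eq, not_forall, not_lt] at hx'
    obtain ⟨i, hi⟩ := hx'
    exact cylBump_eq_zero_of_space hd ((hr i).trans hi) t

end CylBump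

/-! ### Bounds for g. -/

theorem gFun_eq_zero {m a b : ℝ} (hab : a ≤ b) : gFun m a b = 0 := by
  have : ∫ z in b..a, z ^ (1 / m - 1) * max (z - b) 0 = ∫ z in b..a, (0 : ℝ) := by
    refine intervalIntegral.integral_congr fun z hz => ?_
    rw [uIcc_of_ge hab] at hz
    simp [max_eq_right (sub_nonpos.2 hz.2)]
  rw [gFun, this]
  simp

theorem intervalIntegrable_gFun {m b c d : ℝ} (hm : 0 < m) :
    IntervalIntegrable (fun z : ℝ => z ^ (1 / m - 1) * max (z - b) 0) volume c d := by
  have h1 : IntervalIntegrable (fun z : ℝ => z ^ (1 / m - 1)) volume c d :=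
    intervalIntegral.intervalIntegrable_rpow' (by have := one_div_pos.2 hm; linarith)
  exact h1.mul_continuousOn (by fun_prop)

theorem gFun_le {m a b : ℝ} (hm : 0 < m) (hb : 0 < b) (hab : b ≤ a) :
    gFun m a b ≤ 1 / m * a ^ (1 / m + 1) := by
  have ha : 0 < a := hb.trans_le hab
  rw [gFun]
  gcongr
  calc ∫ z in b..a, z ^ (1 / m - 1) * max (z - b) 0 ≤ ∫ z in b..a, a ^ (1 / m) := by
        refine intervalIntegral.integral_mono_on hab (intervalIntegrable_gFun hm)
          (by simp) fun z hz => ?_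
        have hz0 : 0 < z := hb.trans_le hz.1
        rw [max_eq_left (by linarith [hz.1])]
        calc z ^ (1 / m - 1) * (z - b) ≤ z ^ (1 / m - 1) * z := by gcongr; linarith
          _ = z ^ (1 / m) := by rw [Real.rpow_sub_one hz0.ne']; field_simp
          _ ≤ a ^ (1 / m) := Real.rpow_le_rpow hz0.le hz.2 (by positivity)
    _ = (a - b) * a ^ (1 / m) := by simp
    _ ≤ a * a ^ (1 / m) := by gcongr; linarith
    _ = a ^ (1 / m + 1) := by rw [Real.rpow_add_one ha.ne']; ring

theorem gFun_nonneg {m a b : ℝ} (hm : 0 < m) (hb : 0 < b) : 0 ≤ gFun m a b := by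
  rcases le_total a b with h | h
  · rw [gFun_eq_zero h]
  · refine mul_nonneg (by positivity) (intervalIntegral.integral_nonneg h fun z hz => ?_)
    have : 0 ≤ z := hb.le.trans hz.1
    positivity

/-- On the upper half of [b, a] one has z ≥ a/2 and z - b ≥ (a - b)/2, and that half has length (a -
b)/2. -/
theorem exists_le_gFun {m : ℝ} (hm : 0 < m) : ∃ c : ℝ, 0 < c ∧ ∀ a b : ℝ, 0 < b → b ≤ a →
    c * (((a - b) / a) ^ 2 * a ^ (1 / m + 1)) ≤ gFun m a b := by
  -- The minimum covers both signs of the exponent 1/m - 1.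
  set c₁ : ℝ := min 1 ((1 / 2 : ℝ) ^ (1 / m - 1)) with hc₁
  have hc₁0 : 0 < c₁ := by rw [hc₁]; positivity
  refine ⟨1 / m * (c₁ / 4), by positivity, fun a b hb hab => ?_⟩
  have ha : 0 < a := hb.trans_le hab
  have hlow : ∀ z, a / 2 ≤ z → z ≤ a → c₁ * a ^ (1 / m - 1) ≤ z ^ (1 / m - 1) := by
    intro z hz1 hz2
    have hz0 : 0 < z := by linarith
    have hza : z = (z / a) * a := by field_simp
    have h1 : 1 / 2 ≤ z / a := by rw [le_div_iff₀ ha]; linarith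
    have h2 : z / a ≤ 1 := by rw [div_le_one ha]; exact hz2
    rw [hza, Real.mul_rpow (by positivity) ha.le]
    gcongr
    rcases le_total 0 (1 / m - 1) with he | he
    · exact (min_le_right _ _).trans (Real.rpow_le_rpow (by norm_num) h1 he)
    · exact (min_le_left _ _).trans (Real.one_le_rpow_of_pos_of_le_one_of_nonpos
        (by positivity) h2 he)
  rw [gFun, mul_assoc]
  gcongr
  have hmid : b ≤ (a + b) / 2 := by linarith
  have hmid' : (a + b) / 2 ≤ a := by linarith
  rw [← intervalIntegral.integral_add_adjacent_intervals (b := (a + b) / 2)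
    (intervalIntegrable_gFun hm) (intervalIntegrable_gFun hm)]
  have hfirst : 0 ≤ ∫ z in b..(a + b) / 2, z ^ (1 / m - 1) * max (z - b) 0 := by
    refine intervalIntegral.integral_nonneg hmid fun z hz => ?_
    have : 0 ≤ z := hb.le.trans hz.1
    positivity
  have hsecond : ∫ z in (a + b) / 2..a, c₁ * a ^ (1 / m - 1) * ((a - b) / 2)
      ≤ ∫ z in (a + b) / 2..a, z ^ (1 / m - 1) * max (z - b) 0 := by
    refine intervalIntegral.integral_mono_on hmid' (by simp)
      (intervalIntegrable_gFun hm) fun z hz => ?_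
    have hz1 : a / 2 ≤ z := by linarith [hz.1]
    have h3 : (a - b) / 2 ≤ max (z - b) 0 := le_max_of_le_left (by linarith [hz.1])
    have h4 : 0 ≤ (a - b) / 2 := by linarith
    have : 0 ≤ z := by linarith
    exact mul_le_mul (hlow z hz1 hz.2) h3 h4 (by positivity)
  refine le_trans (le_of_eq ?_) (hsecond.trans (by linarith))
  rw [intervalIntegral.integral_const, smul_eq_mul, Real.rpow_add_one ha.ne',
    Real.rpow_sub_one ha.ne']
  field_simp
  ring

/-! ### Lower-order growth compared with 𝓗 and 𝓡. -/

theorem rpow_div_le_of_eq {y e L A H : ℝ} (hy : 0 < y) (he : e = L) (hH : 1 / A ≤ H) (hL : 0 ≤ L)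
    (hH0 : 0 ≤ H) : y ^ e / A ≤ 2 ^ L * (H * y ^ L) := by
  subst he
  have h2 : (1 : ℝ) ≤ 2 ^ e := Real.one_le_rpow (by norm_num) hL
  calc y ^ e / A = 1 * (1 / A * y ^ e) := by ring
    _ ≤ 2 ^ e * (H * y ^ e) := by
        have h3 : 1 / A * y ^ e ≤ H * y ^ e := by gcongr
        have h4 : 0 ≤ H * y ^ e := by positivity
        nlinarith

/-- The powers y^e / A and H' y^L cross at y = (1/(A H'))^(1/(L-e)); above that height the larger
power wins. Allowing y down to k/2 costs 2^(L-e). -/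
theorem rpow_div_le_of_lt {y k e L A H H' : ℝ} (hk : 0 < k) (hy : k / 2 ≤ y) (he0 : 0 ≤ e)
    (he : e < L) (hA : 0 < A) (hH' : 0 < H') (hH : H' ≤ H)
    (hle : (1 / (A * H')) ^ (1 / (L - e)) ≤ k) : y ^ e / A ≤ 2 ^ L * (H * y ^ L) := by
  have hy0 : 0 < y := by linarith
  have hLe : 0 < L - e := by linarith
  have h1 : 1 / (A * H') ≤ (2 * y) ^ (L - e) := by
    have h2 : (1 / (A * H')) ^ (1 / (L - e)) ≤ 2 * y := by linarith
    have h3 := Real.rpow_le_rpow (by positivity) h2 hLe.le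
    rwa [← Real.rpow_mul (by positivity), one_div_mul_cancel hLe.ne', Real.rpow_one] at h3
  have h4 : 1 / A ≤ H' * (2 * y) ^ (L - e) := by
    rw [div_le_iff₀ (by positivity)] at h1
    rw [div_le_iff₀ hA]
    nlinarith
  calc y ^ e / A = y ^ e * (1 / A) := by ring
    _ ≤ y ^ e * (H' * (2 * y) ^ (L - e)) := by gcongr
    _ = 2 ^ (L - e) * (H' * (y ^ e * y ^ (L - e))) := by
        rw [Real.mul_rpow (by norm_num) hy0.le]; ring
    _ = 2 ^ (L - e) * (H' * y ^ L) := by rw [← Real.rpow_add hy0]; ring_nf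
    _ ≤ 2 ^ L * (H * y ^ L) := by
        gcongr
        · norm_num
        · linarith

namespace Exponents

variable {N : ℕ} {D : Exponents N}

/-- For N = 1 the harmonic mean is p_1 > 1, contrary to p < N; for N = 0 the quotient convention
gives p = 0. -/
theorem Admissible.two_le (hD : D.Admissible) : 2 ≤ N := by
  by_contra hN
  have hlt := hD.pBar_lt
  have hcases : N = 0 ∨ N = 1 := by omega
  rcases hcases with rfl | rfl
  · simp [pBar] at hlt
  · have h1 := hD.one_lt_p 0
    simp [pBar] at hlt
    linarith

theorem Admissible.p_pos (hD : D.Admissible) (i : Fin N) : 0 < D.p i := by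
  linarith [hD.one_lt_p i]

theorem Admissible.one_lt_q (hD : D.Admissible) (i : Fin N) : 1 < D.q i :=
  (hD.one_lt_p i).trans_le (hD.p_le_q i)

theorem Admissible.cast_pos (hD : D.Admissible) : (0 : ℝ) < N := by
  have := hD.two_le
  exact_mod_cast (by omega : 0 < N)

theorem Admissible.sum_inv_pos (hD : D.Admissible) : 0 < ∑ i, 1 / D.p i := by
  have hN := hD.two_le
  have : Nonempty (Fin N) := ⟨⟨0, by omega⟩⟩
  exact Finset.sum_pos (fun i _ => one_div_pos.2 (hD.p_pos i)) Finset.univ_nonempty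

theorem Admissible.pBar_pos (hD : D.Admissible) : 0 < D.pBar := by
  have := hD.sum_inv_pos
  have := hD.cast_pos
  unfold pBar
  positivity

theorem Admissible.sum_inv_eq (hD : D.Admissible) : ∑ i, 1 / D.p i = N / D.pBar := by
  have := hD.sum_inv_pos
  have := hD.cast_pos
  unfold pBar
  field_simp

theorem Admissible.mMin_pos (hD : D.Admissible) : 0 < D.mMin := by
  have hN := hD.two_le
  have : Nonempty (Fin N) := ⟨⟨0, by omega⟩⟩
  obtain ⟨i, hi⟩ := exists_eq_ciInf_of_finite (f := fun i => min (D.m i) (D.n i))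
  rw [mMin, ← hi]
  exact lt_min (hD.m_pos i) (hD.n_pos i)

theorem q_le_qMax (D : Exponents N) (i : Fin N) : D.q i ≤ D.qMax :=
  le_ciSup (f := D.q) (finite_range _).bddAbove i

theorem Admissible.one_lt_qMax (hD : D.Admissible) : 1 < D.qMax := by
  have hN := hD.two_le
  exact (hD.one_lt_q ⟨0, by omega⟩).trans_le (D.q_le_qMax _)

theorem Lam_le_LamMax (D : Exponents N) (i : Fin N) : D.Lam i ≤ D.LamMax :=
  le_ciSup (f := D.Lam) (finite_range _).bddAbove i

theorem Admissible.exists_Lam_eq (hD : D.Admissible) : ∃ i, D.Lam i = D.LamMax := by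
  have hN := hD.two_le
  have : Nonempty (Fin N) := ⟨⟨0, by omega⟩⟩
  exact exists_eq_ciSup_of_finite (f := D.Lam)

theorem Admissible.lam_pos (hD : D.Admissible) (i : Fin N) : 0 < D.lam i :=
  mul_pos (hD.m_pos i) (by linarith [hD.one_lt_p i])

theorem Admissible.Lam_pos (hD : D.Admissible) (i : Fin N) : 0 < D.Lam i :=
  (hD.lam_pos i).trans_le (hD.lam_le_Lam i)

theorem Admissible.lam_le_LamMax (hD : D.Admissible) (i : Fin N) : D.lam i ≤ D.LamMax :=
  (hD.lam_le_Lam i).trans (D.Lam_le_LamMax i)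

/-- The lower-order growth appearing in the energy estimate. -/
noncomputable def growth (D : Exponents N) (θ : ℝ) (ρ : Fin N → ℝ) (y : ℝ) : ℝ :=
  y / θ + (∑ i, y ^ D.lam i / ρ i ^ D.p i) + ∑ i, y ^ D.Lam i / ρ i ^ D.q i

section Growth

variable {θ : ℝ} {ρ : Fin N → ℝ}

theorem calH_nonneg (hθ : 0 < θ) (hρ : ∀ i, 0 < ρ i) : 0 ≤ D.calH θ ρ := by
  have h1 : ∀ (S : Finset (Fin N)) (r : Fin N → ℝ), 0 ≤ ∑ i ∈ S, 1 / ρ i ^ r i := fun S r =>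
    Finset.sum_nonneg fun i _ => by have := hρ i; positivity
  unfold calH
  split_ifs
  · positivity
  · have := h1 {i | D.lam i = 1} D.p
    have := h1 {i | D.Lam i = 1} D.q
    positivity
  · exact add_nonneg (h1 _ _) (h1 _ _)

theorem calR_nonneg (hθ : 0 < θ) (hρ : ∀ i, 0 < ρ i) : 0 ≤ D.calR θ ρ := by
  have hs : 0 ≤ D.sigmaLam ρ := Finset.sum_nonneg fun i _ => by have := hρ i; positivity
  have hs' : 0 ≤ D.sigmalam ρ := by
    unfold sigmalam
    split_ifs
    · exact Finset.sum_nonneg fun i _ => by have := hρ i; positivity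
    · exact hs
  unfold calR
  split_ifs
  · exact add_nonneg (Finset.sum_nonneg fun i _ => by have := hρ i; positivity)
      (Finset.sum_nonneg fun i _ => by have := hρ i; positivity)
  · exact add_nonneg (Finset.sum_nonneg fun i _ => by have := hρ i; positivity)
      (Finset.sum_nonneg fun i _ => by have := hρ i; positivity)
  · exact add_nonneg (add_nonneg (add_nonneg
      (Finset.sum_nonneg fun i _ => by have := hρ i; positivity)
      (Finset.sum_nonneg fun i _ => by have := hρ i; positivity))
      (Finset.sum_nonneg fun i _ => by have := hρ i; positivity))
      (Finset.sum_nonneg fun i _ => by have := hρ i; positivity)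

theorem growth_le_of_terms {L H y : ℝ} (h0 : y / θ ≤ 2 ^ L * (H * y ^ L))
    (h1 : ∀ i, y ^ D.lam i / ρ i ^ D.p i ≤ 2 ^ L * (H * y ^ L))
    (h2 : ∀ i, y ^ D.Lam i / ρ i ^ D.q i ≤ 2 ^ L * (H * y ^ L)) :
    D.growth θ ρ y ≤ (1 + 2 * N) * 2 ^ L * (H * y ^ L) := by
  have s1 := Finset.sum_le_sum fun i (_ : i ∈ Finset.univ) => h1 i
  have s2 := Finset.sum_le_sum fun i (_ : i ∈ Finset.univ) => h2 i
  simp only [Finset.sum_const, Finset.card_univ, Fintype.card_fin, nsmul_eq_mul] at s1 s2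
  unfold growth
  linarith

/-- Terms of top degree 𝓛 are read off from 𝓗. Each term of lower degree is compared with one
quantity H' ≤ 𝓗, and the crossing height is then a summand of 𝓡. For Λ ≤ 1 the choice is H' = 1/θ;
for Λ > 1 it is 1/σ_λ or 1/σ_Λ for the spatial terms. -/
theorem Admissible.growth_le (hD : D.Admissible) (hθ : 0 < θ) (hρ : ∀ i, 0 < ρ i) {k y : ℝ}
    (hk : 0 < k) (hR : D.calR θ ρ ≤ k) (hy : k / 2 ≤ y) :
    D.growth θ ρ y ≤ (1 + 2 * N) * 2 ^ D.calL * (D.calH θ ρ * y ^ D.calL) := by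
  have hy0 : 0 < y := by linarith
  have hH0 := calH_nonneg (D := D) hθ hρ
  have hρp : ∀ i, 0 < ρ i ^ D.p i := fun i => by have := hρ i; positivity
  have hρq : ∀ i, 0 < ρ i ^ D.q i := fun i => by have := hρ i; positivity
  have hsum : ∀ (S : Finset (Fin N)) (f : Fin N → ℝ), (∀ i, 0 ≤ f i) → 0 ≤ ∑ i ∈ S, f i :=
    fun S f hf => Finset.sum_nonneg fun i _ => hf i
  have hsingle : ∀ (S : Finset (Fin N)) (f : Fin N → ℝ), (∀ i, 0 ≤ f i) → ∀ i ∈ S,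
      f i ≤ ∑ i ∈ S, f i := fun S f hf i hi => Finset.single_le_sum (fun j _ => hf j) hi
  have np : ∀ i, 0 ≤ 1 / ρ i ^ D.p i := fun i => by have := hρp i; positivity
  have nq : ∀ i, 0 ≤ 1 / ρ i ^ D.q i := fun i => by have := hρq i; positivity
  rcases le_or_gt D.LamMax 1 with hΛ | hΛ
  · have hL : D.calL = 1 := max_eq_left hΛ
    have hHθ : 1 / θ ≤ D.calH θ ρ := by
      unfold calH
      split_ifs with h1 h2
      · exact le_rfl
      · have := hsum {i | D.lam i = 1} _ np
        have := hsum {i | D.Lam i = 1} _ nq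
        linarith
      · exact absurd (lt_of_le_of_ne hΛ h2) h1
    have e0 : y / θ = y ^ (1 : ℝ) / θ := by rw [Real.rpow_one]
    have rp : ∀ i, 0 ≤ (θ / ρ i ^ D.p i) ^ (1 / (1 - D.lam i)) := fun i => by
      have := hρp i; positivity
    have rq : ∀ i, 0 ≤ (θ / ρ i ^ D.q i) ^ (1 / (1 - D.Lam i)) := fun i => by
      have := hρq i; positivity
    have hRp : ∀ i, D.lam i < 1 → (θ / ρ i ^ D.p i) ^ (1 / (1 - D.lam i)) ≤ D.calR θ ρ := by
      intro i hi
      unfold calR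
      split_ifs with h1 h2
      · have := hsingle Finset.univ _ rp i (by simp)
        have := hsum Finset.univ _ rq
        linarith
      · have := hsingle {i | D.lam i < 1} _ rp i (by simpa using hi)
        have := hsum {i | D.Lam i < 1} _ rq
        linarith
      · exact absurd (lt_of_le_of_ne hΛ h2) h1
    have hRq : ∀ i, D.Lam i < 1 → (θ / ρ i ^ D.q i) ^ (1 / (1 - D.Lam i)) ≤ D.calR θ ρ := by
      intro i hi
      unfold calR
      split_ifs with h1 h2
      · have := hsingle Finset.univ _ rq i (by simp)
        have := hsum Finset.univ _ rp
        linarith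
      · have := hsingle {i | D.Lam i < 1} _ rq i (by simpa using hi)
        have := hsum {i | D.lam i < 1} _ rp
        linarith
      · exact absurd (lt_of_le_of_ne hΛ h2) h1
    have hθi : 0 < 1 / θ := by positivity
    rw [hL]
    refine growth_le_of_terms ?_ (fun i => ?_) fun i => ?_
    · rw [e0]
      exact rpow_div_le_of_eq hy0 rfl hHθ zero_le_one hH0
    · rcases ((hD.lam_le_LamMax i).trans hΛ).eq_or_lt with h | h
      · refine rpow_div_le_of_eq hy0 h ?_ zero_le_one hH0
        have hΛ1 : D.LamMax = 1 := le_antisymm hΛ (h ▸ hD.lam_le_LamMax i)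
        rw [calH, if_neg (by linarith), if_pos hΛ1]
        have := hsingle {i | D.lam i = 1} _ np i (by simpa using h)
        have := hsum {i | D.Lam i = 1} _ nq
        linarith
      · refine rpow_div_le_of_lt hk hy (hD.lam_pos i).le h (hρp i) hθi hHθ ?_
        refine le_trans (le_of_eq ?_) ((hRp i h).trans hR)
        congr 1
        field_simp
    · rcases ((D.Lam_le_LamMax i).trans hΛ).eq_or_lt with h | h
      · refine rpow_div_le_of_eq hy0 h ?_ zero_le_one hH0
        have hΛ1 : D.LamMax = 1 := le_antisymm hΛ (h ▸ D.Lam_le_LamMax i)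
        rw [calH, if_neg (by linarith), if_pos hΛ1]
        have := hsingle {i | D.Lam i = 1} _ nq i (by simpa using h)
        have := hsum {i | D.lam i = 1} _ np
        linarith
      · refine rpow_div_le_of_lt hk hy (hD.Lam_pos i).le h (hρq i) hθi hHθ ?_
        refine le_trans (le_of_eq ?_) ((hRq i h).trans hR)
        congr 1
        field_simp
  · have hL : D.calL = D.LamMax := max_eq_right hΛ.le
    have hL0 : 0 ≤ D.LamMax := by linarith
    have hHeq : D.calH θ ρ = (∑ i with D.lam i = D.LamMax, 1 / ρ i ^ D.p i)
        + ∑ i with D.Lam i = D.LamMax, 1 / ρ i ^ D.q i := by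
      rw [calH, if_neg (by linarith), if_neg (by linarith)]
    have hHp : ∀ i, D.lam i = D.LamMax → 1 / ρ i ^ D.p i ≤ D.calH θ ρ := by
      intro i hi
      rw [hHeq]
      have := hsingle {i | D.lam i = D.LamMax} _ np i (by simpa using hi)
      have := hsum {i | D.Lam i = D.LamMax} _ nq
      linarith
    have hHq : ∀ i, D.Lam i = D.LamMax → 1 / ρ i ^ D.q i ≤ D.calH θ ρ := by
      intro i hi
      rw [hHeq]
      have := hsingle {i | D.Lam i = D.LamMax} _ nq i (by simpa using hi)
      have := hsum {i | D.lam i = D.LamMax} _ np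
      linarith
    obtain ⟨l, hl⟩ := hD.exists_Lam_eq
    have hσΛ : ρ l ^ D.q l ≤ D.sigmaLam ρ :=
      hsingle {i | D.Lam i = D.LamMax} (fun i => ρ i ^ D.q i) (fun i => (hρq i).le) l
        (by simpa using hl)
    have hσΛ0 : 0 < D.sigmaLam ρ := (hρq l).trans_le hσΛ
    have hσΛH : 1 / D.sigmaLam ρ ≤ D.calH θ ρ :=
      (one_div_le_one_div_of_le (hρq l) hσΛ).trans (hHq l hl)
    -- A sum dominates each of its terms, so the reciprocal of σ_λ is at most a single summand of 𝓗.
    have hσlam : 0 < D.sigmalam ρ ∧ 1 / D.sigmalam ρ ≤ D.calH θ ρ := by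
      unfold sigmalam
      split_ifs with hex
      · obtain ⟨j, hj⟩ := hex
        have h3 : ρ j ^ D.p j ≤ ∑ l with D.lam l = D.LamMax, ρ l ^ D.p l :=
          hsingle {i | D.lam i = D.LamMax} (fun i => ρ i ^ D.p i) (fun i => (hρp i).le) j
            (by simpa using hj)
        exact ⟨(hρp j).trans_le h3, (one_div_le_one_div_of_le (hρp j) h3).trans (hHp j hj)⟩
      · exact ⟨hσΛ0, hσΛH⟩
    have r1 : ∀ i, 0 ≤ (ρ i ^ D.p i / θ) ^ (1 / (D.LamMax - 1)) := fun i => by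
      have := hρp i; positivity
    have r2 : ∀ i, 0 ≤ (ρ i ^ D.q i / θ) ^ (1 / (D.LamMax - 1)) := fun i => by
      have := hρq i; positivity
    have r3 : ∀ i, 0 ≤ (1 / ρ i ^ D.p i * D.sigmalam ρ) ^ (1 / (D.LamMax - D.lam i)) := fun i => by
      have := hρp i; have := hσlam.1; positivity
    have r4 : ∀ i, 0 ≤ (1 / ρ i ^ D.q i * D.sigmaLam ρ) ^ (1 / (D.LamMax - D.Lam i)) := fun i => by
      have := hρq i; positivity
    have hReq : D.calR θ ρ = (∑ i with D.lam i = D.LamMax, (ρ i ^ D.p i / θ) ^ (1 / (D.LamMax - 1)))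
      + (∑ i with D.Lam i = D.LamMax, (ρ i ^ D.q i / θ) ^ (1 / (D.LamMax - 1)))
      + (∑ i with D.lam i < D.LamMax,
          (1 / ρ i ^ D.p i * D.sigmalam ρ) ^ (1 / (D.LamMax - D.lam i)))
      + ∑ i with D.Lam i < D.LamMax,
          (1 / ρ i ^ D.q i * D.sigmaLam ρ) ^ (1 / (D.LamMax - D.Lam i)) := by
      rw [calR, if_neg (by linarith), if_neg (by linarith)]
    have s1 := hsum {i | D.lam i = D.LamMax} _ r1
    have s2 := hsum {i | D.Lam i = D.LamMax} _ r2
    have s3 := hsum {i | D.lam i < D.LamMax} _ r3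
    have s4 := hsum {i | D.Lam i < D.LamMax} _ r4
    rw [hL]
    refine growth_le_of_terms ?_ (fun i => ?_) fun i => ?_
    -- The time term, now of degree 1 < Λ, is compared with the summand of 𝓗 given by an index l
    -- attaining Λ; the crossing height is (ρ_l^q_l / θ)^(1/(Λ-1)).
    · have hq' : 0 < 1 / ρ l ^ D.q l := by have := hρq l; positivity
      have := rpow_div_le_of_lt (e := 1) hk hy zero_le_one hΛ hθ hq' (hHq l hl) ?_
      · simpa using this
      · have h5 := hsingle {i | D.Lam i = D.LamMax} _ r2 l (by simpa using hl)
        have h6 : (ρ l ^ D.q l / θ) ^ (1 / (D.LamMax - 1)) ≤ k := by linarith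
        refine le_trans (le_of_eq ?_) h6
        congr 1
        have := hρq l
        field_simp
    · rcases (hD.lam_le_LamMax i).eq_or_lt with h | h
      · exact rpow_div_le_of_eq hy0 h (hHp i h) hL0 hH0
      · refine rpow_div_le_of_lt hk hy (hD.lam_pos i).le h (hρp i) (one_div_pos.2 hσlam.1)
          hσlam.2 ?_
        have h5 := hsingle {i | D.lam i < D.LamMax} _ r3 i (by simpa using h)
        have h6 : (1 / ρ i ^ D.p i * D.sigmalam ρ) ^ (1 / (D.LamMax - D.lam i)) ≤ k := by linarith
        refine le_trans (le_of_eq ?_) h6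
        congr 1
        have := hρp i
        have := hσlam.1
        field_simp
    · rcases (D.Lam_le_LamMax i).eq_or_lt with h | h
      · exact rpow_div_le_of_eq hy0 h (hHq i h) hL0 hH0
      · refine rpow_div_le_of_lt hk hy (hD.Lam_pos i).le h (hρq i) (one_div_pos.2 hσΛ0)
          hσΛH ?_
        have h5 := hsingle {i | D.Lam i < D.LamMax} _ r4 i (by simpa using h)
        have h6 : (1 / ρ i ^ D.q i * D.sigmaLam ρ) ^ (1 / (D.LamMax - D.Lam i)) ≤ k := by linarith
        refine le_trans (le_of_eq ?_) h6
        congr 1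
        have := hρq i
        field_simp

end Growth

end Exponents

/-! ### Cylinders, and the energy inequality for a measurable representative. -/

theorem cyl_mono {N : ℕ} {r r' : Fin N → ℝ} {η η' : ℝ} (hr : ∀ i, r i ≤ r' i) (hη : η ≤ η')
    (y : Space N) (τ : ℝ) : cyl r η y τ ⊆ cyl r' η' y τ :=
  fun _ hz => ⟨fun i => (hz.1 i).trans_le (hr i), by linarith [hz.2.1], hz.2.2⟩

theorem measurableSet_cyl {N : ℕ} (r : Fin N → ℝ) (η : ℝ) (y : Space N) (τ : ℝ) :
    MeasurableSet (cyl r η y τ) :=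
  (isOpen_box r y).measurableSet.prod measurableSet_Ioo

/-- The closed box around `y`. -/
def closedBox {N : ℕ} (r : Fin N → ℝ) (y : Space N) : Set (Space N) := {x | ∀ i, |x i - y i| ≤ r i}

theorem isCompact_closedBox {N : ℕ} (r : Fin N → ℝ) (y : Space N) : IsCompact (closedBox r y) := by
  have : closedBox r y = Set.pi univ fun i => Icc (y i - r i) (y i + r i) := by
    ext x
    simp only [closedBox, mem_ofPred_eq, Set.mem_pi, mem_univ, true_imp_iff, mem_Icc, abs_le]
    refine forall_congr' fun i => ?_
    constructor <;> rintro ⟨h1, h2⟩ <;> constructor <;> linarith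
  rw [this]
  exact isCompact_univ_pi fun i => isCompact_Icc

section Geometry

variable {N : ℕ} {Ω : Set (Space N)} {T θ t₀ : ℝ} {ρ : Fin N → ℝ} {x₀ : Space N}

theorem cyl_subset_facts (hρ : ∀ i, 0 < ρ i) (hθ : 0 < θ)
    (hsub : cyl (fun i => 8 * ρ i) (8 * θ) x₀ t₀ ⊆ spaceTime Ω T) :
    closedBox ρ x₀ ⊆ Ω ∧ 0 < t₀ - θ ∧ t₀ ≤ T := by
  have hx₀ : x₀ ∈ box (fun i => 8 * ρ i) x₀ := fun i => by
    have := hρ i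
    simp only [sub_self, abs_zero]
    positivity
  have hmid : t₀ - 2 * θ ∈ Ioo (t₀ - 8 * θ) t₀ := ⟨by linarith, by linarith⟩
  refine ⟨fun x hx => ?_, ?_, ?_⟩
  · have hxb : x ∈ box (fun i => 8 * ρ i) x₀ := fun i =>
      (hx i).trans_lt (by have := hρ i; simp only; linarith)
    exact (hsub (mk_mem_prod hxb hmid)).1
  · have := (hsub (mk_mem_prod hx₀ hmid)).2.1
    linarith
  · by_contra hT
    rw [not_le] at hT
    have ht : max ((T + t₀) / 2) (t₀ - θ) ∈ Ioo (t₀ - 8 * θ) t₀ :=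
      ⟨lt_of_lt_of_le (by linarith) (le_max_right _ _), max_lt (by linarith) (by linarith)⟩
    have h1 := (hsub (mk_mem_prod hx₀ ht)).2.2
    have h2 := le_max_left ((T + t₀) / 2) (t₀ - θ)
    simp only at h1
    linarith

theorem cyl_subset_open (hρ : ∀ i, 0 < ρ i) (hθ : 0 < θ)
    (hsub : cyl (fun i => 8 * ρ i) (8 * θ) x₀ t₀ ⊆ spaceTime Ω T) :
    cyl ρ θ x₀ t₀ ⊆ Ω ×ˢ Ioo 0 T := by
  obtain ⟨h1, h2, h3⟩ := cyl_subset_facts hρ hθ hsub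
  rintro ⟨x, t⟩ ⟨hx, ht⟩
  exact ⟨h1 fun i => (hx i).le, by linarith [ht.1], by linarith [ht.2]⟩

end Geometry

theorem HasWeakSpaceDeriv.congr_ae {N : ℕ} {U : Set (Space N × ℝ)} (hU : IsOpen U) {i : Fin N}
    {f f' g g' : Space N × ℝ → ℝ} (h : HasWeakSpaceDeriv U i f g)
    (hf : f =ᵐ[volume.restrict U] f') (hg : g =ᵐ[volume.restrict U] g') :
    HasWeakSpaceDeriv U i f' g' := by
  have hloc : ∀ {a b : Space N × ℝ → ℝ}, a =ᵐ[volume.restrict U] b →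
      LocallyIntegrableOn a U → LocallyIntegrableOn b U := by
    intro a b hab ha
    rw [locallyIntegrableOn_iff hU.isLocallyClosed] at ha ⊢
    intro k hkU hk
    exact (ha k hkU hk).congr_fun_ae (ae_restrict_of_ae_restrict_of_subset hkU hab)
  refine ⟨hloc hf h.1, hloc hg h.2.1, fun φ h1 h2 h3 => ?_⟩
  have e1 : ∫ z in U, f' z * spaceDeriv i φ z = ∫ z in U, f z * spaceDeriv i φ z :=
    integral_congr_ae (by filter_upwards [hf] with z hz; rw [hz])
  have e2 : ∫ z in U, g' z * φ z = ∫ z in U, g z * φ z :=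
    integral_congr_ae (by filter_upwards [hg] with z hz; rw [hz])
  rw [e1, e2]
  exact h.2.2 φ h1 h2 h3

/-- The right-hand side of the energy inequality for cut-off functions vanishing initially. -/
noncomputable def energyRHS {N : ℕ} (D : Exponents N) (C k : ℝ) (u : Space N × ℝ → ℝ)
    (r : Fin N → ℝ) (η : ℝ) (y : Space N) (τ : ℝ) (ζ : Space N × ℝ → ℝ) : ENNReal :=
  ENNReal.ofReal C * (∫⁻ z in cyl r η y τ, ENNReal.ofReal
        (gFun D.mMin (u z ^ D.mMin) (k ^ D.mMin) * |timeDeriv ζ z|))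
    + ENNReal.ofReal C * (∑ i, ∫⁻ z in cyl r η y τ, ENNReal.ofReal
        (u z ^ ((D.m i - D.mMin) * (D.p i - 1)) * max (u z ^ D.mMin - k ^ D.mMin) 0 ^ D.p i
          * |spaceDeriv i ζ z| ^ D.p i))
    + ENNReal.ofReal C * (∑ i, ∫⁻ z in cyl r η y τ, ENNReal.ofReal
        (u z ^ ((D.n i - D.mMin) * (D.q i - 1)) * max (u z ^ D.mMin - k ^ D.mMin) 0 ^ D.q i
          * |spaceDeriv i ζ z| ^ D.q i))

theorem PDGPlus.exists_measurable_rep {N : ℕ} {D : Exponents N} {C T : ℝ} {Ω : Set (Space N)}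
    {u : Space N × ℝ → ℝ} (hu : PDGPlus D C Ω T u) (hΩ : IsOpen Ω) :
    ∃ v : Space N × ℝ → ℝ, Measurable v ∧ (∀ z, 0 ≤ v z) ∧
      ∀ᵐ z ∂(volume.restrict (spaceTime Ω T)), u z = v z := by
  have hm : MeasurableSet (spaceTime Ω T) := hΩ.measurableSet.prod measurableSet_Ioc
  refine ⟨fun z => max (hu.mem_V.1.mk u z) 0,
    hu.mem_V.1.stronglyMeasurable_mk.measurable.max measurable_const, fun z => le_max_right _ _, ?_⟩
  filter_upwards [hu.mem_V.1.ae_eq_mk, ae_restrict_mem hm] with z hz hzm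
  rw [← hz, max_eq_left (hu.nonneg z hzm)]

/-- The initial term vanishes with ζ, and each term on the left is bounded separately. Replacing u
and the weak derivatives by measurable representatives changes the space-time integrals not at all
and the slice integrals only for a null set of times. -/
theorem PDGPlus.exists_energy {N : ℕ} {D : Exponents N} (hD : D.Admissible) {C T : ℝ} (hC : 0 < C)
    {Ω : Set (Space N)} (hΩ : IsOpen Ω) {u v : Space N × ℝ → ℝ} (hu : PDGPlus D C Ω T u)
    (huv : ∀ᵐ z ∂(volume.restrict (spaceTime Ω T)), u z = v z) {k : ℝ} (hk : 0 < k) :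
    ∃ w : Fin N → Space N × ℝ → ℝ, (∀ i, Measurable (w i)) ∧
      (∀ i, HasWeakSpaceDeriv (Ω ×ˢ Ioo 0 T) i
        (fun z => max (v z ^ D.mMin - k ^ D.mMin) 0) (w i)) ∧
      ∀ (ρ : Fin N → ℝ) (θ : ℝ) (x₀ : Space N) (t₀ : ℝ), (∀ i, 0 < ρ i) → 0 < θ →
        cyl (fun i => 8 * ρ i) (8 * θ) x₀ t₀ ⊆ spaceTime Ω T →
        ∀ ζ, IsCutoff ρ θ x₀ t₀ ζ → (∀ x, ζ (x, t₀ - θ) = 0) →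
        (∀ᵐ t ∂(volume.restrict (Ioo (t₀ - θ) t₀)), ∫⁻ x in box ρ x₀, ENNReal.ofReal
          (gFun D.mMin (v (x, t) ^ D.mMin) (k ^ D.mMin) * ζ (x, t) ^ D.qMax)
            ≤ energyRHS D C k v ρ θ x₀ t₀ ζ) ∧
        ∀ i, ∫⁻ z in cyl ρ θ x₀ t₀,
          ENNReal.ofReal (v z ^ ((D.m i - D.mMin) * (D.p i - 1)) * |w i z| ^ D.p i
            * ζ z ^ D.qMax) ≤ ENNReal.ofReal C * energyRHS D C k v ρ θ x₀ t₀ ζ := by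
  obtain ⟨w, hw, hen⟩ := hu.energy k hk
  have hU : IsOpen (Ω ×ˢ Ioo (0 : ℝ) T) := hΩ.prod isOpen_Ioo
  have hwm : ∀ i, AEStronglyMeasurable (w i) (volume.restrict (Ω ×ˢ Ioo (0 : ℝ) T)) := fun i =>
    (hw i).2.1.aestronglyMeasurable
  have huv' : ∀ᵐ z ∂(volume.restrict (Ω ×ˢ Ioo (0 : ℝ) T)), u z = v z :=
    ae_restrict_of_ae_restrict_of_subset (prod_mono_right Ioo_subset_Ioc_self) huv
  refine ⟨fun i => (hwm i).mk (w i), fun i => (hwm i).stronglyMeasurable_mk.measurable,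
    fun i => (hw i).congr_ae hU ?_ (hwm i).ae_eq_mk, ?_⟩
  · filter_upwards [huv'] with z hz
    rw [hz]
  intro ρ θ x₀ t₀ hρ hθ hsub ζ hζ hζ0
  have hcyl := cyl_subset_open hρ hθ hsub
  have huvc : ∀ᵐ z ∂(volume.restrict (cyl ρ θ x₀ t₀)), u z = v z :=
    ae_restrict_of_ae_restrict_of_subset hcyl huv'
  have hwc : ∀ i, ∀ᵐ z ∂(volume.restrict (cyl ρ θ x₀ t₀)), w i z = (hwm i).mk (w i) z := fun i =>
    ae_restrict_of_ae_restrict_of_subset hcyl (hwm i).ae_eq_mk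
  have hE := hen ρ θ x₀ t₀ hρ hθ hsub ζ hζ
  have hrhs : energyRHS D C k u ρ θ x₀ t₀ ζ = energyRHS D C k v ρ θ x₀ t₀ ζ := by
    unfold energyRHS
    congr 1
    · congr 1
      · congr 1
        exact lintegral_congr_ae (by filter_upwards [huvc] with z hz; rw [hz])
      · congr 1
        refine Finset.sum_congr rfl fun i _ => ?_
        exact lintegral_congr_ae (by filter_upwards [huvc] with z hz; rw [hz])
    · congr 1
      refine Finset.sum_congr rfl fun i _ => ?_
      exact lintegral_congr_ae (by filter_upwards [huvc] with z hz; rw [hz])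
  have hq : D.qMax ≠ 0 := by linarith [hD.one_lt_qMax]
  have hinit : (∫⁻ x in box ρ x₀, ENNReal.ofReal
      (gFun D.mMin (u (x, t₀ - θ) ^ D.mMin) (k ^ D.mMin) * ζ (x, t₀ - θ) ^ D.qMax)) = 0 := by
    simp [hζ0, Real.zero_rpow hq]
  unfold EnergyIneq at hE
  rw [hinit, zero_add] at hE
  change _ ≤ energyRHS D C k u ρ θ x₀ t₀ ζ at hE
  rw [hrhs] at hE
  constructor
  -- By Fubini almost every slice of u agrees almost everywhere with that of v, so the supremum over
  -- all t for u bounds almost every slice of v.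
  · have h1 : ∀ᵐ t : ℝ, ∀ᵐ x : Space N, (x, t) ∈ cyl ρ θ x₀ t₀ → u (x, t) = v (x, t) :=
      ae_ae_snd_fst ((ae_restrict_iff' (measurableSet_cyl _ _ _ _)).1 huvc)
    rw [ae_restrict_iff' measurableSet_Ioo]
    filter_upwards [h1] with t ht htI
    have h2 : ∫⁻ x in box ρ x₀, ENNReal.ofReal
        (gFun D.mMin (v (x, t) ^ D.mMin) (k ^ D.mMin) * ζ (x, t) ^ D.qMax)
        = ∫⁻ x in box ρ x₀, ENNReal.ofReal
        (gFun D.mMin (u (x, t) ^ D.mMin) (k ^ D.mMin) * ζ (x, t) ^ D.qMax) := by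
      refine lintegral_congr_ae ?_
      rw [EventuallyEq, ae_restrict_iff' (isOpen_box _ _).measurableSet]
      filter_upwards [ht] with x hx hxb
      rw [hx ⟨hxb, htI⟩]
    rw [h2]
    refine le_trans ?_ (le_self_add.trans hE)
    exact le_iSup₂ (f := fun t (_ : t ∈ Icc (t₀ - θ) t₀) => ∫⁻ x in box ρ x₀, ENNReal.ofReal
        (gFun D.mMin (u (x, t) ^ D.mMin) (k ^ D.mMin) * ζ (x, t) ^ D.qMax)) t
        (Ioo_subset_Icc_self htI)
  · intro i
    have h2 : ∫⁻ z in cyl ρ θ x₀ t₀, ENNReal.ofReal (v z ^ ((D.m i - D.mMin) * (D.p i - 1))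
          * |(hwm i).mk (w i) z| ^ D.p i * ζ z ^ D.qMax)
        = ∫⁻ z in cyl ρ θ x₀ t₀, ENNReal.ofReal (u z ^ ((D.m i - D.mMin) * (D.p i - 1))
          * |w i z| ^ D.p i * ζ z ^ D.qMax) :=
      lintegral_congr_ae (by filter_upwards [huvc, hwc i] with z hz hz'; rw [hz, hz'])
    rw [h2]
    have h3 := (le_add_self.trans hE : ENNReal.ofReal (1 / C) * _ ≤ _)
    have h4 : ENNReal.ofReal C * ENNReal.ofReal (1 / C) = 1 := by
      rw [← ENNReal.ofReal_mul hC.le, mul_one_div_cancel hC.ne', ENNReal.ofReal_one]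
    calc _ ≤ ∑ i, ∫⁻ z in cyl ρ θ x₀ t₀, ENNReal.ofReal
          (u z ^ ((D.m i - D.mMin) * (D.p i - 1)) * |w i z| ^ D.p i * ζ z ^ D.qMax) :=
          Finset.single_le_sum (f := fun i => ∫⁻ z in cyl ρ θ x₀ t₀, ENNReal.ofReal
          (u z ^ ((D.m i - D.mMin) * (D.p i - 1)) * |w i z| ^ D.p i * ζ z ^ D.qMax))
          (fun _ _ => zero_le) (Finset.mem_univ i)
      _ = ENNReal.ofReal C * (ENNReal.ofReal (1 / C) * ∑ i, ∫⁻ z in cyl ρ θ x₀ t₀, ENNReal.ofReal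
          (u z ^ ((D.m i - D.mMin) * (D.p i - 1)) * |w i z| ^ D.p i * ζ z ^ D.qMax)) := by
          rw [← mul_assoc, h4, one_mul]
      _ ≤ _ := by gcongr

/-! ### The right side of the energy inequality above the level 𝓡. -/

theorem setLIntegral_le_of_le_indicator {X : Type*} [MeasurableSpace X] {μ : Measure X}
    {S S' : Set X} (hS : MeasurableSet S) {f : X → ENNReal} {g : X → ℝ} {c : ℝ} (hc : 0 ≤ c)
    (hf : ∀ z ∈ S, f z ≤ S'.indicator (fun z => ENNReal.ofReal (c * g z)) z) :
    ∫⁻ z in S, f z ∂μ ≤ ENNReal.ofReal c * ∫⁻ z in S', ENNReal.ofReal (g z) ∂μ := by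
  calc ∫⁻ z in S, f z ∂μ ≤ ∫⁻ z in S, S'.indicator (fun z => ENNReal.ofReal (c * g z)) z ∂μ :=
        setLIntegral_mono' hS hf
    _ ≤ ∫⁻ z, S'.indicator (fun z => ENNReal.ofReal (c * g z)) z ∂μ :=
        setLIntegral_le_lintegral _ _
    _ ≤ ∫⁻ z in S', ENNReal.ofReal (c * g z) ∂μ := lintegral_indicator_le _ _
    _ = _ := by
        simp_rw [ENNReal.ofReal_mul hc]
        exact lintegral_const_mul' _ _ (by simp)

/-- The weight u^((a-m)(P-1)) is such that u^((a-m)(P-1)) (u^m)^P = u^m u^(a(P-1)), which is u^m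
times a growth term. -/
theorem rpow_energy_term_le {y k m a P e ε r B D G : ℝ} (hy : 0 < y) (hk : 0 < k)
    (hP : 0 < P) (hε : 0 < ε) (hr : 0 < r) (hB : 0 ≤ B) (hD : |D| ≤ 2 * B / (ε * r))
    (hG : y ^ (a * (P - 1)) / r ^ P ≤ G) (he : e = (a - m) * (P - 1)) :
    y ^ e * max (y ^ m - k ^ m) 0 ^ P * |D| ^ P
      ≤ (2 * B) ^ P * (1 / ε) ^ P * (y ^ m * G) := by
  have h1 : max (y ^ m - k ^ m) 0 ≤ y ^ m :=
    max_le (by have : 0 ≤ k ^ m := by positivity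
               linarith) (by positivity)
  have h2 : max (y ^ m - k ^ m) 0 ^ P ≤ (y ^ m) ^ P :=
    Real.rpow_le_rpow (le_max_right _ _) h1 hP.le
  have h3 : |D| ^ P ≤ (2 * B / (ε * r)) ^ P := Real.rpow_le_rpow (abs_nonneg _) hD hP.le
  have h4 : (2 * B / (ε * r)) ^ P = (2 * B) ^ P * (1 / ε) ^ P / r ^ P := by
    rw [Real.div_rpow (by positivity) (by positivity), Real.mul_rpow hε.le hr.le,
      Real.div_rpow zero_le_one hε.le, Real.one_rpow]
    have : 0 < ε ^ P := by positivity
    have : 0 < r ^ P := by positivity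
    field_simp
  have h5 : y ^ e * (y ^ m) ^ P = y ^ m * y ^ (a * (P - 1)) := by
    rw [← Real.rpow_mul hy.le, ← Real.rpow_add hy, ← Real.rpow_add hy, he]
    ring_nf
  calc y ^ e * max (y ^ m - k ^ m) 0 ^ P * |D| ^ P
      ≤ y ^ e * (y ^ m) ^ P * ((2 * B) ^ P * (1 / ε) ^ P / r ^ P) := by
        rw [h4] at h3
        gcongr
    _ = (2 * B) ^ P * (1 / ε) ^ P * (y ^ m * (y ^ (a * (P - 1)) / r ^ P)) := by
        rw [h5]; ring
    _ ≤ _ := by gcongr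

namespace Exponents

variable {N : ℕ} {D : Exponents N} {θ y : ℝ} {ρ : Fin N → ℝ}

theorem time_le_growth (hρ : ∀ i, 0 < ρ i) (hy : 0 < y) : y / θ ≤ D.growth θ ρ y := by
  have h1 : 0 ≤ ∑ i, y ^ D.lam i / ρ i ^ D.p i :=
    Finset.sum_nonneg fun i _ => by have := hρ i; positivity
  have h2 : 0 ≤ ∑ i, y ^ D.Lam i / ρ i ^ D.q i :=
    Finset.sum_nonneg fun i _ => by have := hρ i; positivity
  unfold growth; linarith

theorem lam_le_growth (hθ : 0 < θ) (hρ : ∀ i, 0 < ρ i) (hy : 0 < y) (i : Fin N) :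
    y ^ D.lam i / ρ i ^ D.p i ≤ D.growth θ ρ y := by
  have h1 := Finset.single_le_sum (f := fun i => y ^ D.lam i / ρ i ^ D.p i)
    (fun i _ => by have := hρ i; positivity) (Finset.mem_univ i)
  have h2 : 0 ≤ ∑ i, y ^ D.Lam i / ρ i ^ D.q i :=
    Finset.sum_nonneg fun i _ => by have := hρ i; positivity
  have h3 : 0 ≤ y / θ := by positivity
  unfold growth; linarith

theorem Lam_le_growth (hθ : 0 < θ) (hρ : ∀ i, 0 < ρ i) (hy : 0 < y) (i : Fin N) :
    y ^ D.Lam i / ρ i ^ D.q i ≤ D.growth θ ρ y := by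
  have h1 := Finset.single_le_sum (f := fun i => y ^ D.Lam i / ρ i ^ D.q i)
    (fun i _ => by have := hρ i; positivity) (Finset.mem_univ i)
  have h2 : 0 ≤ ∑ i, y ^ D.lam i / ρ i ^ D.p i :=
    Finset.sum_nonneg fun i _ => by have := hρ i; positivity
  have h3 : 0 ≤ y / θ := by positivity
  unfold growth; linarith

end Exponents

/-- Cut-off between the cylinders of relative size `σ` and `σ - ε`. -/
noncomputable def cutoff {N : ℕ} (ρ : Fin N → ℝ) (θ : ℝ) (x₀ : Space N) (t₀ σ ε : ℝ) :
    Space N × ℝ → ℝ :=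
  cylBump x₀ t₀ (fun i => σ * ρ i) (fun i => ε * ρ i) (σ * θ) (ε * θ)

/-- The part of the cylinder of relative size `σ` where `v` exceeds `k`. -/
def superlevel {N : ℕ} (v : Space N × ℝ → ℝ) (k : ℝ) (ρ : Fin N → ℝ) (θ : ℝ) (x₀ : Space N)
    (t₀ σ : ℝ) : Set (Space N × ℝ) :=
  cyl (fun i => σ * ρ i) (σ * θ) x₀ t₀ ∩ {z | k < v z}

theorem cutoff_eq_zero {N : ℕ} {ρ : Fin N → ℝ} {θ : ℝ} {x₀ : Space N} {t₀ σ ε : ℝ}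
    (hρ : ∀ i, 0 < ρ i) (hθ : 0 < θ) (hε : 0 < ε) {z : Space N × ℝ}
    (hz : z ∉ cyl (fun i => σ * ρ i) (σ * θ) x₀ t₀) (ht : z.2 < t₀) :
    cutoff ρ θ x₀ t₀ σ ε z = 0 := by
  obtain ⟨x, t⟩ := z
  by_cases hx : x ∈ box (fun i => σ * ρ i) x₀
  · refine cylBump_eq_zero_of_time (by positivity) x ?_
    by_contra h
    exact hz ⟨hx, not_le.1 h, ht⟩
  · simp only [box, mem_ofPred_eq, not_forall, not_lt] at hx
    obtain ⟨i, hi⟩ := hx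
    exact cylBump_eq_zero_of_space (fun i => by have := hρ i; positivity) hi t

/-- Every integrand lives where v > k and where the cut-off has non-zero derivative, and there it is
at most const · ε^(-q) times v^m and the growth function. The second family of integrals is the
cut-off part of the gradient term in the embedding. -/
theorem exists_cutoff_energy_le {N : ℕ} {D : Exponents N} (hD : D.Admissible) {C : ℝ}
    (hC : 0 < C) : ∃ A : ℝ, 0 < A ∧ ∀ (v : Space N × ℝ → ℝ), (∀ z, 0 ≤ v z) →
      ∀ (ρ : Fin N → ℝ) (θ : ℝ) (x₀ : Space N) (t₀ : ℝ), (∀ i, 0 < ρ i) → 0 < θ →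
      ∀ k₀ k σ ε : ℝ, 0 < k₀ → D.calR θ ρ ≤ k₀ → k₀ / 2 ≤ k → 0 < ε → ε ≤ 1 →
      energyRHS D C k v ρ θ x₀ t₀ (cutoff ρ θ x₀ t₀ σ ε)
        ≤ ENNReal.ofReal (A * (1 / ε) ^ D.qMax * D.calH θ ρ)
          * ∫⁻ z in superlevel v k ρ θ x₀ t₀ σ, ENNReal.ofReal (v z ^ (D.calL + D.mMin)) ∧
      ∀ i, ∫⁻ z in cyl ρ θ x₀ t₀, ENNReal.ofReal (if k < v z then v z ^ (D.lam i + D.mMin)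
          * |spaceDeriv i (cutoff ρ θ x₀ t₀ σ ε) z| ^ D.p i else 0)
        ≤ ENNReal.ofReal (A * (1 / ε) ^ D.qMax * D.calH θ ρ)
          * ∫⁻ z in superlevel v k ρ θ x₀ t₀ σ, ENNReal.ofReal (v z ^ (D.calL + D.mMin)) := by
  obtain ⟨B, hB0, hB⟩ := exists_abs_deriv_smoothTransition_le
  have hm := hD.mMin_pos
  set m := D.mMin with hmdef
  set c₀ : ℝ := (1 + 2 * N) * 2 ^ D.calL with hc₀
  have hc₀0 : 0 < c₀ := by positivity
  set A₀ : ℝ := B / m + (∑ i, (2 * B) ^ D.p i) + ∑ i, (2 * B) ^ D.q i with hA₀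
  have hsp : 0 ≤ ∑ i, (2 * B) ^ D.p i := Finset.sum_nonneg fun i _ => by positivity
  have hsq : 0 ≤ ∑ i, (2 * B) ^ D.q i := Finset.sum_nonneg fun i _ => by positivity
  have hBm : 0 < B / m := by positivity
  have hA₀0 : 0 < A₀ := by linarith
  refine ⟨(C + 1) * (A₀ * c₀), by positivity, ?_⟩
  intro v hv ρ θ x₀ t₀ hρ hθ k₀ k σ ε hk₀ hR hk hε hε1
  set ζ := cutoff ρ θ x₀ t₀ σ ε with hζ
  set Y := ∫⁻ z in superlevel v k ρ θ x₀ t₀ σ, ENNReal.ofReal (v z ^ (D.calL + m)) with hY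
  have hk0 : 0 < k := by linarith
  have hH0 := Exponents.calH_nonneg (D := D) hθ hρ
  have h1ε : 1 ≤ 1 / ε := by rw [le_div_iff₀ hε]; linarith
  set e := (1 / ε) ^ D.qMax with he
  have he0 : 0 < e := by positivity
  have hpe : ∀ i, (1 / ε) ^ D.p i ≤ e := fun i =>
    Real.rpow_le_rpow_of_exponent_le h1ε ((hD.p_le_q i).trans (D.q_le_qMax i))
  have hqe : ∀ i, (1 / ε) ^ D.q i ≤ e := fun i =>
    Real.rpow_le_rpow_of_exponent_le h1ε (D.q_le_qMax i)
  have h1e : 1 / ε ≤ e := by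
    have := Real.rpow_le_rpow_of_exponent_le h1ε hD.one_lt_qMax.le
    rwa [Real.rpow_one] at this
  have hsD : ∀ i z, |spaceDeriv i ζ z| ≤ 2 * B / (ε * ρ i) := fun i z =>
    abs_spaceDeriv_cylBump_le hB (fun i => by have := hρ i; positivity) i z
  have htD : ∀ z, |timeDeriv ζ z| ≤ B / (ε * θ) := fun z =>
    abs_timeDeriv_cylBump_le hB (by positivity) z
  have hzero : ∀ z ∈ cyl ρ θ x₀ t₀, z ∉ cyl (fun i => σ * ρ i) (σ * θ) x₀ t₀ →
      (∀ i, spaceDeriv i ζ z = 0) ∧ timeDeriv ζ z = 0 := by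
    intro z hz hzσ
    have h0 : ζ z = 0 := cutoff_eq_zero hρ hθ hε hzσ hz.2.2
    have h1 : fderiv ℝ ζ z = 0 := fderiv_cylBump_eq_zero h0
    exact ⟨fun i => by simp [spaceDeriv, h1], by simp [timeDeriv, h1]⟩
  have hgrow : ∀ y, k < y → y ^ m * D.growth θ ρ y ≤ c₀ * D.calH θ ρ * y ^ (D.calL + m) := by
    intro y hy
    have hy0 : 0 < y := by linarith
    have := hD.growth_le hθ hρ hk₀ hR (y := y) (by linarith)
    calc y ^ m * D.growth θ ρ y ≤ y ^ m * (c₀ * (D.calH θ ρ * y ^ D.calL)) := by gcongr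
      _ = c₀ * D.calH θ ρ * y ^ (D.calL + m) := by rw [Real.rpow_add hy0]; ring
  -- reduction of each integral to a pointwise bound on the superlevel set
  have hreduce : ∀ (f : Space N × ℝ → ℝ) (b : ℝ), 0 ≤ b →
      (∀ z ∈ cyl ρ θ x₀ t₀, z ∉ cyl (fun i => σ * ρ i) (σ * θ) x₀ t₀ → f z = 0) →
      (∀ z, v z ≤ k → f z = 0) →
      (∀ z, k < v z → f z ≤ b * e * (v z ^ m * D.growth θ ρ (v z))) →
      ∫⁻ z in cyl ρ θ x₀ t₀, ENNReal.ofReal (f z) ≤ ENNReal.ofReal (b * e * (c₀ * D.calH θ ρ)) * Y := by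
    intro f b hb h1 h2 h3
    refine setLIntegral_le_of_le_indicator (measurableSet_cyl _ _ _ _) (by positivity) fun z hz => ?_
    by_cases hzk : k < v z
    · by_cases hzσ : z ∈ cyl (fun i => σ * ρ i) (σ * θ) x₀ t₀
      · rw [indicator_of_mem (show z ∈ superlevel v k ρ θ x₀ t₀ σ from ⟨hzσ, hzk⟩)]
        refine ENNReal.ofReal_le_ofReal ((h3 z hzk).trans ?_)
        rw [mul_assoc]
        have := hgrow _ hzk
        calc _ ≤ b * (e * (c₀ * D.calH θ ρ * v z ^ (D.calL + m))) := by gcongr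
          _ = _ := by ring
      · simp [h1 z hz hzσ]
    · simp [h2 z (not_lt.1 hzk)]
  have hmax0 : ∀ z, v z ≤ k → max (v z ^ m - k ^ m) 0 = 0 := fun z hz =>
    max_eq_right (sub_nonpos.2 (Real.rpow_le_rpow (hv z) hz hm.le))
  have hT := hreduce (fun z => gFun m (v z ^ m) (k ^ m) * |timeDeriv ζ z|) (B / m) hBm.le
    (fun z hz hzσ => by simp [(hzero z hz hzσ).2])
    (fun z hz => by simp [gFun_eq_zero (Real.rpow_le_rpow (hv z) hz hm.le)])
    (fun z hz => by
      have hz0 : 0 < v z := by linarith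
      have hg := gFun_le hm (show 0 < k ^ m by positivity)
        (Real.rpow_le_rpow hk0.le hz.le hm.le)
      have hpow : (v z ^ m) ^ (1 / m + 1) = v z ^ m * v z := by
        rw [← Real.rpow_mul hz0.le, mul_add, mul_one_div_cancel hm.ne', mul_one,
          Real.rpow_add hz0, Real.rpow_one, mul_comm]
      rw [hpow] at hg
      calc gFun m (v z ^ m) (k ^ m) * |timeDeriv ζ z|
          ≤ (1 / m * (v z ^ m * v z)) * (B / (ε * θ)) := by
            gcongr
            exact htD z
        _ = B / m * (1 / ε) * (v z ^ m * (v z / θ)) := by field_simp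
        _ ≤ B / m * e * (v z ^ m * D.growth θ ρ (v z)) := by
            have := D.time_le_growth (θ := θ) hρ hz0
            gcongr)
  have hS : ∀ i, ∫⁻ z in cyl ρ θ x₀ t₀, ENNReal.ofReal
      (v z ^ ((D.m i - m) * (D.p i - 1)) * max (v z ^ m - k ^ m) 0 ^ D.p i
        * |spaceDeriv i ζ z| ^ D.p i) ≤ ENNReal.ofReal ((2 * B) ^ D.p i * e * (c₀ * D.calH θ ρ)) * Y := by
    intro i
    have hp0 := hD.p_pos i
    refine hreduce _ _ (by positivity) (fun z hz hzσ => ?_) (fun z hz => ?_) fun z hz => ?_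
    · simp [(hzero z hz hzσ).1 i, Real.zero_rpow hp0.ne']
    · simp [hmax0 z hz, Real.zero_rpow hp0.ne']
    · have hz0 : 0 < v z := by linarith
      have hgz := (D.time_le_growth (θ := θ) hρ hz0).trans' (by positivity : 0 ≤ v z / θ)
      refine (rpow_energy_term_le hz0 hk0 hp0 hε (hρ i) hB0.le (hsD i z)
        (D.lam_le_growth hθ hρ hz0 i) rfl).trans ?_
      have := hpe i
      gcongr
  have hS' : ∀ i, ∫⁻ z in cyl ρ θ x₀ t₀, ENNReal.ofReal
      (v z ^ ((D.n i - m) * (D.q i - 1)) * max (v z ^ m - k ^ m) 0 ^ D.q i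
        * |spaceDeriv i ζ z| ^ D.q i) ≤ ENNReal.ofReal ((2 * B) ^ D.q i * e * (c₀ * D.calH θ ρ)) * Y := by
    intro i
    have hq0 : 0 < D.q i := by linarith [hD.one_lt_q i]
    refine hreduce _ _ (by positivity) (fun z hz hzσ => ?_) (fun z hz => ?_) fun z hz => ?_
    · simp [(hzero z hz hzσ).1 i, Real.zero_rpow hq0.ne']
    · simp [hmax0 z hz, Real.zero_rpow hq0.ne']
    · have hz0 : 0 < v z := by linarith
      have hgz := (D.time_le_growth (θ := θ) hρ hz0).trans' (by positivity : 0 ≤ v z / θ)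
      refine (rpow_energy_term_le hz0 hk0 hq0 hε (hρ i) hB0.le (hsD i z)
        (D.Lam_le_growth hθ hρ hz0 i) rfl).trans ?_
      have := hqe i
      gcongr
  have hX : 0 ≤ e * (c₀ * D.calH θ ρ) := by positivity
  constructor
  · have hsum : ∀ (r : Fin N → ℝ) (f : Fin N → ENNReal),
        (∀ i, f i ≤ ENNReal.ofReal ((2 * B) ^ r i * e * (c₀ * D.calH θ ρ)) * Y) →
        ∑ i, f i ≤ ENNReal.ofReal ((∑ i, (2 * B) ^ r i) * e * (c₀ * D.calH θ ρ)) * Y := by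
      intro r f hf
      refine (Finset.sum_le_sum fun i _ => hf i).trans (le_of_eq ?_)
      rw [← Finset.sum_mul, ← ENNReal.ofReal_sum_of_nonneg (fun i _ => by positivity)]
      simp_rw [Finset.sum_mul]
    have h1 := hsum D.p _ hS
    have h2 := hsum D.q _ hS'
    unfold energyRHS
    calc _ ≤ ENNReal.ofReal C * (ENNReal.ofReal (B / m * e * (c₀ * D.calH θ ρ)) * Y)
          + ENNReal.ofReal C *
            (ENNReal.ofReal ((∑ i, (2 * B) ^ D.p i) * e * (c₀ * D.calH θ ρ)) * Y)
          + ENNReal.ofReal C *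
            (ENNReal.ofReal ((∑ i, (2 * B) ^ D.q i) * e * (c₀ * D.calH θ ρ)) * Y) := by
          gcongr
      _ = ENNReal.ofReal (C * (A₀ * e * (c₀ * D.calH θ ρ))) * Y := by
          rw [hA₀, add_mul, add_mul, add_mul, add_mul, ENNReal.ofReal_mul hC.le,
            ENNReal.ofReal_add (by positivity) (by positivity),
            ENNReal.ofReal_add (by positivity) (by positivity)]
          ring
      _ ≤ _ := by
          gcongr ENNReal.ofReal ?_ * Y
          nlinarith [mul_nonneg hA₀0.le hX]
  · intro i
    have hp0 := hD.p_pos i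
    refine (hreduce _ ((2 * B) ^ D.p i) (by positivity) (fun z hz hzσ => ?_) (fun z hz => ?_)
      fun z hz => ?_).trans ?_
    · simp [(hzero z hz hzσ).1 i, Real.zero_rpow hp0.ne']
    · simp [not_lt.2 hz]
    · have hz0 : 0 < v z := by linarith
      have hgz := (D.time_le_growth (θ := θ) hρ hz0).trans' (by positivity : 0 ≤ v z / θ)
      simp only [if_pos hz]
      have h3 : |spaceDeriv i ζ z| ^ D.p i ≤ (2 * B / (ε * ρ i)) ^ D.p i :=
        Real.rpow_le_rpow (abs_nonneg _) (hsD i z) hp0.le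
      have hr := hρ i
      have h4 : (2 * B / (ε * ρ i)) ^ D.p i = (2 * B) ^ D.p i * (1 / ε) ^ D.p i / ρ i ^ D.p i := by
        rw [Real.div_rpow (by positivity) (by positivity), Real.mul_rpow hε.le hr.le,
          Real.div_rpow zero_le_one hε.le, Real.one_rpow]
        have : 0 < ε ^ D.p i := by positivity
        have : 0 < ρ i ^ D.p i := by positivity
        field_simp
      rw [h4] at h3
      calc _ ≤ v z ^ (D.lam i + m) * ((2 * B) ^ D.p i * (1 / ε) ^ D.p i / ρ i ^ D.p i) := by gcongr
        _ = (2 * B) ^ D.p i * (1 / ε) ^ D.p i * (v z ^ m * (v z ^ D.lam i / ρ i ^ D.p i)) := by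
            rw [Real.rpow_add hz0]; ring
        _ ≤ _ := by
            have := hpe i
            have := D.lam_le_growth hθ hρ hz0 i
            gcongr
    · have h5 : (2 * B) ^ D.p i ≤ A₀ := by
        have := Finset.single_le_sum (f := fun i => (2 * B) ^ D.p i) (fun i _ => by positivity)
          (Finset.mem_univ i)
        linarith
      gcongr ENNReal.ofReal ?_ * Y
      have h6 := mul_le_mul_of_nonneg_right h5 hX
      have h7 := mul_nonneg (mul_nonneg hC.le hA₀0.le) hX
      nlinarith

/-! ### From one superlevel set to a higher one. -/

theorem max_rpow_sub_add {m k y : ℝ} (hm : 0 < m) (hk : 0 ≤ k) (hy : k < y) :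
    0 < max (y ^ m - k ^ m) 0 ∧ max (y ^ m - k ^ m) 0 + k ^ m = y ^ m := by
  have h : k ^ m < y ^ m := Real.rpow_lt_rpow hk hy hm
  rw [max_eq_left (sub_nonneg.2 h.le)]
  exact ⟨sub_pos.2 h, by ring⟩

theorem max_rpow_sub_eq_zero {m k y : ℝ} (hm : 0 < m) (hy0 : 0 ≤ y) (hy : y ≤ k) :
    max (y ^ m - k ^ m) 0 = 0 :=
  max_eq_right (sub_nonpos.2 (Real.rpow_le_rpow hy0 hy hm.le))

/-- With K = k^m one has h + K = y^m wherever h = (y^m - k^m)_+ is positive. The exponent β = (λ_i +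
m)/(p_i m) then solves m (β - 1) p_i = (m_i - m)(p_i - 1), so the gradient term is the one in the
energy inequality. -/
theorem ofReal_gradTerm_rpow_le {m mi p q k y W Z D : ℝ} (hm : 0 < m) (hp : 1 < p) (hq : 0 < q)
    (hk : 0 < k) (hy0 : 0 ≤ y) (hZ : Z ∈ Icc (0 : ℝ) 1) :
    ENNReal.ofReal (gradTerm (k ^ m) ((mi * (p - 1) + m) / (p * m)) q
        (max (y ^ m - k ^ m) 0) W Z D) ^ p
      ≤ ENNReal.ofReal (2 ^ p) * (ENNReal.ofReal (y ^ ((mi - m) * (p - 1)) * |W| ^ p * Z ^ q)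
        + ENNReal.ofReal (if k < y then y ^ (mi * (p - 1) + m) * |D| ^ p else 0)) := by
  have hp0 : 0 < p := by linarith
  by_cases hy : k < y
  swap
  · rw [max_rpow_sub_eq_zero hm hy0 (not_lt.1 hy)]
    simp [gradTerm, hp0]
  have hypos : 0 < y := hk.trans hy
  obtain ⟨h1, h2⟩ := max_rpow_sub_add hm hk.le hy
  rw [gradTerm, if_pos h1, h2, if_pos hy, ENNReal.ofReal_add (by have := hZ.1; positivity)
    (by positivity)]
  refine (ENNReal.rpow_add_le_mul_rpow_add_rpow _ _ hp.le).trans ?_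
  have e0 : (2 : ENNReal) ^ (p - 1) ≤ ENNReal.ofReal (2 ^ p) := by
    rw [← ENNReal.ofReal_rpow_of_pos (by norm_num), ENNReal.ofReal_ofNat]
    exact ENNReal.rpow_le_rpow_of_exponent_le (by norm_num) (by linarith)
  gcongr
  · have hZ0 := hZ.1
    rw [ENNReal.ofReal_rpow_of_nonneg (by positivity) hp0.le]
    refine ENNReal.ofReal_le_ofReal ?_
    rw [Real.mul_rpow (by positivity) (by positivity), Real.mul_rpow (by positivity) (abs_nonneg _),
      ← Real.rpow_mul hy0, ← Real.rpow_mul (by positivity)]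
    have e1 : m * ((mi * (p - 1) + m) / (p * m) - 1) * p = (mi - m) * (p - 1) := by
      field_simp; ring
    rw [e1]
    have e2 : (Z ^ q) ^ p ≤ Z ^ q := by
      rw [← Real.rpow_mul hZ0]
      rcases hZ0.eq_or_lt with h | h
      · rw [← h, Real.zero_rpow (by positivity), Real.zero_rpow hq.ne']
      · exact Real.rpow_le_rpow_of_exponent_ge h hZ.2 (by nlinarith)
    gcongr
  · rw [ENNReal.ofReal_rpow_of_nonneg (by positivity) hp0.le]
    refine ENNReal.ofReal_le_ofReal ?_
    rw [Real.mul_rpow (by positivity) (abs_nonneg _), ← Real.rpow_mul hy0,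
      ← Real.rpow_mul (by positivity)]
    have e1 : m * ((mi * (p - 1) + m) / (p * m)) * p = mi * (p - 1) + m := by
      field_simp
    rw [e1]

/-- The relative height is 1 - (k/y)^m, hence bounded below on {y > k'}: this removes the degenerate
factors of the embedding. -/
theorem le_relHeight {m k k' y r : ℝ} (hm : 0 < m) (hk : 0 < k) (hkk' : k < k') (hy : k' < y)
    (hr : r ≤ 1 - (k / k') ^ m) : r ≤ relHeight (k ^ m) (max (y ^ m - k ^ m) 0) := by
  have hk' : 0 < k' := hk.trans hkk'
  have hy0 : 0 < y := hk'.trans hy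
  obtain ⟨-, h2⟩ := max_rpow_sub_add hm hk.le (hkk'.trans hy)
  rw [relHeight, h2]
  have h3 : max (y ^ m - k ^ m) 0 = y ^ m - k ^ m := by linarith
  have h4 : (k / y) ^ m ≤ (k / k') ^ m := by gcongr
  have hym : 0 < y ^ m := by positivity
  rw [h3, sub_div, div_self hym.ne', ← Real.div_rpow hk.le hy0.le]
  linarith

namespace Exponents

variable {N : ℕ} {D : Exponents N}

/-- This computation is the origin of 𝓜: the first summand is the power of u from the Sobolev
factor, the second the power from sup_t ∫ u^(m+1). -/
theorem Admissible.embedding_exponent (hD : D.Admissible) :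
    D.mMin * (D.pBar * ((∑ i, (D.lam i + D.mMin) / (D.p i * D.mMin)) / N))
      + (1 + D.mMin) * (D.pBar / N) = D.calM + D.mMin := by
  have hm := hD.mMin_pos
  have hp := hD.pBar_pos
  have hN := hD.cast_pos
  have h1 : ∑ i, (D.lam i + D.mMin) / (D.p i * D.mMin)
      = (∑ i, D.lam i / D.p i) / D.mMin + N / D.pBar := by
    rw [← hD.sum_inv_eq, Finset.sum_div, ← Finset.sum_add_distrib]
    refine Finset.sum_congr rfl fun i _ => ?_
    have := hD.p_pos i
    field_simp
  rw [h1, calM, lamOverP]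
  field_simp
  ring

end Exponents

/-- The embedding is applied to (v^m - k^m)_+ with K = k^m. Both the slice bound and the gradient
bound are multiples of the same X, and the powers p/N and 1 add up to 1 + p/N. The power of 1/r is p
from the Sobolev factor plus 2p/N from the squared relative height in the lower bound for g. -/
theorem exists_superlevel_step {N : ℕ} {D : Exponents N} (hD : D.Admissible) {C : ℝ}
    (hC : 0 < C) : ∃ A : ENNReal, A ≠ ⊤ ∧ ∀ (Ω : Set (Space N)) (T : ℝ) (u v : Space N × ℝ → ℝ),
      IsOpen Ω → PDGPlus D C Ω T u → Measurable v → (∀ z, 0 ≤ v z) →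
      (∀ᵐ z ∂(volume.restrict (spaceTime Ω T)), u z = v z) →
      ∀ (ρ : Fin N → ℝ) (θ : ℝ) (x₀ : Space N) (t₀ : ℝ), (∀ i, 0 < ρ i) → 0 < θ →
      cyl (fun i => 8 * ρ i) (8 * θ) x₀ t₀ ⊆ spaceTime Ω T →
      ∀ k₀ k k' σ ε r : ℝ, 0 < k₀ → D.calR θ ρ ≤ k₀ → k₀ / 2 ≤ k → k < k' → 0 < ε → ε ≤ 1 →
      σ ≤ 1 → 0 < r → r ≤ 1 - (k / k') ^ D.mMin →
      ∫⁻ z in superlevel v k ρ θ x₀ t₀ σ, ENNReal.ofReal (v z ^ (D.calL + D.mMin)) ≠ ⊤ →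
      ∫⁻ z in superlevel v k' ρ θ x₀ t₀ (σ - ε), ENNReal.ofReal (v z ^ (D.calM + D.mMin))
        ≤ A * ENNReal.ofReal ((1 / r) ^ (D.pBar + 2 * (D.pBar / N)))
          * (ENNReal.ofReal ((1 / ε) ^ D.qMax * D.calH θ ρ)
            * ∫⁻ z in superlevel v k ρ θ x₀ t₀ σ, ENNReal.ofReal (v z ^ (D.calL + D.mMin)))
              ^ (1 + D.pBar / N) := by
  have hm := hD.mMin_pos
  have hpb := hD.pBar_pos
  have hN := hD.cast_pos
  have hq1 := hD.one_lt_qMax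
  have hexp := hD.embedding_exponent
  obtain ⟨A₁, hA₁, hcut⟩ := exists_cutoff_energy_le hD hC
  have hβ : ∀ i, 0 < (D.lam i + D.mMin) / (D.p i * D.mMin) := fun i => by
    have := hD.lam_pos i; have := hD.p_pos i; positivity
  obtain ⟨A₂, hA₂, hemb⟩ := parabolic_embedding hD.two_le (q := D.qMax)
    (β := fun i => (D.lam i + D.mMin) / (D.p i * D.mMin)) hD.one_lt_p hpb hD.pBar_lt hD.sum_inv_eq
    hβ hq1.le
  obtain ⟨c, hc, hg⟩ := exists_le_gFun hm
  set m := D.mMin with hmdef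
  set pb := D.pBar with hpbdef
  set a := pb / N with ha
  have ha0 : 0 < a := by positivity
  -- C A₁ comes from the weighted gradient, A₁ from the derivative of the cut-off, and the power of
  -- 2 from splitting the p_i-th power of their sum.
  set E₀ : ℝ := 2 ^ D.qMax * (C * A₁ + A₁) with hE₀
  refine ⟨ENNReal.ofReal ((1 / c) ^ a) * (A₂ * (ENNReal.ofReal A₁ ^ a * ENNReal.ofReal E₀)), ?_, ?_⟩
  · refine ENNReal.mul_ne_top ENNReal.ofReal_ne_top (ENNReal.mul_ne_top hA₂ (ENNReal.mul_ne_top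
      (ENNReal.rpow_ne_top_of_nonneg ha0.le ENNReal.ofReal_ne_top) ENNReal.ofReal_ne_top))
  intro Ω T u v hΩ hu hvm hv0 huv ρ θ x₀ t₀ hρ hθ hsub k₀ k k' σ ε r hk₀ hR hk hkk' hε hε1 hσ hr
    hrle hY
  have hk0 : 0 < k := by linarith
  have hk'0 : 0 < k' := hk0.trans hkk'
  set ζ := cutoff ρ θ x₀ t₀ σ ε with hζdef
  set Y := ∫⁻ z in superlevel v k ρ θ x₀ t₀ σ, ENNReal.ofReal (v z ^ (D.calL + m)) with hYdef
  set X := ENNReal.ofReal ((1 / ε) ^ D.qMax * D.calH θ ρ) * Y with hX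
  have hH0 := Exponents.calH_nonneg (D := D) hθ hρ
  have hXtop : X ≠ ⊤ := ENNReal.mul_ne_top ENNReal.ofReal_ne_top hY
  have hA₁X : ENNReal.ofReal (A₁ * (1 / ε) ^ D.qMax * D.calH θ ρ) * Y = ENNReal.ofReal A₁ * X := by
    rw [hX, mul_assoc A₁, ENNReal.ofReal_mul hA₁.le, mul_assoc]
  obtain ⟨hRHS, hcutD⟩ := hcut v hv0 ρ θ x₀ t₀ hρ hθ k₀ k σ ε hk₀ hR hk hε hε1
  rw [hA₁X] at hRHS hcutD
  obtain ⟨hκ, hta, htT⟩ := cyl_subset_facts hρ hθ hsub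
  have hdpos : ∀ i, 0 < ε * ρ i := fun i => by have := hρ i; positivity
  have hζC : ContDiff ℝ ∞ ζ := contDiff_cylBump
  have hζ01 : ∀ z, ζ z ∈ Icc (0 : ℝ) 1 := cylBump_mem
  have hζx : ∀ x t, x ∉ box ρ x₀ → ζ (x, t) = 0 := by
    intro x t hx
    simp only [box, mem_ofPred_eq, not_forall, not_lt] at hx
    obtain ⟨i, hi⟩ := hx
    exact cylBump_eq_zero_of_space hdpos
      ((mul_le_of_le_one_left (hρ i).le hσ).trans hi) t
  have hζt : ∀ x t, t ≤ t₀ - θ → ζ (x, t) = 0 := by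
    intro x t ht
    exact cylBump_eq_zero_of_time (by positivity) x (by nlinarith)
  have hcutoff : IsCutoff ρ θ x₀ t₀ ζ := isCutoff_cylBump hdpos
    fun i => mul_le_of_le_one_left (hρ i).le hσ
  obtain ⟨w, hwm, hww, hwe⟩ := hu.exists_energy hD hC hΩ huv hk0
  obtain ⟨hS, hE⟩ := hwe ρ θ x₀ t₀ hρ hθ hsub ζ hcutoff fun x => hζt x _ le_rfl
  set h : Space N × ℝ → ℝ := fun z => max (v z ^ m - k ^ m) 0 with hh
  have hhm : Measurable h := ((hvm.pow_const m).sub_const _).max measurable_const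
  have hh0 : ∀ z, 0 ≤ h z := fun z => le_max_right _ _
  have hK : 0 < k ^ m := by positivity
  -- An explicit minorant of g(v^m, k^m) ζ^q: where v > k it is c times the squared relative height
  -- times v^(m+1) ζ^q.
  set G : Space N × ℝ → ENNReal := fun z => ENNReal.ofReal
    (c * (relHeight (k ^ m) (h z) ^ 2 * (h z + k ^ m) ^ (1 / m + 1)) * ζ z ^ D.qMax) with hG
  have hrelm : Measurable fun z => relHeight (k ^ m) (h z) := hhm.div (hhm.add_const _)
  have hGm : Measurable G := by
    refine Measurable.ennreal_ofReal ?_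
    exact (((hrelm.pow_const 2).mul ((hhm.add_const _).pow_const _)).const_mul c).mul
      (hζC.continuous.measurable.pow_const _)
  have hGle : ∀ x t, G (x, t) ≤ (box ρ x₀).indicator (fun x => ENNReal.ofReal
      (gFun m (v (x, t) ^ m) (k ^ m) * ζ (x, t) ^ D.qMax)) x := by
    intro x t
    by_cases hx : x ∈ box ρ x₀
    · rw [indicator_of_mem hx]
      refine ENNReal.ofReal_le_ofReal ?_
      have hz0 := (hζ01 (x, t)).1
      refine mul_le_mul_of_nonneg_right ?_ (by positivity)
      by_cases hvk : k < v (x, t)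
      · obtain ⟨h1, h2⟩ := max_rpow_sub_add hm hk0.le hvk
        have h3 := hg (v (x, t) ^ m) (k ^ m) hK (Real.rpow_le_rpow hk0.le hvk.le hm.le)
        have h4 : h (x, t) = v (x, t) ^ m - k ^ m := by simp only [hh]; linarith
        rw [relHeight, h4, sub_add_cancel]
        exact h3
      · have h1 : h (x, t) = 0 := max_rpow_sub_eq_zero hm (hv0 _) (not_lt.1 hvk)
        rw [relHeight, h1]
        simpa using gFun_nonneg hm hK
    · rw [indicator_of_notMem hx]
      simp [hG, hζx x t hx, Real.zero_rpow (by linarith : D.qMax ≠ 0)]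
  have hGS : ∀ᵐ t ∂(volume.restrict (Ioo (t₀ - θ) t₀)), ∫⁻ x : Space N, G (x, t)
      ≤ ENNReal.ofReal A₁ * X := by
    filter_upwards [hS] with t ht
    exact (lintegral_mono fun x => hGle x t).trans ((lintegral_indicator_le _ _).trans
      (ht.trans hRHS))
  have hgrad : ∀ i, ∫⁻ z in univ ×ˢ Ioo (t₀ - θ) t₀, ENNReal.ofReal (gradTerm (k ^ m)
      ((D.lam i + m) / (D.p i * m)) D.qMax (h z) (w i z) (ζ z) (spaceDeriv i ζ z)) ^ D.p i
      ≤ ENNReal.ofReal E₀ * X := by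
    intro i
    have hp0 := hD.p_pos i
    have hmono : ∀ z ∈ (univ : Set (Space N)) ×ˢ Ioo (t₀ - θ) t₀, ENNReal.ofReal (gradTerm (k ^ m)
        ((D.lam i + m) / (D.p i * m)) D.qMax (h z) (w i z) (ζ z) (spaceDeriv i ζ z)) ^ D.p i
        ≤ (cyl ρ θ x₀ t₀).indicator (fun z => ENNReal.ofReal (2 ^ D.p i) * (ENNReal.ofReal
          (v z ^ ((D.m i - m) * (D.p i - 1)) * |w i z| ^ D.p i * ζ z ^ D.qMax)
          + ENNReal.ofReal (if k < v z then v z ^ (D.lam i + m)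
            * |spaceDeriv i ζ z| ^ D.p i else 0))) z := by
      rintro ⟨x, t⟩ ⟨-, ht⟩
      by_cases hx : x ∈ box ρ x₀
      · rw [indicator_of_mem (show (x, t) ∈ cyl ρ θ x₀ t₀ from ⟨hx, ht⟩)]
        exact ofReal_gradTerm_rpow_le hm (hD.one_lt_p i) (by linarith) hk0 (hv0 _) (hζ01 _)
      · have h1 : fderiv ℝ ζ (x, t) = 0 := fderiv_cylBump_eq_zero (hζx x t hx)
        have h2 : spaceDeriv i ζ (x, t) = 0 := by simp [spaceDeriv, h1]
        simp [gradTerm, h2, hζx x t hx, Real.zero_rpow (by linarith : D.qMax ≠ 0), hp0]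
    have hm2 : Measurable fun z => ENNReal.ofReal (if k < v z then v z ^ (D.lam i + m)
        * |spaceDeriv i ζ z| ^ D.p i else 0) := by
      refine (Measurable.ite (measurableSet_lt measurable_const hvm) ?_
        measurable_const).ennreal_ofReal
      exact (hvm.pow_const _).mul
        ((measurable_spaceDeriv (hζC.of_le (by simp))).abs.pow_const _)
    calc _ ≤ ∫⁻ z in univ ×ˢ Ioo (t₀ - θ) t₀, (cyl ρ θ x₀ t₀).indicator (fun z =>
          ENNReal.ofReal (2 ^ D.p i) * (ENNReal.ofReal
          (v z ^ ((D.m i - m) * (D.p i - 1)) * |w i z| ^ D.p i * ζ z ^ D.qMax)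
          + ENNReal.ofReal (if k < v z then v z ^ (D.lam i + m)
            * |spaceDeriv i ζ z| ^ D.p i else 0))) z :=
          setLIntegral_mono' (MeasurableSet.univ.prod measurableSet_Ioo) hmono
      _ ≤ ∫⁻ z in cyl ρ θ x₀ t₀, ENNReal.ofReal (2 ^ D.p i) * (ENNReal.ofReal
          (v z ^ ((D.m i - m) * (D.p i - 1)) * |w i z| ^ D.p i * ζ z ^ D.qMax)
          + ENNReal.ofReal (if k < v z then v z ^ (D.lam i + m)
            * |spaceDeriv i ζ z| ^ D.p i else 0)) :=
          (setLIntegral_le_lintegral _ _).trans (lintegral_indicator_le _ _)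
      _ = ENNReal.ofReal (2 ^ D.p i) * ((∫⁻ z in cyl ρ θ x₀ t₀, ENNReal.ofReal
          (v z ^ ((D.m i - m) * (D.p i - 1)) * |w i z| ^ D.p i * ζ z ^ D.qMax))
          + ∫⁻ z in cyl ρ θ x₀ t₀, ENNReal.ofReal (if k < v z then v z ^ (D.lam i + m)
            * |spaceDeriv i ζ z| ^ D.p i else 0)) := by
          rw [lintegral_const_mul' _ _ ENNReal.ofReal_ne_top, lintegral_add_right _ hm2]
      _ ≤ ENNReal.ofReal (2 ^ D.qMax) * (ENNReal.ofReal C * (ENNReal.ofReal A₁ * X)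
          + ENNReal.ofReal A₁ * X) := by
          gcongr ENNReal.ofReal ?_ * (?_ + ?_)
          · exact Real.rpow_le_rpow_of_exponent_le (by norm_num)
              ((hD.p_le_q i).trans (D.q_le_qMax i))
          · exact (hE i).trans (by gcongr)
          · exact hcutD i
      _ = ENNReal.ofReal E₀ * X := by
          rw [hE₀, ENNReal.ofReal_mul (by positivity), ENNReal.ofReal_add (by positivity)
            (by positivity), ENNReal.ofReal_mul hC.le]
          ring
  have hmain := hemb hK hΩ hta htT hhm hh0 hwm hww (hζC.of_le (by simp)) hζ01
    (isCompact_closedBox ρ x₀) hκ (fun x t hx => hζx x t fun hx' => hx fun i => (hx' i).le) hζt hGm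
    (ENNReal.mul_ne_top ENNReal.ofReal_ne_top hXtop)
    (ENNReal.mul_ne_top ENNReal.ofReal_ne_top hXtop) hGS hgrad
  have hsubset : superlevel v k' ρ θ x₀ t₀ (σ - ε) ⊆ univ ×ˢ Ioo (t₀ - θ) t₀ := by
    rintro ⟨x, t⟩ ⟨⟨-, ht1, ht2⟩, -⟩
    exact ⟨mem_univ _, by simp only at ht1; nlinarith, ht2⟩
  have hlow : ∀ z ∈ superlevel v k' ρ θ x₀ t₀ (σ - ε), ENNReal.ofReal (v z ^ (D.calM + m))
      ≤ ENNReal.ofReal ((1 / c) ^ a * (1 / r) ^ (pb + 2 * a)) * (ENNReal.ofReal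
        ((relHeight (k ^ m) (h z) * ζ z ^ D.qMax) ^ pb * (h z + k ^ m)
          ^ (pb * ((∑ j, (D.lam j + m) / (D.p j * m)) / N))) * G z ^ a) := by
    rintro ⟨x, t⟩ ⟨⟨hx, ht1, ht2⟩, hvz⟩
    simp only [mem_ofPred_eq] at hvz
    simp only at ht1
    have hζ1 : ζ (x, t) = 1 := cylBump_eq_one hdpos (by positivity)
      (fun i => by have := hx i; simp only at this; linarith) (by linarith)
    have hrel : r ≤ relHeight (k ^ m) (h (x, t)) := le_relHeight hm hk0 hkk' hvz hrle
    have hvk : k < v (x, t) := hkk'.trans hvz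
    have hvpos : 0 < v (x, t) := hk0.trans hvk
    obtain ⟨-, h2⟩ := max_rpow_sub_add hm hk0.le hvk
    change h (x, t) + k ^ m = v (x, t) ^ m at h2
    have hR0 : 0 < relHeight (k ^ m) (h (x, t)) := hr.trans_le hrel
    simp only [hG]
    rw [hζ1, h2, Real.one_rpow, mul_one, mul_one,
      ENNReal.ofReal_rpow_of_nonneg (by positivity) ha0.le, ← ENNReal.ofReal_mul (by positivity),
      ← ENNReal.ofReal_mul (by positivity)]
    refine ENNReal.ofReal_le_ofReal ?_
    set y := v (x, t) with hy
    set R := relHeight (k ^ m) (h (x, t)) with hRdef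
    set B := (∑ j, (D.lam j + m) / (D.p j * m)) / (N : ℝ) with hB
    have e1 : y ^ (D.calM + m) = (y ^ m) ^ (pb * B) * ((y ^ m) ^ (1 / m + 1)) ^ a := by
      rw [← Real.rpow_mul hvpos.le, ← Real.rpow_mul hvpos.le, ← Real.rpow_mul hvpos.le,
        ← Real.rpow_add hvpos, ← hexp]
      congr 1
      field_simp
    have e2 : (1 / c) ^ a * (1 / r) ^ (pb + 2 * a) * (c ^ a * r ^ (pb + 2 * a)) = 1 := by
      rw [mul_mul_mul_comm, ← Real.mul_rpow (by positivity) hc.le,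
        ← Real.mul_rpow (by positivity) hr.le, one_div_mul_cancel hc.ne', one_div_mul_cancel hr.ne',
        Real.one_rpow, Real.one_rpow, mul_one]
    have e3 : c ^ a * r ^ (pb + 2 * a) ≤ R ^ pb * (c * R ^ 2) ^ a := by
      rw [Real.mul_rpow hc.le (by positivity), ← Real.rpow_natCast R 2, ← Real.rpow_mul hR0.le,
        mul_left_comm, ← Real.rpow_add hR0]
      push_cast
      gcongr
    calc y ^ (D.calM + m)
        = (1 / c) ^ a * (1 / r) ^ (pb + 2 * a) * (c ^ a * r ^ (pb + 2 * a)) * y ^ (D.calM + m) := by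
          rw [e2, one_mul]
      _ ≤ (1 / c) ^ a * (1 / r) ^ (pb + 2 * a) * (R ^ pb * (c * R ^ 2) ^ a) * y ^ (D.calM + m) := by
          gcongr
      _ = _ := by
          rw [e1, ← mul_assoc c, Real.mul_rpow (by positivity : 0 ≤ c * R ^ 2) (by positivity)]
          ring
  calc ∫⁻ z in superlevel v k' ρ θ x₀ t₀ (σ - ε), ENNReal.ofReal (v z ^ (D.calM + m))
      ≤ ∫⁻ z in superlevel v k' ρ θ x₀ t₀ (σ - ε),
        ENNReal.ofReal ((1 / c) ^ a * (1 / r) ^ (pb + 2 * a)) * (ENNReal.ofReal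
        ((relHeight (k ^ m) (h z) * ζ z ^ D.qMax) ^ pb * (h z + k ^ m)
          ^ (pb * ((∑ j, (D.lam j + m) / (D.p j * m)) / N))) * G z ^ a) := by
        refine setLIntegral_mono' ?_ hlow
        exact (measurableSet_cyl _ _ _ _).inter (measurableSet_lt measurable_const hvm)
    _ ≤ ∫⁻ z in univ ×ˢ Ioo (t₀ - θ) t₀,
        ENNReal.ofReal ((1 / c) ^ a * (1 / r) ^ (pb + 2 * a)) * (ENNReal.ofReal
        ((relHeight (k ^ m) (h z) * ζ z ^ D.qMax) ^ pb * (h z + k ^ m)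
          ^ (pb * ((∑ j, (D.lam j + m) / (D.p j * m)) / N))) * G z ^ a) :=
        lintegral_mono_set hsubset
    _ = ENNReal.ofReal ((1 / c) ^ a * (1 / r) ^ (pb + 2 * a)) * ∫⁻ z in univ ×ˢ Ioo (t₀ - θ) t₀,
        (ENNReal.ofReal ((relHeight (k ^ m) (h z) * ζ z ^ D.qMax) ^ pb * (h z + k ^ m)
          ^ (pb * ((∑ j, (D.lam j + m) / (D.p j * m)) / N))) * G z ^ a) :=
        lintegral_const_mul' _ _ ENNReal.ofReal_ne_top
    _ ≤ ENNReal.ofReal ((1 / c) ^ a * (1 / r) ^ (pb + 2 * a))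
        * (A₂ * (ENNReal.ofReal A₁ * X) ^ a * (ENNReal.ofReal E₀ * X)) := by
        gcongr
    _ = _ := by
        rw [ENNReal.mul_rpow_of_nonneg _ _ ha0.le, ENNReal.ofReal_mul (by positivity),
          ENNReal.rpow_add_of_nonneg _ _ zero_le_one ha0.le, ENNReal.rpow_one]
        ring

/-! ### De Giorgi iteration. -/

/-- Fast geometric convergence: with ratio b^(-1/δ) the gain from the power δ is b^(-j), which
cancels the growth b^j, so smallness of the initial term propagates. -/
theorem le_geometric_of_superlinear {y : ℕ → ℝ} {B b δ : ℝ} (hy : ∀ j, 0 ≤ y j) (hb : 1 ≤ b)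
    (hδ : 0 < δ) (hB : 0 ≤ B) (hstep : ∀ j, y (j + 1) ≤ B * b ^ j * y j ^ (1 + δ))
    (h0 : B * b ^ (1 / δ) * y 0 ^ δ ≤ 1) (j : ℕ) : y j ≤ ((b ^ (1 / δ))⁻¹) ^ j * y 0 := by
  have hb0 : 0 < b := by linarith
  set c := (b ^ (1 / δ))⁻¹ with hc
  have hc0 : 0 < c := by positivity
  have hcδ : c ^ δ = b⁻¹ := by
    rw [hc, Real.inv_rpow (by positivity), ← Real.rpow_mul hb0.le, one_div_mul_cancel hδ.ne',
      Real.rpow_one]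
  have hcb : b ^ (1 / δ) = c⁻¹ := by rw [hc, inv_inv]
  induction j with
  | zero => simp
  | succ j ih =>
    have h1 : y j ^ (1 + δ) ≤ (c ^ j * y 0) ^ (1 + δ) := Real.rpow_le_rpow (hy j) ih (by linarith)
    have hcj : (c ^ j) ^ δ = (b ^ j)⁻¹ := by
      rw [← Real.rpow_natCast, ← Real.rpow_mul hc0.le, mul_comm, Real.rpow_mul hc0.le, hcδ,
        Real.rpow_natCast, inv_pow]
    have h2 : (c ^ j * y 0) ^ (1 + δ) = c ^ j * y 0 * ((b ^ j)⁻¹ * y 0 ^ δ) := by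
      rw [Real.rpow_add_of_nonneg (by have := hy 0; positivity) zero_le_one hδ.le, Real.rpow_one,
        Real.mul_rpow (by positivity) (hy 0), hcj]
    rw [hcb] at h0
    have h3 : B * y 0 ^ δ ≤ c := by
      have := mul_le_mul_of_nonneg_left h0 hc0.le
      field_simp at this
      linarith
    calc y (j + 1) ≤ B * b ^ j * (c ^ j * y 0 * ((b ^ j)⁻¹ * y 0 ^ δ)) :=
          (hstep j).trans (by rw [← h2]; gcongr)
      _ = c ^ j * y 0 * (B * y 0 ^ δ) := by
          field_simp
      _ ≤ c ^ j * y 0 * c := by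
          have := hy 0
          gcongr
      _ = c ^ (j + 1) * y 0 := by ring

/-- Bernoulli's inequality for m ≤ 1 and monotonicity in the exponent for m ≥ 1; it makes the gap
between consecutive levels linear in 2^(-j). -/
theorem one_sub_rpow_le {m x : ℝ} (hm : 0 < m) (hx0 : 0 ≤ x) (hx1 : x ≤ 1) :
    (1 - x) ^ m ≤ 1 - min 1 m * x := by
  rcases le_total 1 m with h | h
  · rw [min_eq_left h, one_mul]
    calc (1 - x) ^ m ≤ (1 - x) ^ (1 : ℝ) := by
          rcases (sub_nonneg.2 hx1).eq_or_lt with h' | h'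
          · rw [← h', Real.zero_rpow hm.ne', Real.zero_rpow one_ne_zero]
          · exact Real.rpow_le_rpow_of_exponent_ge h' (by linarith) h
      _ = 1 - x := Real.rpow_one _
  · rw [min_eq_right h]
    have := rpow_one_add_le_one_add_mul_self (s := -x) (p := m) (by linarith) hm.le h
    linarith [show (1 - x) ^ m = (1 + -x) ^ m by ring_nf]

namespace Exponents

variable {N : ℕ} {D : Exponents N} {s : ℝ}

theorem Admissible.kappa_eq (hD : D.Admissible) : D.kappa s
    = D.pBar * (s - (D.calL + D.mMin)) - N * (D.calL - D.calM) := by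
  have := hD.cast_pos
  unfold kappa calM
  field_simp
  ring

/-- In κ_s = p (s - 𝓛 - m) - N (𝓛 - 𝓜) the subtracted term is non-negative. -/
theorem Admissible.calL_add_lt (hD : D.Admissible) (hLM : D.calM ≤ D.calL)
    (hκ : 0 < D.kappa s) : D.calL + D.mMin < s := by
  rw [hD.kappa_eq] at hκ
  have h1 := mul_nonneg hD.cast_pos.le (sub_nonneg.2 hLM)
  have h2 : 0 < D.pBar * (s - (D.calL + D.mMin)) := by linarith
  have := pos_of_mul_pos_right h2 hD.pBar_pos.le
  linarith

/-- The Hölder exponent `t` with `L + m = t (M + m) + (1 - t) s`. -/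
noncomputable def interp (D : Exponents N) (s : ℝ) : ℝ :=
  (s - (D.calL + D.mMin)) / (s - (D.calM + D.mMin))

theorem Admissible.interp_pos (hD : D.Admissible) (hLM : D.calM ≤ D.calL) (hκ : 0 < D.kappa s) :
    0 < D.interp s := by
  have := hD.calL_add_lt hLM hκ
  exact div_pos (by linarith) (by linarith)

theorem Admissible.interp_le_one (hD : D.Admissible) (hLM : D.calM ≤ D.calL)
    (hκ : 0 < D.kappa s) : D.interp s ≤ 1 := by
  have := hD.calL_add_lt hLM hκ
  exact (div_le_one (by linarith)).2 (by linarith)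

theorem Admissible.interp_spec (hD : D.Admissible) (hLM : D.calM ≤ D.calL) (hκ : 0 < D.kappa s) :
    (D.calM + D.mMin) * D.interp s + s * (1 - D.interp s) = D.calL + D.mMin := by
  have := hD.calL_add_lt hLM hκ
  have : s - (D.calM + D.mMin) ≠ 0 := by linarith
  unfold interp
  field_simp
  ring

/-- This is the excess δ in the recursion; the sign of κ_s decides whether the recursion is
superlinear. -/
theorem Admissible.superlinear_exponent (hD : D.Admissible) (hLM : D.calM ≤ D.calL)
    (hκ : 0 < D.kappa s) : (1 + D.pBar / N) * D.interp s - 1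
      = D.kappa s / (N * (s - (D.calM + D.mMin))) := by
  have := hD.calL_add_lt hLM hκ
  have : s - (D.calM + D.mMin) ≠ 0 := by linarith
  have := hD.cast_pos
  rw [hD.kappa_eq]
  unfold interp
  field_simp
  ring

end Exponents

theorem setLIntegral_rpow_interp {X : Type*} [MeasurableSpace X] {μ : Measure X} {E F : Set X}
    (hE : MeasurableSet E) (hEF : E ⊆ F) {v : X → ℝ} (hv : Measurable v) (hpos : ∀ z ∈ E, 0 < v z)
    {a b t : ℝ} (ht0 : 0 ≤ t) (ht1 : t ≤ 1) :
    ∫⁻ z in E, ENNReal.ofReal (v z ^ (a * t + b * (1 - t))) ∂μ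
      ≤ (∫⁻ z in E, ENNReal.ofReal (v z ^ a) ∂μ) ^ t
        * (∫⁻ z in F, ENNReal.ofReal (v z ^ b) ∂μ) ^ (1 - t) := by
  calc ∫⁻ z in E, ENNReal.ofReal (v z ^ (a * t + b * (1 - t))) ∂μ
      = ∫⁻ z in E, ENNReal.ofReal (v z ^ a) ^ t * ENNReal.ofReal (v z ^ b) ^ (1 - t) ∂μ := by
        refine setLIntegral_congr_fun hE fun z hz => ?_
        have h0 := hpos z hz
        rw [ENNReal.ofReal_rpow_of_nonneg (by positivity) ht0,
          ENNReal.ofReal_rpow_of_nonneg (by positivity) (by linarith),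
          ← ENNReal.ofReal_mul (by positivity), ← Real.rpow_mul h0.le, ← Real.rpow_mul h0.le,
          ← Real.rpow_add h0]
    _ ≤ (∫⁻ z in E, ENNReal.ofReal (v z ^ a) ∂μ) ^ t
        * (∫⁻ z in E, ENNReal.ofReal (v z ^ b) ∂μ) ^ (1 - t) :=
        ENNReal.lintegral_mul_norm_pow_le (hv.pow_const a).ennreal_ofReal.aemeasurable
          (hv.pow_const b).ennreal_ofReal.aemeasurable ht0 (by linarith) (by ring)
    _ ≤ _ := by
        gcongr

theorem measurableSet_superlevel {N : ℕ} {v : Space N × ℝ → ℝ} (hv : Measurable v) (k : ℝ)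
    (ρ : Fin N → ℝ) (θ : ℝ) (x₀ : Space N) (t₀ σ : ℝ) :
    MeasurableSet (superlevel v k ρ θ x₀ t₀ σ) :=
  (measurableSet_cyl _ _ _ _).inter (measurableSet_lt measurable_const hv)

theorem superlevel_subset_cyl {N : ℕ} (v : Space N × ℝ → ℝ) (k : ℝ) {ρ : Fin N → ℝ} {θ : ℝ}
    (hρ : ∀ i, 0 < ρ i) (hθ : 0 < θ) (x₀ : Space N) (t₀ : ℝ) {σ : ℝ} (hσ : σ ≤ 1) :
    superlevel v k ρ θ x₀ t₀ σ ⊆ cyl ρ θ x₀ t₀ :=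
  inter_subset_left.trans (cyl_mono (fun i => mul_le_of_le_one_left (hρ i).le hσ)
    (mul_le_of_le_one_left hθ.le hσ) _ _)

theorem setLIntegral_superlevel_le {N : ℕ} {v : Space N × ℝ → ℝ} (hv : Measurable v) {k : ℝ}
    (hk : 0 < k) {ρ : Fin N → ℝ} {θ : ℝ} (hρ : ∀ i, 0 < ρ i) (hθ : 0 < θ) (x₀ : Space N) (t₀ : ℝ)
    {σ : ℝ} (hσ : σ ≤ 1) {l s : ℝ} (hls : l ≤ s) :
    ∫⁻ z in superlevel v k ρ θ x₀ t₀ σ, ENNReal.ofReal (v z ^ l)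
      ≤ ENNReal.ofReal (k ^ (l - s)) * ∫⁻ z in cyl ρ θ x₀ t₀, ENNReal.ofReal (v z ^ s) := by
  calc _ ≤ ∫⁻ z in superlevel v k ρ θ x₀ t₀ σ,
        ENNReal.ofReal (k ^ (l - s)) * ENNReal.ofReal (v z ^ s) := by
        refine setLIntegral_mono' (measurableSet_superlevel hv _ _ _ _ _ _) fun z hz => ?_
        have hz' : k < v z := hz.2
        have hz0 : 0 < v z := hk.trans hz'
        rw [← ENNReal.ofReal_mul (by positivity)]
        refine ENNReal.ofReal_le_ofReal ?_
        calc v z ^ l = v z ^ (l - s) * v z ^ s := by rw [← Real.rpow_add hz0]; ring_nf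
          _ ≤ _ := by
            gcongr ?_ * _
            exact Real.rpow_le_rpow_of_nonpos hk hz'.le (by linarith)
    _ = ENNReal.ofReal (k ^ (l - s)) * ∫⁻ z in superlevel v k ρ θ x₀ t₀ σ,
        ENNReal.ofReal (v z ^ s) := lintegral_const_mul' _ _ ENNReal.ofReal_ne_top
    _ ≤ _ := by
        gcongr
        exact superlevel_subset_cyl v k hρ hθ x₀ t₀ hσ

theorem iteration_factor_eq {A c H Y e q a t : ℝ} (hA : 0 ≤ A) (hc : 0 < c) (hH : 0 ≤ H)
    (hY : 0 ≤ Y) (j : ℕ) :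
    (A * (1 / (c * ((1 / 2) ^ j / 4))) ^ e * ((1 / ((1 / 2) ^ j / 4)) ^ q * H * Y) ^ (1 + a)) ^ t
      = (A * (4 / c) ^ e * (4 ^ q) ^ (1 + a)) ^ t * ((2 ^ e * (2 ^ q) ^ (1 + a)) ^ t) ^ j
        * (H ^ ((1 + a) * t) * Y ^ ((1 + a) * t)) := by
  have h2 : ((1 / 2 : ℝ) ^ j) = (2 ^ j)⁻¹ := by rw [one_div, inv_pow]
  have e1 : (1 / (c * ((1 / 2) ^ j / 4))) ^ e = (4 / c) ^ e * (2 ^ e) ^ j := by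
    rw [Real.rpow_pow_comm (by norm_num), ← Real.mul_rpow (by positivity) (by positivity), h2]
    congr 1
    field_simp
  have e2 : (1 / ((1 / 2 : ℝ) ^ j / 4)) ^ q = 4 ^ q * (2 ^ q) ^ j := by
    rw [Real.rpow_pow_comm (by norm_num), ← Real.mul_rpow (by positivity) (by positivity), h2]
    congr 1
    field_simp
  have e3 : A * ((4 / c) ^ e * (2 ^ e) ^ j) * (4 ^ q * (2 ^ q) ^ j * H * Y) ^ (1 + a)
      = A * (4 / c) ^ e * (4 ^ q) ^ (1 + a) * (2 ^ e * (2 ^ q) ^ (1 + a)) ^ j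
        * (H ^ (1 + a) * Y ^ (1 + a)) := by
    rw [Real.mul_rpow (by positivity) hY, Real.mul_rpow (by positivity) hH,
      Real.mul_rpow (by positivity) (by positivity), ← Real.rpow_pow_comm (by positivity), mul_pow]
    ring
  rw [e1, e2, e3, Real.mul_rpow (by positivity) (by positivity),
    Real.mul_rpow (x := H ^ (1 + a)) (by positivity) (by positivity),
    Real.mul_rpow (y := (2 ^ e * (2 ^ q) ^ (1 + a)) ^ j) (by positivity) (by positivity),
    ← Real.rpow_pow_comm (by positivity), ← Real.rpow_mul hH, ← Real.rpow_mul hY]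

set_option maxHeartbeats 400000 in
/-- One step of the iteration, in real form, with all the geometric factors made explicit. -/
theorem exists_iteration_step {N : ℕ} {D : Exponents N} (hD : D.Admissible) {C s : ℝ}
    (hC : 0 < C) (hLM : D.calM ≤ D.calL) (hκ : 0 < D.kappa s) :
    ∃ A b : ℝ, 0 < A ∧ 1 < b ∧ ∀ (Ω : Set (Space N)) (T : ℝ) (u v : Space N × ℝ → ℝ),
      IsOpen Ω → PDGPlus D C Ω T u → Measurable v → (∀ z, 0 ≤ v z) →
      (∀ᵐ z ∂(volume.restrict (spaceTime Ω T)), u z = v z) →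
      ∀ (ρ : Fin N → ℝ) (θ : ℝ) (x₀ : Space N) (t₀ : ℝ), (∀ i, 0 < ρ i) → 0 < θ →
      cyl (fun i => 8 * ρ i) (8 * θ) x₀ t₀ ⊆ spaceTime Ω T →
      ∫⁻ z in cyl ρ θ x₀ t₀, ENNReal.ofReal (v z ^ s) ≠ ⊤ →
      ∀ k : ℝ, 0 < k → D.calR θ ρ ≤ k → ∀ Y : ℕ → ℝ,
      (∀ j, Y j = (∫⁻ z in superlevel v (k * (1 - (1 / 2) ^ (j + 1))) ρ θ x₀ t₀
        (1 / 2 + (1 / 2) ^ (j + 1)), ENNReal.ofReal (v z ^ (D.calL + D.mMin))).toReal) →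
      ∀ j, Y (j + 1) ≤ A * b ^ j * (D.calH θ ρ ^ ((1 + D.pBar / N) * D.interp s)
        * (∫⁻ z in cyl ρ θ x₀ t₀, ENNReal.ofReal (v z ^ s)).toReal ^ (1 - D.interp s))
        * Y j ^ ((1 + D.pBar / N) * D.interp s) := by
  obtain ⟨A₀, hA₀, hstep⟩ := exists_superlevel_step hD hC
  have hm := hD.mMin_pos
  have hpb := hD.pBar_pos
  have hN := hD.cast_pos
  have hq := hD.one_lt_qMax
  have ht0 := hD.interp_pos hLM hκ
  have ht1 := hD.interp_le_one hLM hκ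
  have hspec := hD.interp_spec hLM hκ
  have hLs := hD.calL_add_lt hLM hκ
  set t := D.interp s with ht
  set a := D.pBar / N with ha
  have ha0 : 0 < a := by positivity
  set e := D.pBar + 2 * a with he
  have he0 : 0 < e := by positivity
  set c := min 1 D.mMin with hc
  have hc0 : 0 < c := lt_min one_pos hm
  have hc1 : c ≤ 1 := min_le_left _ _
  set B₀ : ℝ := (A₀.toReal + 1) * (4 / c) ^ e * (4 ^ D.qMax) ^ (1 + a) with hB₀
  set b₀ : ℝ := 2 ^ e * (2 ^ D.qMax) ^ (1 + a) with hb₀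
  have hA₀0 : 0 ≤ A₀.toReal := ENNReal.toReal_nonneg
  have hB₀0 : 0 < B₀ := by positivity
  have hb₀1 : 1 < b₀ := by
    have h1 : (1 : ℝ) < 2 ^ e := Real.one_lt_rpow (by norm_num) he0
    have h2 : (1 : ℝ) ≤ (2 ^ D.qMax) ^ (1 + a) :=
      Real.one_le_rpow (Real.one_le_rpow (by norm_num) (by linarith)) (by linarith)
    nlinarith
  refine ⟨B₀ ^ t, b₀ ^ t, by positivity, Real.one_lt_rpow hb₀1 ht0, ?_⟩
  intro Ω T u v hΩ hu hvm hv0 huv ρ θ x₀ t₀ hρ hθ hsub hS k hk hR Y hY j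
  set S := ∫⁻ z in cyl ρ θ x₀ t₀, ENNReal.ofReal (v z ^ s) with hSdef
  have hH0 := Exponents.calH_nonneg (D := D) hθ hρ
  set x : ℝ := (1 / 2) ^ j with hx
  have hx0 : 0 < x := by positivity
  have hx1 : x ≤ 1 := pow_le_one₀ (by norm_num) (by norm_num)
  have hxj : (1 / 2 : ℝ) ^ (j + 1) = x / 2 := by rw [pow_succ]; ring
  have hxj' : (1 / 2 : ℝ) ^ (j + 1 + 1) = x / 4 := by rw [pow_succ, pow_succ]; ring
  have hYj := hY j
  have hYj' := hY (j + 1)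
  rw [hxj] at hYj
  rw [hxj'] at hYj'
  have hkj : 0 < k * (1 - x / 2) := mul_pos hk (by linarith)
  have hkj' : 0 < k * (1 - x / 4) := mul_pos hk (by linarith)
  set I := ∫⁻ z in superlevel v (k * (1 - x / 2)) ρ θ x₀ t₀ (1 / 2 + x / 2),
    ENNReal.ofReal (v z ^ (D.calL + D.mMin)) with hI
  have hItop : I ≠ ⊤ := ne_top_of_le_ne_top (ENNReal.mul_ne_top ENNReal.ofReal_ne_top hS)
    (setLIntegral_superlevel_le hvm hkj hρ hθ x₀ t₀ (by linarith) hLs.le)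
  -- With x = 2^(-j) the ratio of consecutive levels is at most 1 - x/4, because 1 - x/2 ≤ (1 -
  -- x/4)^2.
  have hr : c * (x / 4) ≤ 1 - (k * (1 - x / 2) / (k * (1 - x / 4))) ^ D.mMin := by
    have h1 : k * (1 - x / 2) / (k * (1 - x / 4)) ≤ 1 - x / 4 := by
      rw [div_le_iff₀ hkj']
      nlinarith [mul_nonneg hk.le (sq_nonneg x)]
    have h2 := Real.rpow_le_rpow (by positivity) h1 hm.le
    have h3 := one_sub_rpow_le hm (x := x / 4) (by linarith) (by linarith)
    linarith
  -- The cylinders shrink by ε = x/4. The lowest level is k/2, which is why the one-step estimate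
  -- admits levels down to half of k₀.
  have hmain := hstep Ω T u v hΩ hu hvm hv0 huv ρ θ x₀ t₀ hρ hθ hsub k (k * (1 - x / 2))
    (k * (1 - x / 4)) (1 / 2 + x / 2) (x / 4) (c * (x / 4)) hk hR (by nlinarith) (by nlinarith)
    (by linarith) (by linarith) (by linarith) (by positivity) hr hItop
  rw [show 1 / 2 + x / 2 - x / 4 = 1 / 2 + x / 4 by ring] at hmain
  have hinter := setLIntegral_rpow_interp (μ := volume) (a := D.calM + D.mMin) (b := s)
    (measurableSet_superlevel hvm (k * (1 - x / 4)) ρ θ x₀ t₀ (1 / 2 + x / 4))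
    (superlevel_subset_cyl v _ hρ hθ x₀ t₀ (by linarith)) hvm
    (fun z hz => hkj'.trans hz.2) ht0.le ht1
  rw [hspec] at hinter
  have hbound : ∫⁻ z in superlevel v (k * (1 - x / 4)) ρ θ x₀ t₀ (1 / 2 + x / 4),
      ENNReal.ofReal (v z ^ (D.calL + D.mMin))
      ≤ (A₀ * ENNReal.ofReal ((1 / (c * (x / 4))) ^ e)
        * (ENNReal.ofReal ((1 / (x / 4)) ^ D.qMax * D.calH θ ρ) * I) ^ (1 + a)) ^ t
        * S ^ (1 - t) :=
    hinter.trans (by gcongr)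
  have htop : (A₀ * ENNReal.ofReal ((1 / (c * (x / 4))) ^ e)
        * (ENNReal.ofReal ((1 / (x / 4)) ^ D.qMax * D.calH θ ρ) * I) ^ (1 + a)) ^ t
        * S ^ (1 - t) ≠ ⊤ := by
    refine ENNReal.mul_ne_top (ENNReal.rpow_ne_top_of_nonneg ht0.le (ENNReal.mul_ne_top
      (ENNReal.mul_ne_top hA₀ ENNReal.ofReal_ne_top) (ENNReal.rpow_ne_top_of_nonneg (by positivity)
      (ENNReal.mul_ne_top ENNReal.ofReal_ne_top hItop))))
      (ENNReal.rpow_ne_top_of_nonneg (by linarith) hS)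
  have hreal := ENNReal.toReal_mono htop hbound
  rw [← hYj', ENNReal.toReal_mul, ← ENNReal.toReal_rpow, ← ENNReal.toReal_rpow, ENNReal.toReal_mul,
    ENNReal.toReal_mul, ← ENNReal.toReal_rpow, ENNReal.toReal_mul, ← hYj,
    ENNReal.toReal_ofReal (by positivity), ENNReal.toReal_ofReal (by positivity)] at hreal
  have hYj0 : 0 ≤ Y j := by rw [hYj]; exact ENNReal.toReal_nonneg
  have hS0 : 0 ≤ S.toReal := ENNReal.toReal_nonneg
  refine hreal.trans ?_
  calc _ ≤ ((A₀.toReal + 1) * (1 / (c * (x / 4))) ^ e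
          * ((1 / (x / 4)) ^ D.qMax * D.calH θ ρ * Y j) ^ (1 + a)) ^ t * S.toReal ^ (1 - t) := by
        gcongr
        linarith
    _ = _ := by
        rw [hx, iteration_factor_eq (by positivity) hc0 hH0 hYj0]
        ring

/-- Boundedness above a level that dominates the local `L^s` quantity. -/
theorem exists_ae_le_level {N : ℕ} {D : Exponents N} (hD : D.Admissible) {C s : ℝ}
    (hC : 0 < C) (hLM : D.calM ≤ D.calL) (hκ : 0 < D.kappa s) :
    ∃ γ : ℝ, 0 < γ ∧ ∀ (Ω : Set (Space N)) (T : ℝ) (u v : Space N × ℝ → ℝ),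
      IsOpen Ω → PDGPlus D C Ω T u → Measurable v → (∀ z, 0 ≤ v z) →
      (∀ᵐ z ∂(volume.restrict (spaceTime Ω T)), u z = v z) →
      ∀ (ρ : Fin N → ℝ) (θ : ℝ) (x₀ : Space N) (t₀ : ℝ), (∀ i, 0 < ρ i) → 0 < θ →
      cyl (fun i => 8 * ρ i) (8 * θ) x₀ t₀ ⊆ spaceTime Ω T →
      ∫⁻ z in cyl ρ θ x₀ t₀, ENNReal.ofReal (v z ^ s) ≠ ⊤ →
      ∀ k : ℝ, 0 < k → D.calR θ ρ ≤ k →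
      γ * (D.calH θ ρ ^ ((N + D.pBar) / D.pBar)
        * (∫⁻ z in cyl ρ θ x₀ t₀, ENNReal.ofReal (v z ^ s)).toReal) ^ (D.pBar / D.kappa s) ≤ k →
      ∀ᵐ z ∂(volume.restrict (cyl (fun i => ρ i / 2) (θ / 2) x₀ t₀)), v z ≤ k := by
  obtain ⟨A, b, hA, hb, hstep⟩ := exists_iteration_step hD hC hLM hκ
  have hpb := hD.pBar_pos
  have hN := hD.cast_pos
  have ht0 := hD.interp_pos hLM hκ
  have hLs := hD.calL_add_lt hLM hκ
  have hexp := hD.superlinear_exponent hLM hκ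
  have hsl : 0 < s - (D.calM + D.mMin) := by linarith
  set t := D.interp s with ht
  set l := D.calL + D.mMin with hl
  set a := D.pBar / N with ha
  have ha0 : 0 < a := by positivity
  have htdef : t * (s - (D.calM + D.mMin)) = s - l := by
    rw [ht, Exponents.interp, div_mul_cancel₀ _ hsl.ne']
  set δ := D.kappa s / (N * (s - (D.calM + D.mMin))) with hδ
  have hδ0 : 0 < δ := by positivity
  have hδ1 : (1 + a) * t = 1 + δ := by linarith
  have hE : 0 < (s - l) * δ := mul_pos (by linarith) hδ0
  set A' := A * b ^ (1 / δ) with hA'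
  have hb0 : 0 < b := by linarith
  have hA'0 : 0 < A' := by positivity
  -- The factor 2 compensates for starting at level k/2; the power solves A' P^((p/N) t) ≤
  -- (k/2)^((s-l)δ) for k, where P = 𝓗^((N+p)/p) S and l = 𝓛 + m.
  refine ⟨2 * A' ^ (1 / ((s - l) * δ)), by positivity, ?_⟩
  intro Ω T u v hΩ hu hvm hv0 huv ρ θ x₀ t₀ hρ hθ hsub hS k hk hR hγk
  have hst := hstep Ω T u v hΩ hu hvm hv0 huv ρ θ x₀ t₀ hρ hθ hsub hS k hk hR _ fun j => rfl
  have hH0 := Exponents.calH_nonneg (D := D) hθ hρ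
  set S := ∫⁻ z in cyl ρ θ x₀ t₀, ENNReal.ofReal (v z ^ s) with hSdef
  have hS0 : 0 ≤ S.toReal := ENNReal.toReal_nonneg
  set I : ℕ → ENNReal := fun j => ∫⁻ z in superlevel v (k * (1 - (1 / 2) ^ (j + 1))) ρ θ x₀ t₀
    (1 / 2 + (1 / 2) ^ (j + 1)), ENNReal.ofReal (v z ^ l) with hI
  have hx1 : ∀ j : ℕ, (1 / 2 : ℝ) ^ (j + 1) ≤ 1 / 2 := fun j => by
    rw [pow_succ]
    have : (1 / 2 : ℝ) ^ j ≤ 1 := pow_le_one₀ (by norm_num) (by norm_num)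
    linarith
  have hIle : ∀ j, I j ≤ ENNReal.ofReal ((k * (1 - (1 / 2) ^ (j + 1))) ^ (l - s)) * S := fun j =>
    setLIntegral_superlevel_le hvm (mul_pos hk (by linarith [hx1 j])) hρ hθ x₀ t₀
      (by linarith [hx1 j]) hLs.le
  have hItop : ∀ j, I j ≠ ⊤ := fun j =>
    ne_top_of_le_ne_top (ENNReal.mul_ne_top ENNReal.ofReal_ne_top hS) (hIle j)
  have hI0 : (I 0).toReal ≤ (k / 2) ^ (l - s) * S.toReal := by
    have h1 := ENNReal.toReal_mono (ENNReal.mul_ne_top ENNReal.ofReal_ne_top hS) (hIle 0)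
    rw [ENNReal.toReal_mul, zero_add, pow_one, show k * (1 - 1 / 2) = k / 2 by ring,
      ENNReal.toReal_ofReal (by positivity)] at h1
    exact h1
  rw [hδ1] at hst
  have hsmall : A * (D.calH θ ρ ^ (1 + δ) * S.toReal ^ (1 - t)) * b ^ (1 / δ)
      * (I 0).toReal ^ δ ≤ 1 := by
    set P := D.calH θ ρ ^ ((N + D.pBar) / D.pBar) * S.toReal with hP
    have hP0 : 0 ≤ P := by positivity
    have h1 : A' * P ^ (a * t) ≤ (k / 2) ^ ((s - l) * δ) := by
      have h2 : A' ^ (1 / ((s - l) * δ)) * P ^ (D.pBar / D.kappa s) ≤ k / 2 := by linarith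
      have h3 := Real.rpow_le_rpow (by positivity) h2 hE.le
      rw [Real.mul_rpow (by positivity) (by positivity), ← Real.rpow_mul hA'0.le,
        one_div_mul_cancel hE.ne', Real.rpow_one, ← Real.rpow_mul hP0] at h3
      convert h3 using 3
      rw [← htdef, hδ, ha]
      field_simp
    have h4 : D.calH θ ρ ^ (1 + δ) * S.toReal ^ (1 - t) * S.toReal ^ δ = P ^ (a * t) := by
      rw [hP, Real.mul_rpow (by positivity) hS0, ← Real.rpow_mul hH0, mul_assoc]
      congr 1
      · congr 1
        rw [← hδ1, ha]
        field_simp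
      -- The factor S^(1-t) of the recursion and the S^δ from Y_0 combine to the power of S in P^(a
      -- t).
      · have h5 : 1 - t + δ = a * t := by linarith
        rw [← h5, Real.rpow_add' hS0 (by rw [h5]; positivity)]
    calc A * (D.calH θ ρ ^ (1 + δ) * S.toReal ^ (1 - t)) * b ^ (1 / δ) * (I 0).toReal ^ δ
        ≤ A * (D.calH θ ρ ^ (1 + δ) * S.toReal ^ (1 - t)) * b ^ (1 / δ)
          * ((k / 2) ^ (l - s) * S.toReal) ^ δ := by gcongr
      _ = A' * (D.calH θ ρ ^ (1 + δ) * S.toReal ^ (1 - t) * S.toReal ^ δ)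
          * ((k / 2) ^ (l - s)) ^ δ := by
          rw [Real.mul_rpow (by positivity) hS0, hA']; ring
      _ = A' * P ^ (a * t) * ((k / 2) ^ ((s - l) * δ))⁻¹ := by
          rw [h4, ← Real.rpow_mul (by positivity), ← Real.rpow_neg (by positivity)]
          ring_nf
      _ ≤ 1 := by
          rw [← div_eq_mul_inv]
          exact (div_le_one (by positivity)).2 h1
  have hgeo := le_geometric_of_superlinear (y := fun j => (I j).toReal)
    (fun _ => ENNReal.toReal_nonneg) hb.le hδ0 (by positivity)
    (fun j => (hst j).trans (le_of_eq (by ring))) hsmall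
  have hlim : Tendsto (fun j => ((b ^ (1 / δ))⁻¹) ^ j * (I 0).toReal) atTop (𝓝 0) := by
    have h1 : (b ^ (1 / δ))⁻¹ < 1 := inv_lt_one_of_one_lt₀ (Real.one_lt_rpow hb (by positivity))
    simpa using (tendsto_pow_atTop_nhds_zero_of_lt_one (by positivity) h1).mul_const (I 0).toReal
  -- The half cylinder and the level k are the limits of the shrinking cylinders and rising levels,
  -- so this set lies in all of them and its integral is at most every Y_j.
  set F := cyl (fun i => ρ i / 2) (θ / 2) x₀ t₀ ∩ {z | k < v z} with hF
  have hFm : MeasurableSet F :=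
    (measurableSet_cyl _ _ _ _).inter (measurableSet_lt measurable_const hvm)
  have hFI : ∀ j, ∫⁻ z in F, ENNReal.ofReal (v z ^ l) ≤ I j := by
    intro j
    refine lintegral_mono_set (inter_subset_inter ?_ fun z (hz : k < v z) => ?_)
    · have hp : (0 : ℝ) < (1 / 2) ^ (j + 1) := by positivity
      refine cyl_mono (fun i => ?_) ?_ _ _
      · have := mul_pos hp (hρ i); linarith
      · have := mul_pos hp hθ; linarith
    · have hp : (0 : ℝ) < (1 / 2) ^ (j + 1) := by positivity
      have := mul_pos hk hp
      change k * (1 - (1 / 2) ^ (j + 1)) < v z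
      linarith
  have hzero : ∫⁻ z in F, ENNReal.ofReal (v z ^ l) = 0 := by
    have h0 : ∫⁻ z in F, ENNReal.ofReal (v z ^ l) ≠ ⊤ := ne_top_of_le_ne_top (hItop 0) (hFI 0)
    refine ((ENNReal.toReal_eq_zero_iff _).1 ?_).resolve_right h0
    refine le_antisymm (ge_of_tendsto' hlim fun j => ?_) ENNReal.toReal_nonneg
    exact (ENNReal.toReal_mono (hItop j) (hFI j)).trans (hgeo j)
  rw [lintegral_eq_zero_iff (hvm.pow_const l).ennreal_ofReal, EventuallyEq,
    ae_restrict_iff' hFm] at hzero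
  rw [ae_restrict_iff' (measurableSet_cyl _ _ _ _)]
  filter_upwards [hzero] with z hz hzc
  by_contra hvk
  rw [not_le] at hvk
  have h1 := hz ⟨hzc, hvk⟩
  have h2 : 0 < v z ^ l := Real.rpow_pos_of_pos (hk.trans hvk) _
  simp only [Pi.zero_apply, ENNReal.ofReal_eq_zero] at h1
  linarith

/-! ### Local boundedness and conclusion. -/

section LocalBound

variable {N : ℕ} {Ω : Set (Space N)} {T s θ t₀ : ℝ} {ρ : Fin N → ℝ} {x₀ : Space N}
  {u v : Space N × ℝ → ℝ}

theorem MemLpLoc.integrable_rpow (hs : 0 < s) (hu : MemLpLoc s Ω T u)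
    (hu0 : ∀ z ∈ spaceTime Ω T, 0 ≤ u z) (hρ : ∀ i, 0 < ρ i) (hθ : 0 < θ)
    (hsub : cyl (fun i => 8 * ρ i) (8 * θ) x₀ t₀ ⊆ spaceTime Ω T) :
    Integrable (fun z => u z ^ s) (volume.restrict (cyl ρ θ x₀ t₀)) := by
  obtain ⟨h1, h2, h3⟩ := cyl_subset_facts hρ hθ hsub
  have hK := hu (closedBox ρ x₀ ×ˢ Icc (t₀ - θ) t₀) ((isCompact_closedBox ρ x₀).prod isCompact_Icc)
    (prod_mono h1 fun t ht => ⟨h2.trans_le ht.1, ht.2.trans h3⟩)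
  have hcyl : cyl ρ θ x₀ t₀ ⊆ closedBox ρ x₀ ×ˢ Icc (t₀ - θ) t₀ :=
    prod_mono (fun x hx i => (hx i).le) Ioo_subset_Icc_self
  have hc : MemLp u (ENNReal.ofReal s) (volume.restrict (cyl ρ θ x₀ t₀)) :=
    hK.mono_measure (Measure.restrict_mono hcyl le_rfl)
  have hint := hc.integrable_norm_rpow (by simpa using hs) ENNReal.ofReal_ne_top
  rw [ENNReal.toReal_ofReal hs.le] at hint
  refine hint.congr ?_
  filter_upwards [ae_restrict_mem (measurableSet_cyl ρ θ x₀ t₀)] with z hz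
  have hz0 := hu0 z (prod_mono_right Ioo_subset_Ioc_self (cyl_subset_open hρ hθ hsub hz))
  rw [Real.norm_of_nonneg hz0]

/-- Points with time T are allowed, although cylinders are open at the top. The top time is then T
itself, and only the null slice at that time is lost. -/
theorem exists_cyl_mem_nhds (hΩ : IsOpen Ω) {z : Space N × ℝ} (hz : z ∈ spaceTime Ω T) :
    ∃ (ρ : Fin N → ℝ) (θ t₁ : ℝ), (∀ i, 0 < ρ i) ∧ 0 < θ ∧
      cyl (fun i => 8 * ρ i) (8 * θ) z.1 t₁ ⊆ spaceTime Ω T ∧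
      ∃ V ∈ 𝓝 z, ∀ᵐ z', z' ∈ V → z' ∈ spaceTime Ω T →
        z' ∈ cyl (fun i => ρ i / 2) (θ / 2) z.1 t₁ := by
  obtain ⟨y, τ⟩ := z
  obtain ⟨hy, hτ0, hτT⟩ := hz
  simp only at hy hτ0 hτT
  obtain ⟨r, hr, hball⟩ := Metric.isOpen_iff.1 hΩ y hy
  -- The eightfold cylinder has height τ/2, so it stays in positive time even though its top may be
  -- T; the half cylinder, of height τ/32, reaches below τ - τ/64.
  refine ⟨fun _ => r / 8, τ / 16, min (τ + τ / 64) T, fun _ => by positivity, by positivity, ?_, ?_⟩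
  · rintro ⟨x, t⟩ ⟨hx, ht1, ht2⟩
    simp only at hx ht1 ht2
    have h1 : τ ≤ min (τ + τ / 64) T := le_min (by linarith) hτT
    refine ⟨hball ?_, ?_, ?_⟩
    · rw [Metric.mem_ball, dist_pi_lt_iff hr]
      intro i
      have := hx i
      simp only at this
      rw [Real.dist_eq]
      linarith
    · change 0 < t; linarith
    · exact (ht2.trans_le (min_le_right _ _)).le
  · refine ⟨box (fun _ => r / 8 / 2) y ×ˢ Ioo (τ - τ / 64) (τ + τ / 64), ?_, ?_⟩
    · refine prod_mem_nhds ((isOpen_box _ _).mem_nhds fun i => ?_)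
        (Ioo_mem_nhds (by linarith) (by linarith))
      simp only [sub_self, abs_zero]
      positivity
    · have hnull : volume ((univ : Set (Space N)) ×ˢ {min (τ + τ / 64) T}) = 0 := by
        rw [Measure.volume_eq_prod, Measure.prod_prod, Real.volume_singleton, mul_zero]
      filter_upwards [measure_eq_zero_iff_ae_notMem.1 hnull] with ⟨x, t⟩ hne hV hzT
      refine ⟨hV.1, ?_, ?_⟩
      · have h1 := hV.2.1
        have h2 := min_le_left (τ + τ / 64) T
        simp only at h1 ⊢
        linarith
      · refine lt_of_le_of_ne (le_min hV.2.2.le hzT.2.2) fun h => hne ⟨mem_univ _, ?_⟩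
        exact h

theorem locallyBounded_of_cyl (hΩ : IsOpen Ω) (hu0 : ∀ z ∈ spaceTime Ω T, 0 ≤ u z)
    (hb : ∀ (x₀ : Space N) (t₀ : ℝ) (ρ : Fin N → ℝ) (θ : ℝ), (∀ i, 0 < ρ i) → 0 < θ →
      cyl (fun i => 8 * ρ i) (8 * θ) x₀ t₀ ⊆ spaceTime Ω T →
      ∃ B, ∀ᵐ z ∂(volume.restrict (cyl (fun i => ρ i / 2) (θ / 2) x₀ t₀)), u z ≤ B) :
    LocallyBounded Ω T u := by
  intro K hK hKΩ
  refine hK.induction_on (p := fun A => ∃ B : ℝ, ∀ᵐ z ∂(volume.restrict A), |u z| ≤ B)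
    ⟨0, by simp⟩ ?_ ?_ fun z hz => ?_
  · rintro A A' hAA' ⟨B, hB⟩
    exact ⟨B, ae_restrict_of_ae_restrict_of_subset hAA' hB⟩
  · rintro A A' ⟨B, hB⟩ ⟨B', hB'⟩
    refine ⟨max B B', ?_⟩
    rw [ae_restrict_union_iff]
    exact ⟨hB.mono fun z hz => hz.trans (le_max_left _ _),
      hB'.mono fun z hz => hz.trans (le_max_right _ _)⟩
  · obtain ⟨ρ, θ, t₁, hρ, hθ, hsub, V, hV, hVc⟩ := exists_cyl_mem_nhds hΩ (hKΩ hz)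
    obtain ⟨B, hB⟩ := hb z.1 t₁ ρ θ hρ hθ hsub
    refine ⟨K ∩ interior V, inter_mem_nhdsWithin K (interior_mem_nhds.2 hV), B, ?_⟩
    rw [ae_restrict_iff' (measurableSet_cyl _ _ _ _)] at hB
    rw [ae_restrict_iff' (hK.measurableSet.inter isOpen_interior.measurableSet)]
    filter_upwards [hB, hVc] with z' h1 h2 h3
    have hzT := hKΩ h3.1
    rw [abs_of_nonneg (hu0 z' hzT)]
    exact h1 (h2 (interior_subset h3.2) hzT)

end LocalBound

theorem theorem1p2 (N : ℕ) (D : Exponents N) (hD : D.Admissible) (C : ℝ) (hC : 0 < C)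
    (hLM : D.calM ≤ D.calL) (s : ℝ) (hs : D.mMin + 1 < s) (hκ : 0 < D.kappa s) :
    ∃ γ : ℝ, 0 < γ ∧
      ∀ (Ω : Set (Space N)) (T : ℝ) (u : Space N × ℝ → ℝ),
        IsOpen Ω → Bornology.IsBounded Ω → 0 < T →
        PDGPlus D C Ω T u → MemLpLoc s Ω T u →
        LocallyBounded Ω T u ∧
        ∀ (x₀ : Space N) (t₀ : ℝ) (ρ : Fin N → ℝ) (θ : ℝ), (∀ i, 0 < ρ i) → 0 < θ →
          cyl (fun i => 8 * ρ i) (8 * θ) x₀ t₀ ⊆ spaceTime Ω T →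
          ∀ᵐ z ∂(volume.restrict (cyl (fun i => ρ i / 2) (θ / 2) x₀ t₀)),
            u z ≤ γ * (D.calH θ ρ ^ ((N + D.pBar) / D.pBar)
                    * ∫ z in cyl ρ θ x₀ t₀, u z ^ s) ^ (D.pBar / D.kappa s)
                + D.calR θ ρ := by
  obtain ⟨γ, hγ, hlevel⟩ := exists_ae_le_level hD hC hLM hκ
  refine ⟨γ, hγ, fun Ω T u hΩ _ _ hu hus => ?_⟩
  have hs0 : 0 < s := by linarith [hD.mMin_pos]
  have hbound : ∀ (x₀ : Space N) (t₀ : ℝ) (ρ : Fin N → ℝ) (θ : ℝ), (∀ i, 0 < ρ i) → 0 < θ →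
      cyl (fun i => 8 * ρ i) (8 * θ) x₀ t₀ ⊆ spaceTime Ω T →
      ∀ᵐ z ∂(volume.restrict (cyl (fun i => ρ i / 2) (θ / 2) x₀ t₀)),
        u z ≤ γ * (D.calH θ ρ ^ ((N + D.pBar) / D.pBar)
          * ∫ z in cyl ρ θ x₀ t₀, u z ^ s) ^ (D.pBar / D.kappa s) + D.calR θ ρ := by
    intro x₀ t₀ ρ θ hρ hθ hsub
    obtain ⟨v, hvm, hv0, huv⟩ := hu.exists_measurable_rep hΩ
    have hcylT : cyl ρ θ x₀ t₀ ⊆ spaceTime Ω T :=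
      (cyl_subset_open hρ hθ hsub).trans (prod_mono_right Ioo_subset_Ioc_self)
    have huvc : ∀ᵐ z ∂(volume.restrict (cyl ρ θ x₀ t₀)), u z = v z :=
      ae_restrict_of_ae_restrict_of_subset hcylT huv
    have hint := hus.integrable_rpow hs0 hu.nonneg hρ hθ hsub
    have hintv : Integrable (fun z => v z ^ s) (volume.restrict (cyl ρ θ x₀ t₀)) :=
      hint.congr (by filter_upwards [huvc] with z hz; rw [hz])
    have hS : ∫⁻ z in cyl ρ θ x₀ t₀, ENNReal.ofReal (v z ^ s) ≠ ⊤ := hintv.lintegral_lt_top.ne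
    have hSeq : ∫ z in cyl ρ θ x₀ t₀, u z ^ s
        = (∫⁻ z in cyl ρ θ x₀ t₀, ENNReal.ofReal (v z ^ s)).toReal := by
      rw [← integral_eq_lintegral_of_nonneg_ae (ae_of_all _ fun z => Real.rpow_nonneg (hv0 z) s)
        hintv.1]
      exact integral_congr_ae (by filter_upwards [huvc] with z hz; rw [hz])
    rw [hSeq]
    have hH0 := Exponents.calH_nonneg (D := D) hθ hρ
    have hR0 := Exponents.calR_nonneg (D := D) hθ hρ
    set M := γ * (D.calH θ ρ ^ ((N + D.pBar) / D.pBar)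
      * (∫⁻ z in cyl ρ θ x₀ t₀, ENNReal.ofReal (v z ^ s)).toReal) ^ (D.pBar / D.kappa s) with hM
    have hM0 : 0 ≤ M := by positivity
    -- The level must be strictly positive, while the bound M + 𝓡 is only known to be non-negative;
    -- 1/(n+1) is added and then removed in the limit.
    have hall : ∀ n : ℕ, ∀ᵐ z ∂(volume.restrict (cyl (fun i => ρ i / 2) (θ / 2) x₀ t₀)),
        v z ≤ M + D.calR θ ρ + 1 / ((n : ℝ) + 1) := fun n => by
      have hn : 0 < 1 / ((n : ℝ) + 1) := by positivity
      exact hlevel Ω T u v hΩ hu hvm hv0 huv ρ θ x₀ t₀ hρ hθ hsub hS _ (by positivity)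
        (by linarith) (by linarith)
    have hhalf : cyl (fun i => ρ i / 2) (θ / 2) x₀ t₀ ⊆ cyl ρ θ x₀ t₀ :=
      cyl_mono (fun i => by linarith [hρ i]) (by linarith) _ _
    filter_upwards [ae_all_iff.2 hall, ae_restrict_of_ae_restrict_of_subset hhalf huvc]
      with z hz huvz
    rw [huvz]
    refine le_of_forall_pos_le_add fun ε hε => ?_
    obtain ⟨n, hn⟩ := exists_nat_one_div_lt hε
    linarith [hz n]
  exact ⟨locallyBounded_of_cyl hΩ hu.nonneg fun x₀ t₀ ρ θ hρ hθ hsub =>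
    ⟨_, hbound x₀ t₀ ρ θ hρ hθ hsub⟩, hbound⟩
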